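/- **Setting.** Let $\beta>0$, $p\in(0,1)$, $h\in\mathbb R$. For $N\in\mathbb N$ let $(J_{ij})_{1\le i<j\le N}$ be i.i.d. Bernoulli random variables with mean $p$ and joint law $\mathbb P_J$. For $\sigma\in\mathcal S_N=\{-1,1\}^N$ put $$H_N(\sigma)=-\frac1{Np}\sum_{i<j}J_{ij}\sigma_i\sigma_j-h\sum_i\sigma_i,\qquad Z_{\beta,N}=\sum_{\sigma}e^{-\beta H_N(\sigma)},\qquad \mu_{\beta,N}(\sigma)=\frac{e^{-\beta H_N(\sigma)}}{Z_{\beta,N}} .$$ For fixed $J$, let $(\sigma(t))_{t=0,1,2,\dots}$ be the Markov chain on $\mathcal S_N$ with transition probabilities $p_N(\sigma,\sigma')=\frac1N e^{-\beta\max(H_N(\sigma')-H_N(\sigma),0)}$ if $\sigma'$ differs from $\sigma$ in exactly one spin, $p_N(\sigma,\sigma')=0$ for all other $\sigma'\ne\sigma$, and $p_N(\sigma,\sigma)=1-\sum_{\eta\neq\sigma}p_N(\sigma,\eta)$; let $\mathbb P_\sigma$ be its law when started in $\sigma$, and $\tau_A=\inf\{t>0:\sigma(t)\in A\}$. For disjoint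 $A,B\subset\mathcal S_N$ let $h_{A,B}(\sigma)=\mathbb P_\sigma(\tau_A<\tau_B)$ for $\sigma\notin A\cup B$, $h_{A,B}=1$ on $A$ and $h_{A,B}=0$ on $B$. Let $f_\beta(m)=-\frac{m^2}2-hm+\frac1\beta\left(\frac{1-m}2\log\frac{1-m}2+\frac{1+m}2\log\frac{1+m}2\right)$. Assume $\beta>1$ and that $h>0$ is small enough that $f_\beta$ is a double well, that is, $m=\tanh(\beta(m+h))$ has exactly three solutions $m_-<m^*<m_+$, with $m_-,m_+$ local minimisers and $m^*$ a local maximiser of $f_\beta$. For every $N\ge1$ let $m_\pm(N)$ be a point of $\Gamma_N=\{-1,-1+\frac2N,\dots,1\}$ closest to $m_\pm$, and let $h^N_{m_-,m_+}=h_{A,B}$ with $A=\{\sigma:\frac1N\sum_i\sigma_i=m_-(N)\}$ and $B=\{\sigma:\frac1N\sum_i\sigma_i=m_+(N)\}$ (disjoint for large $N$). Call $(c_1,c_2)$, $c_1,c_2>0$, a *Talagrand pair* if for every $n$, all independent real random variables $X_1,\dots,X_n$ with $|X_i|\le K$ ($K>0$), every convex $G:\mathbb R^n\to\mathbb R$ that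 is $1$-Lipschitz for the Euclidean norm, and every $t\ge0$, $\mathbb P(|G(X)-\mathbb E\,G(X)|\ge tK)\le c_1e^{-c_2t^2}$. Put $$\alpha=\frac{\beta^2(1-p)}{4p},\qquad \kappa=\alpha+\sup_{\eta\in(0,1)}\left\{\log\eta-\frac{\beta\sqrt{2\alpha+\log\frac{c_1}{(1-\eta)^2}}}{p\sqrt{2c_2}}\right\}.$$ **Theorem 1.5.** Talagrand pairs exist. For every Talagrand pair $(c_1,c_2)$ there are constants $k_1,k>0$, depending on $c_1,c_2$ only, such that for all $p,\beta,h$ as above and every $s>0$, with $k_2=k\,p^2/\beta^2$, there are deterministic sequences $\varepsilon_N\to0$ and $\varepsilon'_N\to0$ (which may depend on $p,\beta,h,s$ and on the choice of $m_\pm(N)$) such that for all sufficiently large $N$ $$\mathbb P_J\left(\sum_{\sigma\in\mathcal S_N}\mu_{\beta,N}(\sigma)h^N_{m_-,m_+}(\sigma)\le e^{\alpha+s}\,\frac{e^{-\beta Nf_\beta(m_-)}(1+\varepsilon_N)}{Z_{\beta,N}\sqrt{(1-m_-^2)\,\beta f_\beta''(m_-)}}\right)\ge1-k_1e^{-k_2s^2}$$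 and $$\mathbb P_J\left(\sum_{\sigma\in\mathcal S_N}\mu_{\beta,N}(\sigma)h^N_{m_-,m_+}(\sigma)\ge e^{\kappa-s}\,\frac{e^{-\beta Nf_\beta(m_-)}(1+\varepsilon'_N)}{Z_{\beta,N}\sqrt{(1-m_-^2)\,\beta f_\beta''(m_-)}}\right)\ge1-k_1e^{-k_2s^2}.$$ -/

import Mathlib

open MeasureTheory ProbabilityTheory Filter Topology
open scoped ENNReal

noncomputable section

namespace RDCW

/-! ### Parameters, spins and couplings -/

/-- The parameters of the model: inverse temperature `β > 0`, mean coupling `p ∈ (0, 1)`,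
external field `h ∈ ℝ`. -/
structure Params where
  β : ℝ
  p : ℝ
  h : ℝ
  β_pos : 0 < β
  p_pos : 0 < p
  p_lt_one : p < 1

/-- Spin configurations on `N` vertices; `true` stands for the spin `+1`, `false` for `-1`. -/
abbrev Config (N : ℕ) : Type := Fin N → Bool

/-- The value `±1` of a spin. -/
def spin (b : Bool) : ℝ := if b then 1 else -1

/-- The unordered pairs of vertices, written as pairs `i < j`. -/
abbrev Pair (N : ℕ) : Type := {e : Fin N × Fin N // e.1 < e.2}

/-- A realisation of the couplings; `true` stands for `J i j = 1`, `false` for `J i j = 0`. -/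
abbrev Couplings (N : ℕ) : Type := Pair N → Bool

/-- The value `0` or `1` of a coupling. -/
def coupling (b : Bool) : ℝ := if b then 1 else 0

/-- The law of the couplings: independent Bernoulli variables with mean `p`. -/
def couplingLaw (M : Params) (N : ℕ) : Measure (Couplings N) :=
  Measure.pi fun _ => bernoulliMeasure true false ⟨M.p, M.p_pos.le, M.p_lt_one.le⟩

/-! ### Hamiltonian and Gibbs measure -/

/-- The Hamiltonian `H_N(σ) = -(1/(Np)) ∑_{i<j} J_{ij} σ_i σ_j - h ∑_i σ_i`. -/
def hamiltonian (M : Params) {N : ℕ} (J : Couplings N) (σ : Config N) : ℝ :=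
  -(1 / (N * M.p)) * ∑ e : Pair N, coupling (J e) * spin (σ e.1.1) * spin (σ e.1.2)
    - M.h * ∑ i, spin (σ i)

/-- The partition function `Z_{β,N}`. -/
def partitionFn (M : Params) {N : ℕ} (J : Couplings N) : ℝ :=
  ∑ σ : Config N, Real.exp (-M.β * hamiltonian M J σ)

/-- The Gibbs measure `μ_{β,N}(σ)`. -/
def gibbs (M : Params) {N : ℕ} (J : Couplings N) (σ : Config N) : ℝ :=
  Real.exp (-M.β * hamiltonian M J σ) / partitionFn M J

/-! ### Glauber dynamics with Metropolis rates -/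

/-- Flip the spin at vertex `i`. -/
def flip {N : ℕ} (σ : Config N) (i : Fin N) : Config N := Function.update σ i (!σ i)

open Classical in
/-- Transition probabilities between different configurations. -/
def jumpProb (M : Params) {N : ℕ} (J : Couplings N) (σ η : Config N) : ℝ :=
  if ∃ i, η = flip σ i then
    1 / N * Real.exp (-M.β * max (hamiltonian M J η - hamiltonian M J σ) 0)
  else 0

/-- The Metropolis transition probabilities `p_N(σ, η)`. -/
def transProb (M : Params) {N : ℕ} (J : Couplings N) (σ η : Config N) : ℝ :=
  if η = σ then 1 - ∑ ξ ∈ Finset.univ.erase σ, jumpProb M J σ ξ else jumpProb M J σ η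

lemma jumpProb_nonneg (M : Params) {N : ℕ} (J : Couplings N) (σ η : Config N) :
    0 ≤ jumpProb M J σ η := by
  unfold jumpProb
  split_ifs <;> positivity

lemma sum_jumpProb_le_one (M : Params) {N : ℕ} (J : Couplings N) (σ : Config N) :
    ∑ ξ ∈ Finset.univ.erase σ, jumpProb M J σ ξ ≤ 1 := by
  classical
  have hle : ∀ ξ, jumpProb M J σ ξ ≤ if ξ ∈ Finset.univ.image (flip σ) then 1 / (N : ℝ) else 0 := by
    intro ξ
    have hiff : (∃ i, ξ = flip σ i) ↔ ξ ∈ Finset.univ.image (flip σ) := by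
      simp [eq_comm]
    unfold jumpProb
    by_cases hx : ∃ i, ξ = flip σ i
    · rw [if_pos hx, if_pos (hiff.1 hx)]
      refine mul_le_of_le_one_right (by positivity) (Real.exp_le_one_iff.2 ?_)
      have := mul_nonneg M.β_pos.le (le_max_right (hamiltonian M J ξ - hamiltonian M J σ) 0)
      linarith
    · rw [if_neg hx, if_neg (fun hc => hx (hiff.2 hc))]
  calc ∑ ξ ∈ Finset.univ.erase σ, jumpProb M J σ ξ
      ≤ ∑ ξ, jumpProb M J σ ξ :=
        Finset.sum_le_sum_of_subset_of_nonneg (Finset.erase_subset _ _)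
          (fun _ _ _ => jumpProb_nonneg M J σ _)
    _ ≤ ∑ ξ, if ξ ∈ Finset.univ.image (flip σ) then 1 / (N : ℝ) else 0 :=
        Finset.sum_le_sum fun ξ _ => hle ξ
    _ = (Finset.univ.image (flip σ)).card * (1 / (N : ℝ)) := by
        rw [Finset.sum_ite_mem, Finset.univ_inter, Finset.sum_const, nsmul_eq_mul]
    _ ≤ N * (1 / (N : ℝ)) := by
        gcongr
        simpa using Finset.card_image_le (s := (Finset.univ : Finset (Fin N))) (f := flip σ)
    _ ≤ 1 := by
        rw [mul_one_div]
        exact div_self_le_one _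

lemma transProb_nonneg (M : Params) {N : ℕ} (J : Couplings N) (σ η : Config N) :
    0 ≤ transProb M J σ η := by
  unfold transProb
  split_ifs
  · exact sub_nonneg.2 (sum_jumpProb_le_one M J σ)
  · exact jumpProb_nonneg M J σ η

lemma sum_transProb (M : Params) {N : ℕ} (J : Couplings N) (σ : Config N) :
    ∑ η, transProb M J σ η = 1 := by
  rw [← Finset.add_sum_erase _ _ (Finset.mem_univ σ)]
  have : ∑ η ∈ Finset.univ.erase σ, transProb M J σ η
      = ∑ η ∈ Finset.univ.erase σ, jumpProb M J σ η :=
    Finset.sum_congr rfl fun η hη => by simp [transProb, Finset.ne_of_mem_erase hη]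
  rw [this]
  simp [transProb]

/-- The one-step transition kernel of the Glauber dynamics. -/
def glauberKernel (M : Params) {N : ℕ} (J : Couplings N) : Kernel (Config N) (Config N) :=
  Kernel.ofFunOfCountable fun σ =>
    ∑ η : Config N, ENNReal.ofReal (transProb M J σ η) • Measure.dirac η

instance (M : Params) {N : ℕ} (J : Couplings N) : IsMarkovKernel (glauberKernel M J) := by
  refine ⟨fun σ => ⟨?_⟩⟩
  change (∑ η : Config N, ENNReal.ofReal (transProb M J σ η) • Measure.dirac η) Set.univ = 1
  simp only [Measure.coe_finsetSum, Finset.sum_apply, Measure.smul_apply, measure_univ,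
    smul_eq_mul, mul_one]
  rw [← ENNReal.ofReal_sum_of_nonneg (fun η _ => transProb_nonneg M J σ η), sum_transProb,
    ENNReal.ofReal_one]

/-- The law, on the space of trajectories `ℕ → Config N`, of the Glauber dynamics started
in `σ` (for fixed couplings `J`). -/
def chainLaw (M : Params) {N : ℕ} (J : Couplings N) (σ : Config N) : Measure (ℕ → Config N) :=
  Kernel.traj (X := fun _ => Config N)
    (fun n => (glauberKernel M J).comap
      (fun x : (i : Finset.Iic n) → Config N => x ⟨n, Finset.mem_Iic.2 le_rfl⟩)
      (measurable_pi_apply _)) 0 (fun _ => σ)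

/-- The hitting time `τ_A = inf {t > 0 : σ(t) ∈ A}` (equal to `⊤` if `A` is never hit). -/
def hittingTime {N : ℕ} (A : Set (Config N)) (ω : ℕ → Config N) : ℕ∞ :=
  ⨅ (t : ℕ) (_ : 0 < t ∧ ω t ∈ A), (t : ℕ∞)

open Classical in
/-- The harmonic function `h_{A,B}`. -/
def harmonic (M : Params) {N : ℕ} (J : Couplings N) (A B : Set (Config N)) (σ : Config N) : ℝ :=
  if σ ∈ A then 1
  else if σ ∈ B then 0
  else (chainLaw M J σ).real {ω | hittingTime A ω < hittingTime B ω}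

/-! ### Magnetisation and Curie-Weiss free energy -/

/-- The empirical magnetisation. -/
def magnetisation {N : ℕ} (σ : Config N) : ℝ := 1 / N * ∑ i, spin (σ i)

/-- The grid `Γ_N = {-1, -1 + 2/N, …, 1}`. -/
def grid (N : ℕ) : Set ℝ := {x | ∃ k : ℕ, k ≤ N ∧ x = -1 + 2 * k / N}

/-- The configurations with magnetisation `m`. -/
def level (N : ℕ) (m : ℝ) : Set (Config N) := {σ | magnetisation σ = m}

/-- `x` is a point of `Γ_N` closest to `m`. -/
def IsClosestInGrid (N : ℕ) (m x : ℝ) : Prop :=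
  x ∈ grid N ∧ ∀ y ∈ grid N, |x - m| ≤ |y - m|

/-- The limiting entropy `I`. -/
def entropy (m : ℝ) : ℝ :=
  (1 - m) / 2 * Real.log ((1 - m) / 2) + (1 + m) / 2 * Real.log ((1 + m) / 2)

/-- The limiting free energy `f_β(m) = -m²/2 - h m + I(m)/β`. -/
def freeEnergy (M : Params) (m : ℝ) : ℝ := -m ^ 2 / 2 - M.h * m + M.β⁻¹ * entropy m

/-- The double-well regime: `m = tanh (β (m + h))` has exactly the three solutions
`m₋ < m⋆ < m₊`; the free energy has local minima at `m₋`, `m₊` and a local maximum (the saddle)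
at `m⋆`. -/
structure IsDoubleWell (M : Params) (mMinus mStar mPlus : ℝ) : Prop where
  lt_star : mMinus < mStar
  star_lt : mStar < mPlus
  critical : ∀ m : ℝ, m = Real.tanh (M.β * (m + M.h)) ↔ m = mMinus ∨ m = mStar ∨ m = mPlus
  isLocalMin_minus : IsLocalMin (freeEnergy M) mMinus
  isLocalMax_star : IsLocalMax (freeEnergy M) mStar
  isLocalMin_plus : IsLocalMin (freeEnergy M) mPlus

/-- The harmonic sum `∑_σ μ_{β,N}(σ) h_{A,B}(σ)` for `A`, `B` the configurations with
magnetisation `a`, `b` respectively. -/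
def harmonicSum (M : Params) {N : ℕ} (J : Couplings N) (a b : ℝ) : ℝ :=
  ∑ σ : Config N, gibbs M J σ * harmonic M J (level N a) (level N b) σ

/-- `exp (-β N f_β(m)) / (Z_{β,N} √((1 - m²) β f_β''(m)))`. -/
def wellWeight (M : Params) {N : ℕ} (J : Couplings N) (m : ℝ) : ℝ :=
  Real.exp (-M.β * N * freeEnergy M m) /
    (partitionFn M J * √((1 - m ^ 2) * (M.β * iteratedDeriv 2 (freeEnergy M) m)))

/-! ### The constants -/

/-- `c₁, c₂ > 0` are constants for which Talagrand's concentration inequality holds: for all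
independent random variables `X₁, …, X_n` bounded by `K`, all convex functions `G : ℝⁿ → ℝ` that
are `1`-Lipschitz for the Euclidean norm, and all `t ≥ 0`,
`P(|G(X) - E G(X)| ≥ t K) ≤ c₁ exp(-c₂ t²)`. -/
def IsTalagrandPair (c₁ c₂ : ℝ) : Prop :=
  0 < c₁ ∧ 0 < c₂ ∧
  ∀ (n : ℕ) (Ω : Type) (_ : MeasurableSpace Ω) (P : Measure Ω) (_ : IsProbabilityMeasure P)
    (X : Fin n → Ω → ℝ) (K : ℝ) (G : EuclideanSpace ℝ (Fin n) → ℝ) (t : ℝ),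
    (∀ i, Measurable (X i)) → iIndepFun X P → 0 < K → (∀ i ω, |X i ω| ≤ K) →
    LipschitzWith 1 G → ConvexOn ℝ Set.univ G → 0 ≤ t →
    P.real {ω | t * K ≤
        |G (WithLp.toLp 2 fun i => X i ω) - ∫ ω', G (WithLp.toLp 2 fun i => X i ω') ∂P|}
      ≤ c₁ * Real.exp (-c₂ * t ^ 2)

/-- `α = β² (1 - p) / (4 p)`. -/
def alpha (M : Params) : ℝ := M.β ^ 2 * (1 - M.p) / (4 * M.p)

/-- `κ = α + max_{η ∈ (0,1)} (log η - β √(2α + log (c₁ / (1-η)²)) / (p √(2 c₂)))`. -/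
def kappa (M : Params) (c₁ c₂ : ℝ) : ℝ :=
  alpha M + sSup ((fun η : ℝ =>
    Real.log η - M.β * √(2 * alpha M + Real.log (c₁ / (1 - η) ^ 2)) / (M.p * √(2 * c₂))) ''
      Set.Ioo 0 1)

end RDCW

end

open RDCW

/-!
The proof compares the harmonic sum with the partition function of the left well, and the latter
with its Curie-Weiss counterpart.

**Reduction.** As `k₁` and `k` may depend on the Talagrand pair, they can be chosen so that the
probability bounds are void unless `s ≥ L β / p`, for a constant `L` depending on `c₂` only. For such `s`, constant
factors and factors `exp (O(β / p))` are absorbed into `exp (± s / 4)`, so that neither sharp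
Laplace asymptotics nor sharp capacity asymptotics are needed, and the sequences `ε`, `ε'` can be
taken to be `0`.

**Talagrand pairs.** For independent bounded variables and a convex Lipschitz function, Maurey's
argument applies: an infimum-convolution inequality holds for each coordinate, tensorises
(`transport_pi`), and yields Gaussian concentration (`isTalagrandPair_two`).

**Concentration in the couplings.** For a set `S` of configurations, `partialZ M S` is the part of
the partition function carried by `S`, and `partialCW M S` the same quantity for the Curie-Weiss
Hamiltonian. Its first two moments are `partialCW M S` and its square up to factors bounded in
`N`, of which `exp α` comes from the variance of the couplings (`eventually_partialZ_moments`). Its logarithm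
is convex and `β / (p √2)`-Lipschitz in the couplings, so a Talagrand pair gives tails around its
mean. Jensen's inequality bounds this mean from above; the Paley-Zygmund inequality with level `η`
bounds it from below, and optimising over `η` produces `κ`
(`eventually_measure_partialZ_gt_le`, `eventually_measure_partialZ_lt_le`).

**Laplace method.** `partialCW` of the configurations with at most `k` up-spins is a sum of binomial
coefficients times exponentials. Stirling bounds and the quadratic behaviour of the free energy at
`m₋`, which is non-degenerate by Rolle's theorem, compare it with
`exp (-β N f(m₋)) / √((1 - m₋²) β f''(m₋))` (`IsDoubleWell.sum_levelWeight_le`,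
`IsDoubleWell.le_sum_levelWeight`).

**The harmonic function.** `h_{A,B}` is shown, from the path measure, to be harmonic off `A ∪ B`
for the Metropolis chain. As the chain moves by single flips, `h_{A,B} = 1` on all configurations
with fewer up-spins than `A`, which gives the lower bound. For the upper bound, `h_{A,B} ≤ 1` is
used up to the saddle. Beyond it, the average of `h_{A,B}` over a level is at most its energy
times the effective resistance from that level to `B`, up to a logarithm (`sum_level_harmonic_le`;
the logarithm comes from testing harmonicity against `log (h_{A,B} + δ)`, which controls the
energy of `√(h_{A,B} + δ)`). The Dirichlet principle bounds the energy by the weight of the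
saddle, and the resistance is governed by the first level, whose Boltzmann weights it cancels. So
the configurations beyond the saddle contribute about `exp (-β N f(m⋆))`, exponentially less than
the left well (`IsDoubleWell.exists_sum_beyond_saddle_le`). This only uses that the energies,
times `β`, are uniformly within `ε N` of their Curie-Weiss values, which holds with probability
tending to `1` by a Chernoff bound (`eventually_typicalCouplings`).
-/

namespace RDCW

/-! ### Concentration for convex Lipschitz functions of independent bounded variables -/

section LogIntegralExp

variable {α E : Type*} [MeasurableSpace α] {ν : Measure α} [NeZero ν]

/-- A logarithmic integral of exponentials of convex functions is convex. Normalising both integrals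
to `1` reduces the claim to the convexity of `exp`. -/
lemma convexOn_log_integral_exp [AddCommGroup E] [Module ℝ E] {q : E → α → ℝ}
    (hint : ∀ x, Integrable (fun y => Real.exp (q x y)) ν)
    (hq : ∀ y, ConvexOn ℝ Set.univ (fun x => q x y)) :
    ConvexOn ℝ Set.univ (fun x => Real.log (∫ y, Real.exp (q x y) ∂ν)) := by
  have hpos : ∀ x, 0 < ∫ y, Real.exp (q x y) ∂ν := fun x => integral_exp_pos (hint x)
  refine ⟨convex_univ, fun x _ x' _ a b ha hb hab => ?_⟩
  set A := Real.log (∫ y, Real.exp (q x y) ∂ν) with hA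
  set B := Real.log (∫ y, Real.exp (q x' y) ∂ν) with hB
  have hnorm : ∀ z, ∫ y, Real.exp (q z y - Real.log (∫ y, Real.exp (q z y) ∂ν)) ∂ν = 1 := by
    intro z
    simp_rw [Real.exp_sub, Real.exp_log (hpos z)]
    rw [integral_div, div_self (hpos z).ne']
  have hi : ∀ z, Integrable
      (fun y => Real.exp (q z y - Real.log (∫ y, Real.exp (q z y) ∂ν))) ν := by
    intro z
    simp_rw [Real.exp_sub]
    exact (hint z).div_const _
  have key : ∫ y, Real.exp (q (a • x + b • x') y - (a * A + b * B)) ∂ν ≤ 1 := by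
    calc ∫ y, Real.exp (q (a • x + b • x') y - (a * A + b * B)) ∂ν
        ≤ ∫ y, (a * Real.exp (q x y - A) + b * Real.exp (q x' y - B)) ∂ν := by
          refine integral_mono ?_ (((hi x).const_mul a).add ((hi x').const_mul b)) fun y => ?_
          · simp_rw [Real.exp_sub]
            exact (hint _).div_const _
          · have h1 := (hq y).2 (Set.mem_univ x) (Set.mem_univ x') ha hb hab
            have h2 := convexOn_exp.2 (Set.mem_univ (q x y - A)) (Set.mem_univ (q x' y - B))
              ha hb hab
            simp only [smul_eq_mul] at h1 h2
            refine le_trans (Real.exp_le_exp.2 ?_) h2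
            linarith
      _ = 1 := by
          rw [integral_add ((hi x).const_mul a) ((hi x').const_mul b), integral_const_mul,
            integral_const_mul, hnorm, hnorm, mul_one, mul_one, hab]
  simp_rw [Real.exp_sub] at key
  rw [integral_div, div_le_one (Real.exp_pos _)] at key
  simpa using (Real.log_le_iff_le_exp (hpos _)).2 key

lemma log_integral_exp_le_add {q q' : α → ℝ} {C : ℝ}
    (hint : Integrable (fun y => Real.exp (q y)) ν)
    (hint' : Integrable (fun y => Real.exp (q' y)) ν) (h : ∀ y, q y ≤ q' y + C) :
    Real.log (∫ y, Real.exp (q y) ∂ν) ≤ Real.log (∫ y, Real.exp (q' y) ∂ν) + C := by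
  rw [Real.log_le_iff_le_exp (integral_exp_pos hint), Real.exp_add,
    Real.exp_log (integral_exp_pos hint'), ← integral_mul_const]
  refine integral_mono hint (hint'.mul_const _) fun y => ?_
  rw [← Real.exp_add]
  exact Real.exp_le_exp.2 (h y)

end LogIntegralExp

lemma convexOn_iInf {E Z : Type*} [AddCommGroup E] [Module ℝ E] [AddCommGroup Z] [Module ℝ Z]
    {F : E → Z → ℝ} (hF : ∀ x x' z z' a b, 0 ≤ a → 0 ≤ b → a + b = 1 →
      F (a • x + b • x') (a • z + b • z') ≤ a * F x z + b * F x' z')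
    (hbdd : ∀ x, BddBelow (Set.range (F x))) :
    ConvexOn ℝ Set.univ (fun x => ⨅ z, F x z) := by
  refine ⟨convex_univ, fun x _ x' _ a b ha hb hab => ?_⟩
  simp only [smul_eq_mul]
  rw [← sub_le_iff_le_add', Real.mul_iInf_of_nonneg hb]
  refine le_ciInf fun z' => ?_
  rw [sub_le_iff_le_add', ← sub_le_iff_le_add, Real.mul_iInf_of_nonneg ha]
  refine le_ciInf fun z => ?_
  rw [sub_le_iff_le_add]
  exact (ciInf_le (hbdd _) (a • z + b • z')).trans (hF _ _ _ _ _ _ ha hb hab)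

/-- The scalar inequality behind the one-dimensional transport estimate: moving from height `u`
towards the minimum, at quadratic cost, is possible below the height `log (2 - e^{-u})`. -/
lemma exists_cost_le_log {u : ℝ} (hu : 0 ≤ u) :
    ∃ θ ∈ Set.Icc (0 : ℝ) 1, Real.exp ((1 - θ) * u + θ ^ 2 / 4) ≤ 2 - Real.exp (-u) := by
  have h1 : ∀ {x : ℝ}, 0 ≤ x → Real.exp (-x) ≤ 1 - x + x ^ 2 / 2 := by
    intro x hx
    have h2 : Real.exp (-x) * Real.exp x = 1 := by rw [← Real.exp_add]; simp
    have h3 := Real.quadratic_le_exp_of_nonneg hx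
    have h4 : 0 ≤ 1 - x + x ^ 2 / 2 := by nlinarith [sq_nonneg (x - 1)]
    have h5 := Real.exp_pos x
    by_contra hcon
    push Not at hcon
    have : (1 - x + x ^ 2 / 2) * (1 + x + x ^ 2 / 2) < 1 := by
      calc _ ≤ (1 - x + x ^ 2 / 2) * Real.exp x := by gcongr
        _ < Real.exp (-x) * Real.exp x := by gcongr
        _ = 1 := h2
    nlinarith [sq_nonneg (x ^ 2)]
  have hexp : ∀ {y : ℝ}, y < 1 → Real.exp y ≤ (1 - y)⁻¹ := by
    intro y hy
    rw [← neg_neg y, Real.exp_neg]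
    refine inv_anti₀ (by linarith) ?_
    have := Real.add_one_le_exp (-y)
    linarith
  rcases le_total u (1 / 2) with h | h
  · refine ⟨2 * u, ⟨by linarith, by linarith⟩, ?_⟩
    have e : (1 - 2 * u) * u + (2 * u) ^ 2 / 4 = u - u ^ 2 := by ring
    rw [e]
    have hy0 : 0 ≤ u - u ^ 2 := by nlinarith
    have h6 := Real.exp_bound' hy0 (by nlinarith) (n := 3) (by norm_num)
    norm_num [Finset.sum_range_succ, Nat.factorial] at h6
    have h7 : (u - u ^ 2) ^ 3 ≤ u ^ 3 := by
      gcongr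
      nlinarith
    have h8 : 0 ≤ u ^ 3 * (1 / 2 - u) := mul_nonneg (by positivity) (by linarith)
    have := h1 hu
    nlinarith
  · refine ⟨1, ⟨by norm_num, le_rfl⟩, ?_⟩
    have h8 : Real.exp (-u) ≤ Real.exp (-(1 / 2)) := Real.exp_le_exp.2 (by linarith)
    have h9 : Real.exp (-(1 / 2)) ≤ 1 - 1 / 2 + (1 / 2) ^ 2 / 2 := h1 (by norm_num)
    have h10 : Real.exp ((1 - 1) * u + 1 ^ 2 / 4) ≤ (1 - 1 / 4)⁻¹ := by
      convert hexp (y := 1 / 4) (by norm_num) using 2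
      ring
    norm_num at h9 h10 ⊢
    linarith

/-- The quadratic cost on `ℝ` satisfies the convex form of Maurey's infimum-convolution inequality
for measures on an interval of length `2 K`. -/
lemma transport_real {μ : Measure ℝ} [IsProbabilityMeasure μ] {K : ℝ} (hK : 0 < K)
    (hμ : ∀ᵐ x ∂μ, x ∈ Set.Icc (-K) K) {φ ψ : ℝ → ℝ} (hφ : ConvexOn ℝ Set.univ φ)
    (hφc : Continuous φ) (hψc : Continuous ψ)
    (h : ∀ x y, ψ x ≤ φ y + (x - y) ^ 2 / (16 * K ^ 2)) :
    (∫ x, Real.exp (ψ x) ∂μ) * (∫ x, Real.exp (-φ x) ∂μ) ≤ 1 := by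
  have hint : ∀ {g : ℝ → ℝ}, Continuous g → Integrable g μ := by
    intro g hg
    obtain ⟨C, hC⟩ := (isCompact_Icc (a := -K) (b := K)).exists_bound_of_continuousOn hg.continuousOn
    exact Integrable.of_bound hg.aestronglyMeasurable C (hμ.mono fun x hx => hC x hx)
  obtain ⟨z, hz, hzmin⟩ := (isCompact_Icc (a := -K) (b := K)).exists_isMinOn
    ⟨0, by constructor <;> linarith⟩ hφc.continuousOn
  have hpt : ∀ x ∈ Set.Icc (-K) K,
      Real.exp (ψ x) ≤ Real.exp (φ z) * (2 - Real.exp (φ z) * Real.exp (-φ x)) := by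
    intro x hx
    have hu : 0 ≤ φ x - φ z := sub_nonneg.2 (hzmin hx)
    obtain ⟨θ, ⟨hθ0, hθ1⟩, hθ⟩ := exists_cost_le_log hu
    have hc := hφ.2 (Set.mem_univ x) (Set.mem_univ z) (sub_nonneg.2 hθ1) hθ0 (by ring)
    have hh := h x ((1 - θ) • x + θ • z)
    simp only [smul_eq_mul] at hc hh
    have hcost : (x - ((1 - θ) * x + θ * z)) ^ 2 / (16 * K ^ 2) ≤ θ ^ 2 / 4 := by
      have e : (x - ((1 - θ) * x + θ * z)) ^ 2 = θ ^ 2 * (x - z) ^ 2 := by ring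
      have hxz : (x - z) ^ 2 ≤ (2 * K) ^ 2 := by
        rw [sq_le_sq, abs_of_pos (by positivity : 0 < 2 * K), abs_le]
        constructor <;> linarith [hx.1, hx.2, hz.1, hz.2]
      rw [e, div_le_iff₀ (by positivity)]
      nlinarith [mul_le_mul_of_nonneg_left hxz (sq_nonneg θ)]
    calc Real.exp (ψ x) ≤ Real.exp (φ z + ((1 - θ) * (φ x - φ z) + θ ^ 2 / 4)) := by
          refine Real.exp_le_exp.2 ?_
          linarith
      _ = Real.exp (φ z) * Real.exp ((1 - θ) * (φ x - φ z) + θ ^ 2 / 4) := Real.exp_add _ _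
      _ ≤ Real.exp (φ z) * (2 - Real.exp (φ z) * Real.exp (-φ x)) := by
          have e : Real.exp (φ z) * Real.exp (-φ x) = Real.exp (-(φ x - φ z)) := by
            rw [← Real.exp_add]
            congr 1
            ring
          rw [e]
          gcongr
  have i2 : Integrable (fun x => Real.exp (-φ x)) μ := hint (Real.continuous_exp.comp hφc.neg)
  set v := ∫ x, Real.exp (-φ x) ∂μ with hv
  have hv0 : 0 ≤ v := integral_nonneg fun _ => (Real.exp_pos _).le
  have h1 : ∫ x, Real.exp (ψ x) ∂μ ≤ Real.exp (φ z) * (2 - Real.exp (φ z) * v) := by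
    calc ∫ x, Real.exp (ψ x) ∂μ
        ≤ ∫ x, Real.exp (φ z) * (2 - Real.exp (φ z) * Real.exp (-φ x)) ∂μ := by
          refine integral_mono_ae (hint (Real.continuous_exp.comp hψc)) ?_ (hμ.mono hpt)
          exact ((integrable_const _).sub (i2.const_mul _)).const_mul _
      _ = _ := by
          rw [integral_const_mul, integral_sub (integrable_const _) (i2.const_mul _),
            integral_const_mul, integral_const]
          simp [hv]
  calc _ ≤ Real.exp (φ z) * (2 - Real.exp (φ z) * v) * v := by gcongr
    _ ≤ 1 := by nlinarith [sq_nonneg (Real.exp (φ z) * v - 1)]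

section Product

variable {n : ℕ} {μ : Fin n → Measure ℝ} [∀ i, IsProbabilityMeasure (μ i)] {K : ℝ}

lemma integrable_pi_of_continuous (hμ : ∀ i, ∀ᵐ x ∂μ i, x ∈ Set.Icc (-K) K)
    {g : (Fin n → ℝ) → ℝ} (hg : Continuous g) : Integrable g (Measure.pi μ) := by
  obtain ⟨C, hC⟩ := (isCompact_Icc (a := fun _ : Fin n => -K)
    (b := fun _ : Fin n => K)).exists_bound_of_continuousOn hg.continuousOn
  have hae : ∀ᵐ x ∂Measure.pi μ, ∀ i, x i ∈ Set.Icc (-K) K :=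
    eventually_all.2 fun i => (Measure.tendsto_eval_ae_ae (μ := μ) (i := i)).eventually (hμ i)
  refine Integrable.of_bound hg.aestronglyMeasurable C (hae.mono fun x hx => hC x ?_)
  exact ⟨fun i => (hx i).1, fun i => (hx i).2⟩

end Product

lemma dist_cons_le {n : ℕ} (x x' : ℝ) (y y' : Fin n → ℝ) :
    dist (Fin.cons x y : Fin (n + 1) → ℝ) (Fin.cons x' y' : Fin (n + 1) → ℝ)
      ≤ max (dist x x') (dist y y') := by
  rw [dist_pi_le_iff (le_max_of_le_left dist_nonneg)]
  intro i
  refine Fin.cases ?_ (fun j => ?_) i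
  · simp
  · simpa using le_max_of_le_right (dist_le_pi_dist y y' j)

lemma cons_combo {n : ℕ} (a b x x' : ℝ) (y y' : Fin n → ℝ) :
    (Fin.cons (a • x + b • x') (a • y + b • y') : Fin (n + 1) → ℝ)
      = a • (Fin.cons x y : Fin (n + 1) → ℝ) + b • (Fin.cons x' y' : Fin (n + 1) → ℝ) := by
  ext i
  refine Fin.cases ?_ (fun j => ?_) i <;> simp

lemma integral_pi_succ {n : ℕ} {μ : Fin (n + 1) → Measure ℝ} [∀ i, IsProbabilityMeasure (μ i)]
    {g : (Fin (n + 1) → ℝ) → ℝ} (hg : Integrable g (Measure.pi μ)) :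
    ∫ x, g x ∂Measure.pi μ
      = ∫ x0, ∫ y, g (Fin.cons x0 y) ∂(Measure.pi fun i => μ (Fin.succ i)) ∂(μ 0) := by
  have hmp := (measurePreserving_piFinSuccAbove μ 0).symm
  rw [← hmp.integral_comp', integral_prod]
  · simp [MeasurableEquiv.piFinSuccAbove, Fin.insertNthEquiv]
  · exact (hmp.integrable_comp_emb (MeasurableEquiv.measurableEmbedding _)).2 hg

/-- Maurey's convex infimum-convolution inequality for product measures on a cube. The inductive step
replaces `f` by the logarithmic integral, over all coordinates but one, of its infimum convolution
in these coordinates; this is again convex. -/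
lemma transport_pi {K : ℝ} (hK : 0 < K) : ∀ {n : ℕ} {μ : Fin n → Measure ℝ}
    [∀ i, IsProbabilityMeasure (μ i)] (_ : ∀ i, ∀ᵐ x ∂μ i, x ∈ Set.Icc (-K) K)
    {f g : (Fin n → ℝ) → ℝ} {L : ℝ} (_ : 0 ≤ L) (_ : ConvexOn ℝ Set.univ f)
    (_ : ∀ x y, |f x - f y| ≤ L * dist x y) (_ : ∀ x y, |g x - g y| ≤ L * dist x y)
    (_ : ∀ x y, g x ≤ f y + (∑ i, (x i - y i) ^ 2) / (16 * K ^ 2)),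
    (∫ x, Real.exp (g x) ∂Measure.pi μ) * (∫ x, Real.exp (-f x) ∂Measure.pi μ) ≤ 1 := by
  have hcont : ∀ {m : ℕ} {f : (Fin m → ℝ) → ℝ} {L : ℝ}, 0 ≤ L →
      (∀ x y, |f x - f y| ≤ L * dist x y) → Continuous f := by
    intro m f L hL h
    refine (LipschitzWith.of_dist_le_mul (K := L.toNNReal) fun x y => ?_).continuous
    rw [Real.coe_toNNReal _ hL]
    exact h x y
  intro n
  induction n with
  | zero =>
    intro μ _ hμ f g L hL hf hfL hgL h
    have h0 : ∀ x : Fin 0 → ℝ, x = Fin.elim0 := fun x => Subsingleton.elim _ _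
    have e1 : ∀ F : (Fin 0 → ℝ) → ℝ, ∫ x, F x ∂Measure.pi μ = F Fin.elim0 := by
      intro F
      have : F = fun _ => F Fin.elim0 := by
        funext x
        rw [h0 x]
      rw [this]
      simp
    rw [e1, e1, ← Real.exp_add, Real.exp_le_one_iff]
    have := h Fin.elim0 Fin.elim0
    simp at this
    linarith
  | succ n ih =>
    intro μ _ hμ f g L hL hf hfL hgL h
    have hfc := hcont hL hfL
    have hgc := hcont hL hgL
    set ν : Measure (Fin n → ℝ) := Measure.pi fun i => μ (Fin.succ i) with hν
    have hμ' : ∀ i : Fin n, ∀ᵐ x ∂μ (Fin.succ i), x ∈ Set.Icc (-K) K := fun i => hμ _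
    -- `F x₀ y z` is minimised over the displacement `z` of the last `n` coordinates.
    set F : ℝ → (Fin n → ℝ) → (Fin n → ℝ) → ℝ := fun x0 y z =>
      f (Fin.cons x0 (y + z)) + (∑ i, z i ^ 2) / (16 * K ^ 2) with hF
    set q : ℝ → (Fin n → ℝ) → ℝ := fun x0 y => ⨅ z, F x0 y z with hq
    have hcons : ∀ x0 x0' (y y' : Fin n → ℝ), |f (Fin.cons x0 y) - f (Fin.cons x0' y')|
        ≤ L * max (dist x0 x0') (dist y y') := fun x0 x0' y y' =>
      (hfL _ _).trans (by gcongr; exact dist_cons_le _ _ _ _)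
    have hbdd : ∀ x0 y, BddBelow (Set.range (F x0 y)) := by
      intro x0 y
      refine ⟨f (Fin.cons x0 y) - 4 * L ^ 2 * K ^ 2, ?_⟩
      rintro _ ⟨z, rfl⟩
      have h1 := (abs_le.1 (hcons x0 x0 (y + z) y)).1
      have h2 : max (dist x0 x0) (dist (y + z) y) = ‖z‖ := by simp
      have h3 : ‖z‖ ^ 2 ≤ ∑ i, z i ^ 2 := by
        have h4 : ‖z‖ ≤ √(∑ i, z i ^ 2) := by
          rw [pi_norm_le_iff_of_nonneg (Real.sqrt_nonneg _)]
          intro i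
          rw [Real.norm_eq_abs]
          refine Real.abs_le_sqrt ?_
          exact Finset.single_le_sum (f := fun i => z i ^ 2) (fun i _ => sq_nonneg _)
            (Finset.mem_univ i)
        have h5 := Real.sq_sqrt (Finset.sum_nonneg fun i (_ : i ∈ Finset.univ) => sq_nonneg (z i))
        nlinarith [norm_nonneg z]
      have h6 : L * ‖z‖ ≤ ‖z‖ ^ 2 / (16 * K ^ 2) + 4 * L ^ 2 * K ^ 2 := by
        rw [div_add' _ _ _ (by positivity), le_div_iff₀ (by positivity)]
        nlinarith [sq_nonneg (‖z‖ - 8 * L * K ^ 2)]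
      have h7 : ‖z‖ ^ 2 / (16 * K ^ 2) ≤ (∑ i, z i ^ 2) / (16 * K ^ 2) := by gcongr
      simp only [hF]
      rw [h2] at h1
      linarith
    have hqL : ∀ x0 x0' y y', q x0 y ≤ q x0' y' + L * max (dist x0 x0') (dist y y') := by
      intro x0 x0' y y'
      rw [← sub_le_iff_le_add]
      refine le_ciInf fun z => ?_
      rw [sub_le_iff_le_add]
      refine (ciInf_le (hbdd x0 y) z).trans ?_
      have h1 := (abs_le.1 (hcons x0 x0' (y + z) (y' + z))).2
      rw [dist_add_right] at h1
      simp only [hF]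
      linarith
    have hqle : ∀ x0 y y', q x0 y ≤ f (Fin.cons x0 y') + (∑ i, (y i - y' i) ^ 2) / (16 * K ^ 2) := by
      intro x0 y y'
      refine (ciInf_le (hbdd x0 y) (y' - y)).trans (le_of_eq ?_)
      simp only [hF, add_sub_cancel, Pi.sub_apply]
      congr 2
      exact Finset.sum_congr rfl fun i _ => by ring
    have hqL1 : ∀ x0 (y y' : Fin n → ℝ), |q x0 y - q x0 y'| ≤ L * dist y y' := by
      intro x0 y y'
      have h1 := hqL x0 x0 y y'
      have h2 := hqL x0 x0 y' y
      rw [dist_comm y' y] at h2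
      simp only [dist_self, dist_nonneg, sup_of_le_right] at h1 h2
      rw [abs_le]
      constructor <;> linarith
    have hqconv : ∀ y, ConvexOn ℝ Set.univ (fun x0 => q x0 y) := by
      intro y
      refine convexOn_iInf (fun x x' z z' a b ha hb hab => ?_) (fun x => hbdd x y)
      have e1 : y + (a • z + b • z') = a • (y + z) + b • (y + z') := by
        rw [smul_add, smul_add, add_add_add_comm, ← add_smul, hab, one_smul]
      have h1 := hf.2 (Set.mem_univ (Fin.cons x (y + z) : Fin (n + 1) → ℝ))
        (Set.mem_univ (Fin.cons x' (y + z') : Fin (n + 1) → ℝ)) ha hb hab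
      rw [← cons_combo, ← e1] at h1
      have h2 : ∑ i, (a • z + b • z') i ^ 2 ≤ a * ∑ i, z i ^ 2 + b * ∑ i, z' i ^ 2 := by
        rw [Finset.mul_sum, Finset.mul_sum, ← Finset.sum_add_distrib]
        refine Finset.sum_le_sum fun i _ => ?_
        have hb' : b = 1 - a := by linarith
        simp only [Pi.add_apply, Pi.smul_apply, smul_eq_mul]
        subst hb'
        nlinarith [mul_nonneg (mul_nonneg ha hb) (sq_nonneg (z i - z' i))]
      have h3 := div_le_div_of_nonneg_right h2 (by positivity : 0 ≤ 16 * K ^ 2)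
      simp only [hF]
      simp only [smul_eq_mul] at h1 h3 ⊢
      rw [add_div] at h3
      calc _ ≤ _ := add_le_add h1 h3
        _ = _ := by ring
    have hconsc : ∀ x0 : ℝ, Continuous fun y : Fin n → ℝ => (Fin.cons x0 y : Fin (n + 1) → ℝ) := by
      intro x0
      exact continuous_const.finCons continuous_id
    have iq : ∀ x0, Integrable (fun y => Real.exp (q x0 y)) ν := fun x0 =>
      integrable_pi_of_continuous hμ' (Real.continuous_exp.comp (hcont hL (hqL1 x0)))
    have ig : ∀ x0, Integrable (fun y => Real.exp (g (Fin.cons x0 y))) ν := fun x0 =>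
      integrable_pi_of_continuous hμ' (Real.continuous_exp.comp (hgc.comp (hconsc x0)))
    have iif : ∀ x0, Integrable (fun y => Real.exp (-f (Fin.cons x0 y))) ν := fun x0 =>
      integrable_pi_of_continuous hμ' (Real.continuous_exp.comp (hfc.comp (hconsc x0)).neg)
    set φ : ℝ → ℝ := fun x0 => Real.log (∫ y, Real.exp (q x0 y) ∂ν) with hφ
    set ψ : ℝ → ℝ := fun x0 => Real.log (∫ y, Real.exp (g (Fin.cons x0 y)) ∂ν) with hψ
    have hφconv : ConvexOn ℝ Set.univ φ := convexOn_log_integral_exp iq hqconv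
    have hcont1 : ∀ {θ : ℝ → ℝ}, (∀ x y, θ x ≤ θ y + L * dist x y) → Continuous θ := by
      intro θ hθ
      refine (LipschitzWith.of_dist_le_mul (K := L.toNNReal) fun x y => ?_).continuous
      have h1 := hθ x y
      have h2 := hθ y x
      rw [dist_comm y x] at h2
      rw [Real.dist_eq, abs_le, Real.coe_toNNReal _ hL]
      constructor <;> linarith
    have hφc : Continuous φ := hcont1 fun x y => by
      refine log_integral_exp_le_add (iq x) (iq y) fun z => ?_
      simpa using hqL x y z z
    have hψc : Continuous ψ := hcont1 fun x y => by
      refine log_integral_exp_le_add (ig x) (ig y) fun z => ?_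
      have h1 := (abs_le.1 (hgL (Fin.cons x z) (Fin.cons y z))).2
      have h2 := mul_le_mul_of_nonneg_left (dist_cons_le x y z z) hL
      simp only [dist_self, dist_nonneg, sup_of_le_left] at h2
      linarith
    have hψφ : ∀ x y, ψ x ≤ φ y + (x - y) ^ 2 / (16 * K ^ 2) := by
      intro x y
      refine log_integral_exp_le_add (ig x) (iq y) fun z => ?_
      rw [← sub_le_iff_le_add]
      refine le_ciInf fun w => ?_
      have h1 := h (Fin.cons x z) (Fin.cons y (z + w))
      rw [Fin.sum_univ_succ] at h1
      simp only [Fin.cons_zero, Fin.cons_succ, Pi.add_apply] at h1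
      have e2 : ∑ i, (z i - (z i + w i)) ^ 2 = ∑ i, w i ^ 2 :=
        Finset.sum_congr rfl fun i _ => by ring
      rw [e2, add_div] at h1
      simp only [hF]
      linarith
    have h1d := transport_real hK (hμ 0) hφconv hφc hψc hψφ
    have eψ : ∀ x, Real.exp (ψ x) = ∫ y, Real.exp (g (Fin.cons x y)) ∂ν := fun x =>
      Real.exp_log (integral_exp_pos (ig x))
    have hfφ : ∀ x, ∫ y, Real.exp (-f (Fin.cons x y)) ∂ν ≤ Real.exp (-φ x) := by
      intro x
      have h1 := ih (μ := fun i => μ (Fin.succ i)) hμ' (f := fun y => f (Fin.cons x y))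
        (g := q x) hL ?_ ?_ (hqL1 x) (hqle x)
      · rw [Real.exp_neg, ← one_div, le_div_iff₀ (Real.exp_pos _), mul_comm,
          Real.exp_log (integral_exp_pos (iq x))]
        exact h1
      · refine ⟨convex_univ, fun y _ y' _ a b ha hb hab => ?_⟩
        have h2 := hf.2 (Set.mem_univ (Fin.cons x y : Fin (n + 1) → ℝ))
          (Set.mem_univ (Fin.cons x y' : Fin (n + 1) → ℝ)) ha hb hab
        rw [← cons_combo, ← add_smul, hab, one_smul] at h2
        exact h2
      · intro y y'
        simpa using hcons x x y y'
    rw [integral_pi_succ (g := fun x => Real.exp (g x))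
        (integrable_pi_of_continuous hμ (Real.continuous_exp.comp hgc)),
      integral_pi_succ (g := fun x => Real.exp (-f x))
        (integrable_pi_of_continuous hμ (Real.continuous_exp.comp hfc.neg))]
    refine le_trans ?_ h1d
    simp_rw [eψ]
    refine mul_le_mul_of_nonneg_left ?_
      (integral_nonneg fun x => integral_nonneg fun y => (Real.exp_pos _).le)
    have hi0 : Integrable (fun x => Real.exp (-φ x)) (μ 0) := by
      have hc := Real.continuous_exp.comp hφc.neg
      obtain ⟨C, hC⟩ := (isCompact_Icc (a := -K) (b := K)).exists_bound_of_continuousOn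
        hc.continuousOn
      exact Integrable.of_bound hc.aestronglyMeasurable C ((hμ 0).mono fun x hx => hC x hx)
    exact integral_mono_of_nonneg
      (ae_of_all _ fun x => integral_nonneg fun y => (Real.exp_pos _).le) hi0 (ae_of_all _ hfφ)

/-- The two-sided exponential moment bound: for a convex `1`-Lipschitz `G`, the infimum-convolution
inequality is applied to `λ G`, whose infimum convolution is at least `λ G - 4 λ² K²`. -/
lemma integral_exp_mul_integral_exp_neg_le {n : ℕ} {μ : Fin n → Measure ℝ}
    [∀ i, IsProbabilityMeasure (μ i)] {K : ℝ} (hK : 0 < K)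
    (hμ : ∀ i, ∀ᵐ x ∂μ i, x ∈ Set.Icc (-K) K) {G : EuclideanSpace ℝ (Fin n) → ℝ}
    (hG : LipschitzWith 1 G) (hGc : ConvexOn ℝ Set.univ G) {l : ℝ} (hl : 0 ≤ l) :
    (∫ x, Real.exp (l * G (WithLp.toLp 2 x)) ∂Measure.pi μ) *
      (∫ x, Real.exp (-(l * G (WithLp.toLp 2 x))) ∂Measure.pi μ)
      ≤ Real.exp (4 * l ^ 2 * K ^ 2) := by
  have hlip : ∀ x y, |G x - G y| ≤ dist x y := fun x y => by
    have := hG.dist_le_mul x y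
    rwa [NNReal.coe_one, one_mul, Real.dist_eq] at this
  obtain ⟨C, hC⟩ : ∃ C : ℝ, 0 ≤ C ∧ ∀ x y : Fin n → ℝ,
      dist (WithLp.toLp 2 x : EuclideanSpace ℝ (Fin n)) (WithLp.toLp 2 y) ≤ C * dist x y :=
    ⟨_, NNReal.coe_nonneg _, fun x y =>
      (PiLp.lipschitzWith_toLp 2 (fun _ : Fin n => ℝ)).dist_le_mul x y⟩
  have hL : ∀ x y : Fin n → ℝ, |l * G (WithLp.toLp 2 x) - l * G (WithLp.toLp 2 y)|
      ≤ l * C * dist x y := by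
    intro x y
    rw [← mul_sub, abs_mul, abs_of_nonneg hl, mul_assoc]
    exact mul_le_mul_of_nonneg_left ((hlip _ _).trans (hC.2 x y)) hl
  have key := transport_pi hK hμ (f := fun x => l * G (WithLp.toLp 2 x))
    (g := fun x => l * G (WithLp.toLp 2 x) - 4 * l ^ 2 * K ^ 2) (L := l * C)
    (mul_nonneg hl hC.1) ?_ hL ?_ ?_
  · simp_rw [Real.exp_sub, integral_div] at key
    rwa [div_mul_eq_mul_div, div_le_one (Real.exp_pos _)] at key
  · refine ⟨convex_univ, fun x _ y _ a b ha hb hab => ?_⟩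
    have := hGc.2 (Set.mem_univ (WithLp.toLp 2 x)) (Set.mem_univ (WithLp.toLp 2 y)) ha hb hab
    simp only [smul_eq_mul, WithLp.toLp_add, WithLp.toLp_smul] at this ⊢
    nlinarith
  · intro x y
    simpa using hL x y
  · intro x y
    have h1 := (le_abs_self _).trans (hlip (WithLp.toLp 2 x) (WithLp.toLp 2 y))
    have h2 : dist (WithLp.toLp 2 x : EuclideanSpace ℝ (Fin n)) (WithLp.toLp 2 y) ^ 2
        = ∑ i, (x i - y i) ^ 2 := by
      rw [EuclideanSpace.dist_eq, Real.sq_sqrt (Finset.sum_nonneg fun i _ => sq_nonneg _)]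
      exact Finset.sum_congr rfl fun i _ => by rw [Real.dist_eq, sq_abs]
    rw [← h2]
    set r := dist (WithLp.toLp 2 x : EuclideanSpace ℝ (Fin n)) (WithLp.toLp 2 y)
    have h3 : l * r ≤ 4 * l ^ 2 * K ^ 2 + r ^ 2 / (16 * K ^ 2) := by
      rw [add_div' _ _ _ (by positivity), le_div_iff₀ (by positivity)]
      nlinarith [sq_nonneg (r - 8 * l * K ^ 2)]
    have h4 := mul_le_mul_of_nonneg_left h1 hl
    linarith

/-- A Chernoff bound from the two-sided exponential moment bound; by Jensen's inequality each of the
two moments is at least the exponential of the mean, which centres the other one. -/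
lemma measure_abs_sub_integral_ge_le {Ω : Type*} [MeasurableSpace Ω] {P : Measure Ω}
    [IsProbabilityMeasure P] {Y : Ω → ℝ} {K : ℝ} (hK : 0 < K) (hY : Integrable Y P)
    (hexp : ∀ l : ℝ, Integrable (fun ω => Real.exp (l * Y ω)) P)
    (h : ∀ l : ℝ, 0 ≤ l → (∫ ω, Real.exp (l * Y ω) ∂P) * (∫ ω, Real.exp (-(l * Y ω)) ∂P)
      ≤ Real.exp (4 * l ^ 2 * K ^ 2)) {t : ℝ} (ht : 0 ≤ t) :
    P.real {ω | t * K ≤ |Y ω - ∫ ω', Y ω' ∂P|} ≤ 2 * Real.exp (-(1 / 16) * t ^ 2) := by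
  set m := ∫ ω', Y ω' ∂P with hm
  have jensen : ∀ l : ℝ, Real.exp (l * m) ≤ ∫ ω, Real.exp (l * Y ω) ∂P := by
    intro l
    have := convexOn_exp.map_integral_le (μ := P) (f := fun ω => l * Y ω)
      Real.continuous_exp.continuousOn isClosed_univ (by simp) (hY.const_mul l) (hexp l)
    rwa [integral_const_mul] at this
  have hneg : ∀ l : ℝ, ∫ ω, Real.exp (-(l * Y ω)) ∂P = ∫ ω, Real.exp (-l * Y ω) ∂P := by
    intro l
    simp_rw [neg_mul]
  set l := t / (8 * K) with hl
  have hl0 : 0 ≤ l := by positivity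
  have hval : -l * (t * K) + 4 * l ^ 2 * K ^ 2 = -(1 / 16) * t ^ 2 := by
    rw [hl]
    field_simp
    ring
  have hsq := h l hl0
  rw [hneg] at hsq
  have up : P.real {ω | t * K ≤ Y ω - m} ≤ Real.exp (-(1 / 16) * t ^ 2) := by
    have hi : Integrable (fun ω => Real.exp (l * (Y ω - m))) P := by
      simp_rw [mul_sub, Real.exp_sub]
      exact (hexp l).div_const _
    refine (measure_ge_le_exp_mul_mgf (X := fun ω => Y ω - m) (t * K) hl0 hi).trans ?_
    rw [← hval, Real.exp_add, mgf]
    gcongr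
    simp_rw [mul_sub, Real.exp_sub]
    rw [integral_div, div_le_iff₀ (Real.exp_pos _)]
    have h1 := mul_le_mul_of_nonneg_left (jensen (-l)) (integral_nonneg (μ := P)
      fun ω => (Real.exp_pos (l * Y ω)).le)
    have h2 := h1.trans hsq
    have h3 : Real.exp (-l * m) * Real.exp (l * m) = 1 := by rw [← Real.exp_add]; simp
    calc ∫ ω, Real.exp (l * Y ω) ∂P
        = (∫ ω, Real.exp (l * Y ω) ∂P) * Real.exp (-l * m) * Real.exp (l * m) := by
          rw [mul_assoc, h3, mul_one]
      _ ≤ _ := by gcongr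
  have down : P.real {ω | t * K ≤ -(Y ω - m)} ≤ Real.exp (-(1 / 16) * t ^ 2) := by
    have e0 : ∀ ω, Real.exp (l * -(Y ω - m)) = Real.exp (-l * Y ω) * Real.exp (l * m) := by
      intro ω
      rw [← Real.exp_add]
      congr 1
      ring
    have hi : Integrable (fun ω => Real.exp (l * -(Y ω - m))) P := by
      simp_rw [e0]
      exact (hexp (-l)).mul_const _
    refine (measure_ge_le_exp_mul_mgf (X := fun ω => -(Y ω - m)) (t * K) hl0 hi).trans ?_
    rw [← hval, Real.exp_add, mgf]
    gcongr
    simp_rw [e0]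
    rw [integral_mul_const]
    have h1 := mul_le_mul_of_nonneg_right (jensen l) (integral_nonneg (μ := P)
      fun ω => (Real.exp_pos (-l * Y ω)).le)
    rw [mul_comm]
    exact h1.trans hsq
  have hsub : {ω | t * K ≤ |Y ω - m|} ⊆ {ω | t * K ≤ Y ω - m} ∪ {ω | t * K ≤ -(Y ω - m)} := by
    intro ω hω
    simp only [Set.mem_ofPred_eq, Set.mem_union] at hω ⊢
    exact le_abs.1 hω
  calc P.real {ω | t * K ≤ |Y ω - m|}
      ≤ P.real ({ω | t * K ≤ Y ω - m} ∪ {ω | t * K ≤ -(Y ω - m)}) := measureReal_mono hsub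
    _ ≤ _ := measureReal_union_le _ _
    _ ≤ _ := by linarith

/-- Talagrand's concentration inequality, with the constants `2` and `1 / 16`. -/
lemma isTalagrandPair_two : IsTalagrandPair 2 (1 / 16) := by
  refine ⟨by norm_num, by norm_num, ?_⟩
  intro n Ω _ P _ X K G t hX hind hK hbd hG hGc ht
  have hmap : Measure.map (fun ω i => X i ω) P = Measure.pi fun i => Measure.map (X i) P :=
    hind.map_fun_eq_pi_map fun i => (hX i).aemeasurable
  have hprob : ∀ i, IsProbabilityMeasure (Measure.map (X i) P) := fun i =>
    Measure.isProbabilityMeasure_map (hX i).aemeasurable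
  have hXm : Measurable fun ω i => X i ω := measurable_pi_lambda _ hX
  have hμ : ∀ i, ∀ᵐ x ∂Measure.map (X i) P, x ∈ Set.Icc (-K) K := fun i => by
    rw [ae_map_iff (p := fun x => x ∈ Set.Icc (-K) K) (hX i).aemeasurable
      (measurableSet_Icc (a := -K) (b := K))]
    exact ae_of_all _ fun ω => abs_le.1 (hbd i ω)
  have hGcont : Continuous fun x : Fin n → ℝ => G (WithLp.toLp 2 x) :=
    hG.continuous.comp (PiLp.continuous_toLp 2 _)
  have tr : ∀ {g : (Fin n → ℝ) → ℝ}, Continuous g → Integrable (fun ω => g fun i => X i ω) P := by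
    intro g hg
    have := integrable_pi_of_continuous hμ hg
    rw [← hmap] at this
    exact this.comp_measurable hXm
  have tri : ∀ {g : (Fin n → ℝ) → ℝ}, Continuous g → ∫ ω, g (fun i => X i ω) ∂P
      = ∫ x, g x ∂Measure.pi fun i => Measure.map (X i) P := by
    intro g hg
    rw [← hmap, integral_map hXm.aemeasurable hg.aestronglyMeasurable]
  have hce : ∀ l : ℝ, Continuous fun x : Fin n → ℝ => Real.exp (l * G (WithLp.toLp 2 x)) :=
    fun l => Real.continuous_exp.comp (continuous_const.mul hGcont)
  have hce' : ∀ l : ℝ, Continuous fun x : Fin n → ℝ => Real.exp (-(l * G (WithLp.toLp 2 x))) :=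
    fun l => Real.continuous_exp.comp (continuous_const.mul hGcont).neg
  refine measure_abs_sub_integral_ge_le hK (tr hGcont) (fun l => tr (hce l)) (fun l hl => ?_) ht
  rw [tri (hce l), tri (hce' l)]
  exact integral_exp_mul_integral_exp_neg_le hK hμ hG hGc hl

/-! ### The harmonic function of the Glauber dynamics -/

section Chain

variable {M : Params} {N : ℕ} {J : Couplings N}

instance (σ : Config N) : IsProbabilityMeasure (chainLaw M J σ) := by
  unfold chainLaw
  infer_instance

lemma glauberKernel_singleton (σ η : Config N) :
    glauberKernel M J σ {η} = ENNReal.ofReal (transProb M J σ η) := by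
  change (∑ η : Config N, ENNReal.ofReal (transProb M J σ η) • Measure.dirac η) {η} = _
  simp only [Measure.coe_finsetSum, Finset.sum_apply, Measure.smul_apply, smul_eq_mul]
  rw [Finset.sum_eq_single η]
  · simp
  · intro b _ hb
    simp [Measure.dirac_apply' _ (measurableSet_singleton _), hb]
  · simp

/-- The trajectories that agree with `x` up to time `n`. -/
def pathCylinder (n : ℕ) (x : ℕ → Config N) : Set (ℕ → Config N) := {ω | ∀ i ≤ n, ω i = x i}

lemma chainLaw_pathCylinder_zero (σ : Config N) (x : ℕ → Config N) :
    chainLaw M J σ (pathCylinder 0 x) = if x 0 = σ then 1 else 0 := by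
  have h1 : pathCylinder 0 x = Preorder.frestrictLe (π := fun _ => Config N) 0 ⁻¹'
      {fun _ => x 0} := by
    ext ω
    simp only [pathCylinder, Nat.le_zero, Set.mem_ofPred_eq, forall_eq, Set.mem_preimage,
      Set.mem_singleton_iff]
    constructor
    · intro h
      funext i
      obtain ⟨i, hi⟩ := i
      have : i = 0 := by simpa using hi
      subst this
      exact h
    · intro h
      exact congrFun h ⟨0, by simp⟩
  rw [h1, ← Measure.map_apply (by fun_prop) (measurableSet_singleton _), chainLaw,
    Kernel.traj_map_frestrictLe_apply, Kernel.partialTraj_self, Kernel.id_apply,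
    Measure.dirac_apply' _ (measurableSet_singleton _)]
  by_cases h : x 0 = σ
  · simp [h]
  · rw [if_neg h, Set.indicator_of_notMem]
    intro hc
    exact h (congrFun hc ⟨0, by simp⟩).symm

lemma chainLaw_pathCylinder_succ (σ : Config N) (n : ℕ) (x : ℕ → Config N) :
    chainLaw M J σ (pathCylinder (n + 1) x) = chainLaw M J σ (pathCylinder n x) *
      ENNReal.ofReal (transProb M J (x n) (x (n + 1))) := by
  have h1 : pathCylinder (n + 1) x = (fun ω : ℕ → Config N =>
      (Preorder.frestrictLe (π := fun _ => Config N) n ω, ω (n + 1))) ⁻¹'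
      ({Preorder.frestrictLe n x} ×ˢ {x (n + 1)}) := by
    ext ω
    simp only [pathCylinder, Set.mem_ofPred_eq, Set.mem_preimage, Set.mem_prod,
      Set.mem_singleton_iff]
    constructor
    · intro h
      refine ⟨funext fun i => h i ((Finset.mem_Iic.1 i.2).trans (Nat.le_succ n)), h _ le_rfl⟩
    · rintro ⟨h, h'⟩ i hi
      rcases hi.lt_or_eq with hi | rfl
      · exact congrFun h ⟨i, Finset.mem_Iic.2 (Nat.lt_succ_iff.1 hi)⟩
      · exact h'
  have h2 : pathCylinder n x = Preorder.frestrictLe (π := fun _ => Config N) n ⁻¹'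
      {Preorder.frestrictLe n x} := by
    ext ω
    simp only [pathCylinder, Set.mem_ofPred_eq, Set.mem_preimage, Set.mem_singleton_iff]
    constructor
    · intro h
      exact funext fun i => h i (Finset.mem_Iic.1 i.2)
    · intro h i hi
      exact congrFun h ⟨i, Finset.mem_Iic.2 hi⟩
  rw [h1, h2, ← Measure.map_apply (by fun_prop)
      ((measurableSet_singleton _).prod (measurableSet_singleton _)),
    ← Measure.map_apply (by fun_prop) (measurableSet_singleton _), chainLaw,
    ← Kernel.partialTraj_compProd_eq_map_traj (Nat.zero_le n), Kernel.traj_map_frestrictLe_apply,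
    Measure.compProd_apply_prod (measurableSet_singleton _) (measurableSet_singleton _),
    lintegral_singleton, mul_comm, Kernel.comap_apply, glauberKernel_singleton]
  rfl

lemma chainLaw_pathCylinder (σ : Config N) (n : ℕ) (x : ℕ → Config N) :
    chainLaw M J σ (pathCylinder n x) = (if x 0 = σ then 1 else 0) *
      ∏ i ∈ Finset.range n, ENNReal.ofReal (transProb M J (x i) (x (i + 1))) := by
  induction n with
  | zero => simp [chainLaw_pathCylinder_zero]
  | succ n ih => rw [chainLaw_pathCylinder_succ, ih, Finset.prod_range_succ, mul_assoc]

lemma ae_chainLaw_zero (σ : Config N) : ∀ᵐ ω ∂chainLaw M J σ, ω 0 = σ := by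
  have h := chainLaw_pathCylinder_zero (M := M) (J := J) σ (fun _ => σ)
  have h2 : pathCylinder 0 (fun _ => σ) = {ω : ℕ → Config N | ω 0 = σ} := by
    ext ω
    simp [pathCylinder]
  rw [h2, if_pos rfl] at h
  exact (prob_compl_eq_zero_iff ((measurableSet_singleton σ).preimage (measurable_pi_apply 0))).2 h

lemma measurableSet_pathCylinder (n : ℕ) (x : ℕ → Config N) :
    MeasurableSet (pathCylinder n x) := by
  have : pathCylinder n x = ⋂ i, ⋂ (_ : i ≤ n), (fun ω : ℕ → Config N => ω i) ⁻¹' {x i} := by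
    ext ω
    simp [pathCylinder]
  rw [this]
  exact MeasurableSet.iInter fun i => MeasurableSet.iInter fun _ =>
    (measurableSet_singleton _).preimage (measurable_pi_apply i)

lemma measure_ext_of_pathCylinder {μ ν : Measure (ℕ → Config N)} [IsFiniteMeasure μ]
    [IsFiniteMeasure ν] (h : ∀ n x, μ (pathCylinder n x) = ν (pathCylinder n x)) : μ = ν := by
  have hp : IsProjectiveMeasureFamily (fun I : Finset ℕ => ν.map I.restrict) :=
    isProjectiveMeasureFamily_map_restrict fun t => (measurable_pi_apply t).aemeasurable
  have hν : IsProjectiveLimit ν (fun I : Finset ℕ => ν.map I.restrict) := fun I => rfl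
  have hμ : IsProjectiveLimit μ (fun I : Finset ℕ => ν.map I.restrict) := by
    rw [isProjectiveLimit_nat_iff hp]
    intro n
    refine Measure.ext_of_singleton fun y => ?_
    have hy : ∃ x : ℕ → Config N, Preorder.frestrictLe (π := fun _ => Config N) n x = y :=
      ⟨fun i => if hi : i ≤ n then y ⟨i, Finset.mem_Iic.2 hi⟩ else fun _ => true, by
        funext i
        simp [Preorder.frestrictLe, Finset.mem_Iic.1 i.2]⟩
    obtain ⟨x, rfl⟩ := hy
    have h2 : pathCylinder n x = Preorder.frestrictLe (π := fun _ => Config N) n ⁻¹'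
        {Preorder.frestrictLe n x} := by
      ext ω
      simp only [pathCylinder, Set.mem_ofPred_eq, Set.mem_preimage, Set.mem_singleton_iff]
      constructor
      · intro h
        exact funext fun i => h i (Finset.mem_Iic.1 i.2)
      · intro h i hi
        exact congrFun h ⟨i, Finset.mem_Iic.2 hi⟩
    rw [Measure.map_apply (by fun_prop) (measurableSet_singleton _), ← h2]
    change _ = ν.map (Preorder.frestrictLe (π := fun _ => Config N) n) _
    rw [Measure.map_apply (by fun_prop) (measurableSet_singleton _), ← h2, h]
  exact hμ.unique hν

/-- The Markov property at time `1`. -/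
lemma chainLaw_map_shift (σ : Config N) :
    (chainLaw M J σ).map (fun ω t => ω (t + 1))
      = ∑ η : Config N, ENNReal.ofReal (transProb M J σ η) • chainLaw M J η := by
  have hm : Measurable fun (ω : ℕ → Config N) t => ω (t + 1) :=
    measurable_pi_lambda _ fun t => measurable_pi_apply (t + 1)
  have hf : IsFiniteMeasure
      (∑ η : Config N, ENNReal.ofReal (transProb M J σ η) • chainLaw M J η) := by
    refine ⟨?_⟩
    simp only [Measure.coe_finsetSum, Finset.sum_apply, Measure.smul_apply, smul_eq_mul,
      measure_univ, mul_one]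
    exact ENNReal.sum_lt_top.2 fun _ _ => ENNReal.ofReal_lt_top
  have hf' : IsFiniteMeasure ((chainLaw M J σ).map (fun ω t => ω (t + 1))) :=
    Measure.isFiniteMeasure_map _ _
  refine measure_ext_of_pathCylinder fun n x => ?_
  rw [Measure.map_apply hm (measurableSet_pathCylinder n x)]
  have h1 : chainLaw M J σ ((fun (ω : ℕ → Config N) t => ω (t + 1)) ⁻¹' pathCylinder n x)
      = chainLaw M J σ (pathCylinder (n + 1) (fun t => Nat.casesOn t σ x)) := by
    refine measure_congr ((ae_chainLaw_zero σ).mono fun ω hω => ?_)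
    refine propext ⟨fun h i hi => ?_, fun h i hi => h (i + 1) (by omega)⟩
    cases i with
    | zero => exact hω
    | succ i => exact h i (by omega)
  rw [h1, chainLaw_pathCylinder, Finset.prod_range_succ']
  simp only [Measure.coe_finsetSum, Finset.sum_apply, Measure.smul_apply, smul_eq_mul]
  rw [Finset.sum_eq_single (x 0)]
  · rw [chainLaw_pathCylinder]
    simp [mul_comm]
  · intro η _ hη
    rw [chainLaw_pathCylinder, if_neg (Ne.symm hη)]
    simp
  · simp

/-- The trajectories that visit `A`, at a time `t ≥ 0`, without having visited `B`. -/
def reachesBefore (A B : Set (Config N)) : Set (ℕ → Config N) :=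
  {ω | ∃ t, ω t ∈ A ∧ ∀ s ≤ t, ω s ∉ B}

lemma measurableSet_reachesBefore (A B : Set (Config N)) :
    MeasurableSet (reachesBefore A B) := by
  have : reachesBefore A B = ⋃ t, ((fun ω : ℕ → Config N => ω t) ⁻¹' A ∩
      ⋂ s, ⋂ (_ : s ≤ t), (fun ω : ℕ → Config N => ω s) ⁻¹' Bᶜ) := by
    ext ω
    simp [reachesBefore]
  rw [this]
  exact MeasurableSet.iUnion fun t => ((Set.toFinite A).measurableSet.preimage
    (measurable_pi_apply t)).inter (MeasurableSet.iInter fun s => MeasurableSet.iInter fun _ =>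
      (Set.toFinite Bᶜ).measurableSet.preimage (measurable_pi_apply s))

lemma hittingTime_lt_iff {A B : Set (Config N)} (ω : ℕ → Config N) :
    hittingTime A ω < hittingTime B ω ↔ (fun t => ω (t + 1)) ∈ reachesBefore A B := by
  unfold hittingTime reachesBefore
  constructor
  · intro h
    obtain ⟨t, ht⟩ := iInf_lt_iff.1 h
    obtain ⟨⟨ht0, htA⟩, ht⟩ := iInf_lt_iff.1 ht
    obtain ⟨t, rfl⟩ := Nat.exists_eq_succ_of_ne_zero ht0.ne'
    refine ⟨t, htA, fun s hs hsB => ?_⟩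
    have h1 : (⨅ (t : ℕ) (_ : 0 < t ∧ ω t ∈ B), (t : ℕ∞)) ≤ ((s + 1 : ℕ) : ℕ∞) :=
      iInf₂_le (s + 1) ⟨Nat.succ_pos s, hsB⟩
    have h2 := ht.trans_le h1
    have h3 : t + 1 < s + 1 := by exact_mod_cast h2
    omega
  · rintro ⟨t, htA, htB⟩
    have h1 : (⨅ (t : ℕ) (_ : 0 < t ∧ ω t ∈ A), (t : ℕ∞)) ≤ ((t + 1 : ℕ) : ℕ∞) :=
      iInf₂_le (t + 1) ⟨Nat.succ_pos t, htA⟩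
    have h2 : ((t + 2 : ℕ) : ℕ∞) ≤ ⨅ (t : ℕ) (_ : 0 < t ∧ ω t ∈ B), (t : ℕ∞) := by
      refine le_iInf₂ fun s hs => ?_
      obtain ⟨s, rfl⟩ := Nat.exists_eq_succ_of_ne_zero hs.1.ne'
      have : ¬ s ≤ t := fun hst => htB s hst hs.2
      exact_mod_cast (by omega : t + 2 ≤ s + 1)
    refine h1.trans_lt (lt_of_lt_of_le ?_ h2)
    exact_mod_cast Nat.lt_succ_self _

lemma harmonic_eq_reachesBefore {A B : Set (Config N)} (hAB : Disjoint A B) (σ : Config N) :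
    harmonic M J A B σ = (chainLaw M J σ).real (reachesBefore A B) := by
  have h0 := ae_chainLaw_zero (M := M) (J := J) σ
  unfold harmonic
  split_ifs with hA hB
  · have : reachesBefore A B =ᵐ[chainLaw M J σ] Set.univ := by
      refine h0.mono fun ω hω => ?_
      refine eq_true ⟨0, by rwa [hω], fun s hs => ?_⟩
      rw [Nat.le_zero.1 hs, hω]
      exact Set.disjoint_left.1 hAB hA
    rw [measureReal_congr this]
    simp
  · have : reachesBefore A B =ᵐ[chainLaw M J σ] (∅ : Set (ℕ → Config N)) := by
      refine h0.mono fun ω hω => ?_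
      refine eq_false ?_
      rintro ⟨t, _, ht⟩
      exact ht 0 (Nat.zero_le _) (by rwa [hω])
    rw [measureReal_congr this]
    simp
  · refine measureReal_congr (h0.mono fun ω hω => ?_)
    refine propext ((hittingTime_lt_iff ω).trans ⟨?_, ?_⟩)
    · rintro ⟨t, htA, htB⟩
      refine ⟨t + 1, htA, fun s hs => ?_⟩
      cases s with
      | zero => rwa [hω]
      | succ s => exact htB s (by omega)
    · rintro ⟨t, htA, htB⟩
      cases t with
      | zero => exact absurd (hω ▸ htA) hA
      | succ t => exact ⟨t, htA, fun s hs => htB (s + 1) (by omega)⟩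

lemma harmonic_nonneg {A B : Set (Config N)} (σ : Config N) :
    0 ≤ harmonic M J A B σ := by
  unfold harmonic
  split_ifs <;> positivity

lemma harmonic_le_one {A B : Set (Config N)} (σ : Config N) :
    harmonic M J A B σ ≤ 1 := by
  unfold harmonic
  split_ifs
  exacts [le_rfl, zero_le_one, measureReal_le_one]

/-- The mean value property of the harmonic function off `A ∪ B`. -/
lemma harmonic_eq_sum {A B : Set (Config N)} (hAB : Disjoint A B) {σ : Config N} (hA : σ ∉ A)
    (hB : σ ∉ B) :
    harmonic M J A B σ = ∑ η, transProb M J σ η * harmonic M J A B η := by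
  have hm : Measurable fun (ω : ℕ → Config N) t => ω (t + 1) :=
    measurable_pi_lambda _ fun t => measurable_pi_apply (t + 1)
  have h1 : harmonic M J A B σ
      = ((chainLaw M J σ).map fun ω t => ω (t + 1)).real (reachesBefore A B) := by
    rw [harmonic, if_neg hA, if_neg hB, measureReal_def, measureReal_def,
      Measure.map_apply hm (measurableSet_reachesBefore A B)]
    congr 2
    ext ω
    exact hittingTime_lt_iff ω
  rw [h1, chainLaw_map_shift, measureReal_def]
  simp only [Measure.coe_finsetSum, Finset.sum_apply, Measure.smul_apply, smul_eq_mul]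
  rw [ENNReal.toReal_sum fun η _ => ENNReal.mul_ne_top ENNReal.ofReal_ne_top (measure_ne_top _ _)]
  refine Finset.sum_congr rfl fun η _ => ?_
  rw [ENNReal.toReal_mul, ENNReal.toReal_ofReal (transProb_nonneg M J σ η),
    harmonic_eq_reachesBefore hAB η, measureReal_def]

end Chain

/-! ### Counting configurations by their number of up-spins -/

section Up

variable {N : ℕ}

/-- The number of up-spins. -/
def up (σ : Config N) : ℕ := (Finset.univ.filter fun i => σ i = true).card

lemma up_le (σ : Config N) : up σ ≤ N := by
  simpa [up] using Finset.card_filter_le (Finset.univ : Finset (Fin N)) (fun i => σ i = true)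

lemma flip_apply_self (σ : Config N) (i : Fin N) : flip σ i i = !σ i := by simp [flip]

lemma flip_apply_of_ne (σ : Config N) {i j : Fin N} (h : j ≠ i) : flip σ i j = σ j := by
  simp [flip, h]

@[simp]
lemma flip_flip (σ : Config N) (i : Fin N) : flip (flip σ i) i = σ := by
  funext j
  by_cases h : j = i
  · subst h; simp [flip]
  · simp [flip, h]

lemma flip_injective (σ : Config N) : Function.Injective (flip σ) := by
  intro i j h
  by_contra hij
  have := congrFun h i
  rw [flip_apply_self, flip_apply_of_ne σ hij] at this
  simp at this

/-- Flipping the spin at `i` is an involution of the configurations. -/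
lemma sum_flip (i : Fin N) (F : Config N → ℝ) : ∑ σ, F (flip σ i) = ∑ σ, F σ :=
  Finset.sum_bij' (fun σ _ => flip σ i) (fun σ _ => flip σ i) (by simp) (by simp) (by simp)
    (by simp) (by simp)

lemma up_flip_of_false {σ : Config N} {i : Fin N} (h : σ i = false) :
    up (flip σ i) = up σ + 1 := by
  unfold up
  have : (Finset.univ.filter fun j => flip σ i j = true)
      = insert i (Finset.univ.filter fun j => σ j = true) := by
    ext j
    by_cases hj : j = i
    · subst hj; simp [flip, h]
    · simp [Finset.mem_filter, flip_apply_of_ne σ hj, hj]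
  rw [this, Finset.card_insert_of_notMem (by simp [h])]

lemma up_flip_of_true {σ : Config N} {i : Fin N} (h : σ i = true) :
    up (flip σ i) + 1 = up σ := by
  have h1 : flip σ i i = false := by simp [flip, h]
  rw [← up_flip_of_false h1, flip_flip]

lemma card_false (σ : Config N) :
    ((Finset.univ.filter fun i => σ i = false).card : ℝ) = N - up σ := by
  have h := Finset.card_filter_add_card_filter_not (s := (Finset.univ : Finset (Fin N)))
    (fun i => σ i = true)
  simp only [Finset.card_univ, Fintype.card_fin, Bool.not_eq_true] at h
  rw [eq_sub_iff_add_eq, add_comm]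
  exact_mod_cast h

/-- The configurations with `k` up-spins. -/
def upLevel (N k : ℕ) : Finset (Config N) := Finset.univ.filter fun σ => up σ = k

@[simp]
lemma mem_upLevel {k : ℕ} {σ : Config N} : σ ∈ upLevel N k ↔ up σ = k := by simp [upLevel]

lemma card_upLevel (N k : ℕ) : (upLevel N k).card = N.choose k := by
  have h : (Finset.powersetCard k (Finset.univ : Finset (Fin N))).card = N.choose k := by
    simp
  rw [← h]
  refine Finset.card_bij' (fun σ _ => Finset.univ.filter fun i => σ i = true)
    (fun s _ => fun i => decide (i ∈ s)) ?_ ?_ ?_ ?_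
  · intro σ hσ
    simpa [Finset.mem_powersetCard, up] using hσ
  · intro s hs
    rw [Finset.mem_powersetCard] at hs
    simp [up, hs.2]
  · intro σ _
    funext i
    simp
  · intro s _
    ext i
    simp

/-- Each configuration with `k + 1` up-spins arises in `k + 1` ways by raising a spin. -/
lemma sum_upLevel_flip (k : ℕ) (F : Config N → ℝ) :
    ∑ σ ∈ upLevel N k, ∑ i ∈ Finset.univ.filter (fun i => σ i = false), F (flip σ i)
      = (k + 1) * ∑ τ ∈ upLevel N (k + 1), F τ := by
  have h1 : ∑ σ ∈ upLevel N k, ∑ i ∈ Finset.univ.filter (fun i => σ i = false), F (flip σ i)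
      = ∑ i, ∑ σ : Config N, if up σ = k ∧ σ i = false then F (flip σ i) else 0 := by
    rw [Finset.sum_comm, upLevel, Finset.sum_filter]
    refine Finset.sum_congr rfl fun σ _ => ?_
    split_ifs with h
    · simp [h, Finset.sum_filter]
    · simp [h]
  have h2 : (k + 1) * ∑ τ ∈ upLevel N (k + 1), F τ
      = ∑ i, ∑ τ : Config N, if up τ = k + 1 ∧ τ i = true then F τ else 0 := by
    rw [Finset.sum_comm, upLevel, Finset.sum_filter, Finset.mul_sum]
    refine Finset.sum_congr rfl fun τ _ => ?_
    split_ifs with h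
    · simp only [h, true_and]
      rw [← Finset.sum_filter, Finset.sum_const, nsmul_eq_mul]
      have : (Finset.univ.filter fun i => τ i = true).card = k + 1 := h
      rw [this]
      push_cast
      ring
    · simp [h]
  rw [h1, h2]
  refine Finset.sum_congr rfl fun i _ => ?_
  rw [← sum_flip i]
  refine Finset.sum_congr rfl fun σ _ => ?_
  rw [flip_flip]
  cases hσ : σ i with
  | false => simp [flip, hσ]
  | true =>
    have := up_flip_of_true hσ
    simp only [flip_apply_self, hσ, Bool.not_true, and_true]
    congr 1
    simp only [eq_iff_iff]
    omega

end Up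

/-! ### Dirichlet forms on the hypercube -/

section Dirichlet

variable {N : ℕ} (c : Config N → Fin N → ℝ)

/-- The Laplacian of the network on the hypercube with conductance `c σ i` on the edge between `σ`
and `flip σ i`. -/
noncomputable def laplacian (u : Config N → ℝ) (σ : Config N) : ℝ := ∑ i, c σ i * (u σ - u (flip σ i))

/-- The Dirichlet form; the factor `1 / 2` accounts for the two orientations of an edge. -/
noncomputable def energy (u v : Config N → ℝ) : ℝ :=
  1 / 2 * ∑ σ, ∑ i, c σ i * ((u σ - u (flip σ i)) * (v σ - v (flip σ i)))

variable {c}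

lemma energy_eq_sum_laplacian (hc : ∀ σ i, c (flip σ i) i = c σ i) (u v : Config N → ℝ) :
    energy c u v = ∑ σ, v σ * laplacian c u σ := by
  have h1 : ∑ σ, ∑ i, c σ i * ((u σ - u (flip σ i)) * (v σ - v (flip σ i)))
      = ∑ σ, ∑ i, v σ * (c σ i * (u σ - u (flip σ i)))
        + ∑ σ, ∑ i, v (flip σ i) * (c σ i * (u (flip σ i) - u σ)) := by
    rw [← Finset.sum_add_distrib]
    refine Finset.sum_congr rfl fun σ _ => ?_
    rw [← Finset.sum_add_distrib]
    exact Finset.sum_congr rfl fun i _ => by ring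
  have h2 : ∑ σ, ∑ i, v (flip σ i) * (c σ i * (u (flip σ i) - u σ))
      = ∑ σ, ∑ i, v σ * (c σ i * (u σ - u (flip σ i))) := by
    rw [Finset.sum_comm]
    conv_rhs => rw [Finset.sum_comm]
    refine Finset.sum_congr rfl fun i _ => ?_
    rw [← sum_flip i]
    exact Finset.sum_congr rfl fun σ _ => by rw [flip_flip, hc]
  rw [energy, h1, h2, ← two_mul, ← mul_assoc]
  simp only [laplacian, Finset.mul_sum]
  norm_num

lemma energy_self_nonneg (hc0 : ∀ σ i, 0 ≤ c σ i) (u : Config N → ℝ) : 0 ≤ energy c u u :=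
  mul_nonneg (by norm_num) (Finset.sum_nonneg fun σ _ => Finset.sum_nonneg fun i _ =>
    mul_nonneg (hc0 σ i) (mul_self_nonneg _))

/-- A function that is harmonic wherever it does not vanish is constant, since its energy is `0`. -/
lemma eq_zero_of_laplacian (hc0 : ∀ σ i, 0 < c σ i) (hc : ∀ σ i, c (flip σ i) i = c σ i)
    {v : Config N → ℝ} (hv : ∀ σ, v σ = 0 ∨ laplacian c v σ = 0) {τ : Config N} (hτ : v τ = 0)
    (σ : Config N) : v σ = 0 := by
  have hE : energy c v v = 0 := by
    rw [energy_eq_sum_laplacian hc]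
    refine Finset.sum_eq_zero fun σ _ => ?_
    rcases hv σ with h | h <;> simp [h]
  have hterm : ∀ σ i, 0 ≤ c σ i * ((v σ - v (flip σ i)) * (v σ - v (flip σ i))) := fun σ i =>
    mul_nonneg (hc0 σ i).le (mul_self_nonneg _)
  have hflip : ∀ σ i, v (flip σ i) = v σ := by
    intro σ i
    have h1 : ∑ σ, ∑ i, c σ i * ((v σ - v (flip σ i)) * (v σ - v (flip σ i))) = 0 := by
      unfold energy at hE
      linarith
    have h2 := (Finset.sum_eq_zero_iff_of_nonneg fun σ _ =>
      Finset.sum_nonneg fun i _ => hterm σ i).1 h1 σ (Finset.mem_univ _)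
    have h3 := (Finset.sum_eq_zero_iff_of_nonneg fun i _ => hterm σ i).1 h2 i (Finset.mem_univ _)
    have h4 := (mul_eq_zero.1 h3).resolve_left (hc0 σ i).ne'
    linarith [mul_self_eq_zero.1 h4]
  have hupd : ∀ s : Finset (Fin N), v (fun i => if i ∈ s then τ i else σ i) = v σ := by
    intro s
    induction s using Finset.induction_on with
    | empty => simp
    | insert a s ha ih =>
      rw [← ih]
      set ρ : Config N := fun i => if i ∈ s then τ i else σ i with hρ
      have hρa : ρ a = σ a := by simp [hρ, ha]
      by_cases h : τ a = σ a
      · congr 1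
        funext i
        by_cases hi : i = a
        · subst hi; simp [hρ, h, ha]
        · simp [hρ, hi]
      · rw [← hflip ρ a]
        congr 1
        funext i
        by_cases hi : i = a
        · subst hi
          rw [flip_apply_self, hρa]
          simp only [Finset.mem_insert_self, if_true]
          revert h
          cases τ i <;> cases σ i <;> simp
        · rw [flip_apply_of_ne _ hi]
          simp [hρ, hi]
  rw [← hupd Finset.univ]
  simpa using hτ

section Capacity

variable {A B : Set (Config N)} {u : Config N → ℝ}

lemma energy_eq_mul (hc : ∀ σ i, c (flip σ i) i = c σ i)
    (hA : ∀ σ ∈ A, u σ = 1) (hB : ∀ σ ∈ B, u σ = 0)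
    (hu : ∀ σ, σ ∉ A → σ ∉ B → laplacian c u σ = 0) {g : Config N → ℝ} {x : ℝ}
    (hgA : ∀ σ ∈ A, g σ = x) (hgB : ∀ σ ∈ B, g σ = 0) :
    energy c u g = x * energy c u u := by
  rw [energy_eq_sum_laplacian hc, energy_eq_sum_laplacian hc, Finset.mul_sum]
  refine Finset.sum_congr rfl fun σ _ => ?_
  by_cases h1 : σ ∈ A
  · rw [hA σ h1, hgA σ h1]; ring
  by_cases h2 : σ ∈ B
  · rw [hB σ h2, hgB σ h2]; ring
  · rw [hu σ h1 h2]; ring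

/-- The Dirichlet principle. -/
lemma energy_le_energy (hc0 : ∀ σ i, 0 ≤ c σ i) (hc : ∀ σ i, c (flip σ i) i = c σ i)
    (hA : ∀ σ ∈ A, u σ = 1) (hB : ∀ σ ∈ B, u σ = 0)
    (hu : ∀ σ, σ ∉ A → σ ∉ B → laplacian c u σ = 0) {g : Config N → ℝ}
    (hgA : ∀ σ ∈ A, g σ = 1) (hgB : ∀ σ ∈ B, g σ = 0) :
    energy c u u ≤ energy c g g := by
  have h1 := energy_eq_mul hc hA hB hu hgA hgB
  have h2 := energy_self_nonneg hc0 (fun σ => u σ - g σ)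
  have h3 : energy c (fun σ => u σ - g σ) (fun σ => u σ - g σ)
      = energy c u u - 2 * energy c u g + energy c g g := by
    unfold energy
    simp only [Finset.mul_sum]
    rw [← Finset.sum_sub_distrib, ← Finset.sum_add_distrib]
    refine Finset.sum_congr rfl fun σ _ => ?_
    rw [← Finset.sum_sub_distrib, ← Finset.sum_add_distrib]
    exact Finset.sum_congr rfl fun i _ => by ring
  linarith

lemma sqrt_sub_sqrt_sq_le {x y : ℝ} (hx : 0 < x) (hy : 0 < y) :
    (√x - √y) * (√x - √y) ≤ 1 / 2 * ((x - y) * (Real.log x - Real.log y)) := by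
  wlog hxy : y ≤ x generalizing x y
  · have := this hy hx (le_of_not_ge hxy)
    linarith
  have hr : 0 < √x := Real.sqrt_pos.2 hx
  have hs : 0 < √y := Real.sqrt_pos.2 hy
  have hsr : √y ≤ √x := Real.sqrt_le_sqrt hxy
  have h1 : x = √x ^ 2 := (Real.sq_sqrt hx.le).symm
  have h2 : y = √y ^ 2 := (Real.sq_sqrt hy.le).symm
  have h3 : Real.log x - Real.log y = 2 * (Real.log √x - Real.log √y) := by
    rw [Real.log_sqrt hx.le, Real.log_sqrt hy.le]
    ring
  have h4 : (√x - √y) / √x ≤ Real.log √x - Real.log √y := by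
    have := Real.one_sub_inv_le_log_of_pos (div_pos hr hs)
    rw [Real.log_div hr.ne' hs.ne', inv_div] at this
    calc _ = 1 - √y / √x := by rw [sub_div, div_self hr.ne']
      _ ≤ _ := this
  have h5 : √x - √y ≤ √x * (Real.log √x - Real.log √y) := by
    rwa [div_le_iff₀' hr] at h4
  have h6 : x - y = (√x - √y) * (√x + √y) := by
    conv_lhs => rw [h1, h2]
    ring
  rw [h3, h6]
  have h7 : 0 ≤ √x - √y := sub_nonneg.2 hsr
  have h8 : 0 ≤ Real.log √x - Real.log √y := le_trans (by positivity) h4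
  have h9 : √x - √y ≤ (√x + √y) * (Real.log √x - Real.log √y) := by nlinarith
  nlinarith [mul_le_mul_of_nonneg_left h9 h7]

/-- The square root of the harmonic function, regularised by `δ`, has energy at most a logarithmic
multiple of the capacity: by harmonicity, the energy of `u` against `log (u + δ)` only sees the
boundary values. -/
lemma energy_sqrt_le (hc0 : ∀ σ i, 0 ≤ c σ i) (hc : ∀ σ i, c (flip σ i) i = c σ i)
    (hA : ∀ σ ∈ A, u σ = 1) (hB : ∀ σ ∈ B, u σ = 0)
    (hu : ∀ σ, σ ∉ A → σ ∉ B → laplacian c u σ = 0) (hu0 : ∀ σ, 0 ≤ u σ) {δ : ℝ} (hδ : 0 < δ) :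
    energy c (fun σ => √(u σ + δ) - √δ) (fun σ => √(u σ + δ) - √δ)
      ≤ 1 / 2 * Real.log (1 + 1 / δ) * energy c u u := by
  have h1 := energy_eq_mul hc hA hB hu (g := fun σ => Real.log (u σ + δ) - Real.log δ)
    (x := Real.log (1 + 1 / δ)) (fun σ hσ => ?_) (fun σ hσ => by simp [hB σ hσ])
  · rw [mul_assoc, ← h1]
    unfold energy
    rw [← mul_assoc, mul_comm (1 / 2 : ℝ) (1 / 2), mul_assoc]
    refine mul_le_mul_of_nonneg_left ?_ (by norm_num)
    rw [Finset.mul_sum]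
    refine Finset.sum_le_sum fun σ _ => ?_
    rw [Finset.mul_sum]
    refine Finset.sum_le_sum fun i _ => ?_
    have h2 := sqrt_sub_sqrt_sq_le (add_pos_of_nonneg_of_pos (hu0 σ) hδ)
      (add_pos_of_nonneg_of_pos (hu0 (flip σ i)) hδ)
    have h3 := mul_le_mul_of_nonneg_left h2 (hc0 σ i)
    calc _ = c σ i * ((√(u σ + δ) - √(u (flip σ i) + δ)) * (√(u σ + δ) - √(u (flip σ i) + δ))) := by
          ring
      _ ≤ _ := h3
      _ = _ := by ring
  · rw [hA σ hσ, ← Real.log_div (by positivity) (by positivity)]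
    congr 1
    field_simp
    ring

end Capacity

/-- Averages of `φ²` over successive levels, compared along a uniformly random edge between them. -/
lemma avg_level_le (φ : Config N → ℝ) {k : ℕ} (hk : k < N) {d r : ℝ}
    (hr : 0 < r) (hcr : ∀ σ ∈ upLevel N k, ∀ i, σ i = false → r ≤ N.choose k * c σ i)
    (hc0 : ∀ σ i, 0 ≤ c σ i) (hd : 2 * (N + 1) * energy c φ φ ≤ d * r) :
    (∑ σ ∈ upLevel N k, φ σ ^ 2) / N.choose k
      ≤ (1 + 1 / N) * ((∑ σ ∈ upLevel N (k + 1), φ σ ^ 2) / N.choose (k + 1)) + d := by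
  have hN : (0 : ℝ) < N := by exact_mod_cast (by omega : 0 < N)
  have hC : (0 : ℝ) < N.choose k := by exact_mod_cast Nat.choose_pos hk.le
  have hC' : (0 : ℝ) < N.choose (k + 1) := by exact_mod_cast Nat.choose_pos hk
  have hNk : (1 : ℝ) ≤ (N : ℝ) - k := by
    have : (k : ℝ) + 1 ≤ N := by exact_mod_cast hk
    linarith
  have hrec : (N.choose (k + 1) : ℝ) * (k + 1) = N.choose k * (N - k) := by
    have := Nat.choose_succ_right_eq N k
    have h2 : ((N.choose (k + 1) * (k + 1) : ℕ) : ℝ) = ((N.choose k * (N - k) : ℕ) : ℝ) := by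
      exact_mod_cast this
    push_cast [Nat.cast_sub hk.le] at h2
    exact h2
  set S := ∑ σ ∈ upLevel N k, φ σ ^ 2 with hS
  set S' := ∑ σ ∈ upLevel N (k + 1), φ σ ^ 2 with hS'
  set D := ∑ σ ∈ upLevel N k, ∑ i ∈ Finset.univ.filter (fun i => σ i = false),
    (φ σ - φ (flip σ i)) ^ 2 with hD
  have hcount : ((N : ℝ) - k) * S ≤ (1 + 1 / N) * ((k + 1) * S') + (1 + N) * D := by
    have e1 : ((N : ℝ) - k) * S = ∑ σ ∈ upLevel N k,
        ∑ i ∈ Finset.univ.filter (fun i => σ i = false), φ σ ^ 2 := by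
      rw [hS, Finset.mul_sum]
      refine Finset.sum_congr rfl fun σ hσ => ?_
      rw [Finset.sum_const, nsmul_eq_mul, card_false, mem_upLevel.1 hσ]
    rw [e1, hS', ← sum_upLevel_flip k (fun σ => φ σ ^ 2), hD, Finset.mul_sum, Finset.mul_sum,
      ← Finset.sum_add_distrib]
    refine Finset.sum_le_sum fun σ _ => ?_
    rw [Finset.mul_sum, Finset.mul_sum, ← Finset.sum_add_distrib]
    refine Finset.sum_le_sum fun i _ => ?_
    -- `a² ≤ (1 + 1/N) b² + (1 + N) (a - b)²` with `a = φ σ` and `b = φ (flip σ i)`.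
    have : (1 + 1 / (N : ℝ)) * φ (flip σ i) ^ 2 + (1 + N) * (φ σ - φ (flip σ i)) ^ 2 - φ σ ^ 2
        = (N * (φ σ - φ (flip σ i)) - φ (flip σ i)) ^ 2 / N := by
      field_simp
      ring
    have h2 : 0 ≤ (N * (φ σ - φ (flip σ i)) - φ (flip σ i)) ^ 2 / (N : ℝ) := by positivity
    linarith
  have hDE : r * D ≤ N.choose k * (2 * energy c φ φ) := by
    have e2 : 2 * energy c φ φ
        = ∑ σ, ∑ i, c σ i * ((φ σ - φ (flip σ i)) * (φ σ - φ (flip σ i))) := by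
      unfold energy
      ring
    rw [e2, hD, Finset.mul_sum, Finset.mul_sum]
    have hnn : ∀ σ i, 0 ≤ (N.choose k : ℝ) * (c σ i * ((φ σ - φ (flip σ i)) *
        (φ σ - φ (flip σ i)))) := fun σ i =>
      mul_nonneg hC.le (mul_nonneg (hc0 σ i) (mul_self_nonneg _))
    calc _ ≤ ∑ σ ∈ upLevel N k, (N.choose k : ℝ) *
          ∑ i, c σ i * ((φ σ - φ (flip σ i)) * (φ σ - φ (flip σ i))) := by
          refine Finset.sum_le_sum fun σ hσ => ?_
          rw [Finset.mul_sum, Finset.mul_sum]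
          calc _ ≤ ∑ i ∈ Finset.univ.filter (fun i => σ i = false), (N.choose k : ℝ) *
                (c σ i * ((φ σ - φ (flip σ i)) * (φ σ - φ (flip σ i)))) := by
                refine Finset.sum_le_sum fun i hi => ?_
                have h1 := hcr σ hσ i (by simpa using hi)
                rw [← mul_assoc, ← sq]
                exact mul_le_mul_of_nonneg_right h1 (sq_nonneg _)
            _ ≤ _ := Finset.sum_le_sum_of_subset_of_nonneg (Finset.subset_univ _)
                fun i _ _ => hnn σ i
      _ ≤ _ := Finset.sum_le_sum_of_subset_of_nonneg (Finset.subset_univ _) fun σ _ _ => by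
          rw [Finset.mul_sum]
          exact Finset.sum_nonneg fun i _ => hnn σ i
  have hDd : (1 + N) * D ≤ N.choose k * d := by
    refine le_of_mul_le_mul_right ?_ hr
    calc (1 + N) * D * r = (1 + N) * (r * D) := by ring
      _ ≤ (1 + N) * (N.choose k * (2 * energy c φ φ)) := by gcongr
      _ = N.choose k * (2 * (N + 1) * energy c φ φ) := by ring
      _ ≤ N.choose k * (d * r) := by gcongr
      _ = N.choose k * d * r := by ring
  have hd0 : 0 ≤ d := by
    have h1 : 0 ≤ d * r := le_trans
      (mul_nonneg (by positivity) (energy_self_nonneg hc0 φ)) hd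
    exact nonneg_of_mul_nonneg_left h1 hr
  rw [div_le_iff₀ hC]
  have e3 : ((1 + 1 / (N : ℝ)) * (S' / N.choose (k + 1)) + d) * N.choose k * (N - k)
      = (1 + 1 / N) * ((k + 1) * S') + d * N.choose k * (N - k) := by
    have h1 : S' / (N.choose (k + 1) : ℝ) * (N.choose k * (N - k)) = (k + 1) * S' := by
      rw [← hrec]
      field_simp
    calc _ = (1 + 1 / (N : ℝ)) * (S' / (N.choose (k + 1) : ℝ) * (N.choose k * (N - k)))
          + d * N.choose k * (N - k) := by ring
      _ = _ := by rw [h1]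
  refine le_of_mul_le_mul_right ?_ (by linarith : (0 : ℝ) < (N : ℝ) - k)
  rw [e3]
  have : d * (N.choose k : ℝ) * 1 ≤ d * N.choose k * (N - k) := by gcongr
  linarith

/-- Iteration of the comparison of levels, up to a level `k'` where `φ` vanishes. -/
lemma avg_level_le_of_eq_zero (φ : Config N → ℝ) {k k' : ℕ} (hkk : k ≤ k') (hk' : k' ≤ N)
    (hφ : ∀ σ ∈ upLevel N k', φ σ = 0) {d r : ℝ} (hr : 0 < r)
    (hcr : ∀ j, k ≤ j → j < k' → ∀ σ ∈ upLevel N j, ∀ i, σ i = false → r ≤ N.choose j * c σ i)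
    (hc0 : ∀ σ i, 0 ≤ c σ i) (hd : 2 * (N + 1) * energy c φ φ ≤ d * r) :
    (∑ σ ∈ upLevel N k, φ σ ^ 2) / N.choose k ≤ Real.exp 1 * (N * d) := by
  have hd0 : 0 ≤ d := by
    have h1 : 0 ≤ d * r := le_trans
      (mul_nonneg (by positivity) (energy_self_nonneg hc0 φ)) hd
    exact nonneg_of_mul_nonneg_left h1 hr
  have key : ∀ l, l ≤ k' - k → (∑ σ ∈ upLevel N (k' - l), φ σ ^ 2) / N.choose (k' - l)
      ≤ (1 + 1 / (N : ℝ)) ^ l * (l * d) := by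
    intro l
    induction l with
    | zero =>
      intro _
      rw [Nat.sub_zero, Finset.sum_eq_zero fun σ hσ => by rw [hφ σ hσ]; norm_num]
      simp
    | succ l ih =>
      intro hl
      have h1 := ih (by omega)
      have h2 := avg_level_le φ (k := k' - (l + 1)) (by omega) hr
        (hcr _ (by omega) (by omega)) hc0 hd
      have e : k' - (l + 1) + 1 = k' - l := by omega
      rw [e] at h2
      have h3 : (1 : ℝ) ≤ (1 + 1 / (N : ℝ)) ^ (l + 1) :=
        one_le_pow₀ (by simp)
      calc _ ≤ (1 + 1 / (N : ℝ)) * ((1 + 1 / (N : ℝ)) ^ l * (l * d)) + 1 * d := by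
            rw [one_mul]
            exact h2.trans (by gcongr)
        _ ≤ (1 + 1 / (N : ℝ)) * ((1 + 1 / (N : ℝ)) ^ l * (l * d))
            + (1 + 1 / (N : ℝ)) ^ (l + 1) * d := by gcongr
        _ = _ := by
            push_cast
            ring
  have h1 := key (k' - k) le_rfl
  rw [Nat.sub_sub_self hkk] at h1
  refine h1.trans ?_
  have hl : k' - k ≤ N := by omega
  have hpow : (1 + 1 / (N : ℝ)) ^ (k' - k) ≤ Real.exp 1 := by
    rcases Nat.eq_zero_or_pos N with h0 | h0
    · subst h0
      have : k' - k = 0 := by omega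
      rw [this, pow_zero]
      exact Real.one_le_exp (by norm_num)
    · have hN : (0 : ℝ) < N := by exact_mod_cast h0
      calc (1 + 1 / (N : ℝ)) ^ (k' - k) ≤ (1 + 1 / (N : ℝ)) ^ N :=
            pow_le_pow_right₀ (by simp) hl
        _ ≤ Real.exp (1 / N) ^ N := by
            gcongr
            rw [add_comm]
            exact Real.add_one_le_exp _
        _ = Real.exp 1 := by
            rw [← Real.exp_nat_mul]
            congr 1
            field_simp
  have : ((k' - k : ℕ) : ℝ) ≤ N := by exact_mod_cast hl
  gcongr

/-- The average over a level of a harmonic function is at most its capacity times the effective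
resistance between the level and the set where it vanishes, up to polynomial and logarithmic
factors. -/
lemma sum_level_harmonic_le {A B : Set (Config N)} {u : Config N → ℝ}
    (hc0 : ∀ σ i, 0 ≤ c σ i) (hc : ∀ σ i, c (flip σ i) i = c σ i)
    (hA : ∀ σ ∈ A, u σ = 1) (hB : ∀ σ ∈ B, u σ = 0)
    (hu : ∀ σ, σ ∉ A → σ ∉ B → laplacian c u σ = 0) (hu0 : ∀ σ, 0 ≤ u σ) {δ : ℝ} (hδ : 0 < δ)
    {k k' : ℕ} (hkk : k ≤ k') (hk' : k' ≤ N) (hkB : ∀ σ ∈ upLevel N k', u σ = 0)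
    {r : ℝ} (hr : 0 < r)
    (hcr : ∀ j, k ≤ j → j < k' → ∀ σ ∈ upLevel N j, ∀ i, σ i = false → r ≤ N.choose j * c σ i) :
    ∑ σ ∈ upLevel N k, u σ ≤ N.choose k * (2 * Real.exp 1 * (N * (N + 1)) *
      Real.log (1 + 1 / δ) * energy c u u / r + 2 * δ) := by
  have h1 := energy_sqrt_le hc0 hc hA hB hu hu0 hδ
  have hC : (0 : ℝ) < N.choose k := by exact_mod_cast Nat.choose_pos (hkk.trans hk')
  have h2 := avg_level_le_of_eq_zero (fun σ => √(u σ + δ) - √δ) hkk hk'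
    (fun σ hσ => by simp [hkB σ hσ]) (d := (N + 1) * Real.log (1 + 1 / δ) * energy c u u / r)
    hr hcr hc0 (by
      rw [div_mul_cancel₀ _ hr.ne']
      calc _ ≤ 2 * ((N : ℝ) + 1) * (1 / 2 * Real.log (1 + 1 / δ) * energy c u u) := by gcongr
        _ = _ := by ring)
  rw [div_le_iff₀ hC] at h2
  calc ∑ σ ∈ upLevel N k, u σ
      ≤ ∑ σ ∈ upLevel N k, (2 * (√(u σ + δ) - √δ) ^ 2 + 2 * δ) := by
        refine Finset.sum_le_sum fun σ _ => ?_
        have e1 := Real.sq_sqrt (add_nonneg (hu0 σ) hδ.le)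
        have e2 := Real.sq_sqrt hδ.le
        nlinarith [sq_nonneg (√(u σ + δ) - 2 * √δ)]
    _ = 2 * ∑ σ ∈ upLevel N k, (√(u σ + δ) - √δ) ^ 2 + N.choose k * (2 * δ) := by
        rw [Finset.sum_add_distrib, ← Finset.mul_sum, Finset.sum_const, card_upLevel,
          nsmul_eq_mul]
    _ ≤ 2 * (Real.exp 1 * (N * ((N + 1) * Real.log (1 + 1 / δ) * energy c u u / r)) *
          N.choose k) + N.choose k * (2 * δ) := by gcongr
    _ = _ := by ring

end Dirichlet

/-! ### The free energy in the double-well regime -/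

section FreeEnergy

variable {M : Params}

/-- The derivative of the free energy on `(-1, 1)`. -/
noncomputable def freeEnergyDeriv (M : Params) (m : ℝ) : ℝ :=
  -m - M.h + M.β⁻¹ * (1 / 2 * (Real.log ((1 + m) / 2) - Real.log ((1 - m) / 2)))

lemma continuous_freeEnergy : Continuous (freeEnergy M) := by
  unfold freeEnergy entropy
  have h1 : Continuous fun m : ℝ => (1 - m) / 2 * Real.log ((1 - m) / 2) :=
    Real.continuous_mul_log.comp (by fun_prop)
  have h2 : Continuous fun m : ℝ => (1 + m) / 2 * Real.log ((1 + m) / 2) :=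
    Real.continuous_mul_log.comp (by fun_prop)
  fun_prop

lemma hasDerivAt_freeEnergy {m : ℝ} (hm : m ∈ Set.Ioo (-1 : ℝ) 1) :
    HasDerivAt (freeEnergy M) (freeEnergyDeriv M m) m := by
  have h1 : 0 < (1 - m) / 2 := by linarith [hm.2]
  have h2 : 0 < (1 + m) / 2 := by linarith [hm.1]
  have d1 : HasDerivAt (fun m : ℝ => (1 - m) / 2) (-1 / 2) m :=
    ((hasDerivAt_id m).const_sub 1).div_const 2
  have d2 : HasDerivAt (fun m : ℝ => (1 + m) / 2) (1 / 2) m :=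
    ((hasDerivAt_id m).const_add 1).div_const 2
  have e1 := d1.mul (d1.log h1.ne')
  have e2 := d2.mul (d2.log h2.ne')
  have e3 : HasDerivAt (fun m : ℝ => -m ^ 2 / 2 - M.h * m) (-m - M.h) m := by
    have := (((hasDerivAt_pow 2 m).neg.div_const 2).sub ((hasDerivAt_id m).const_mul M.h))
    convert! this using 1
    norm_num
    ring
  have e4 := e3.add ((e1.add e2).const_mul M.β⁻¹)
  convert! e4 using 1
  have h3 : (1 - m) / 2 * (-1 / 2 / ((1 - m) / 2)) = -1 / 2 := mul_div_cancel₀ _ h1.ne'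
  have h4 : (1 + m) / 2 * (1 / 2 / ((1 + m) / 2)) = 1 / 2 := mul_div_cancel₀ _ h2.ne'
  rw [h3, h4, freeEnergyDeriv]
  ring

lemma hasDerivAt_freeEnergyDeriv {m : ℝ} (hm : m ∈ Set.Ioo (-1 : ℝ) 1) :
    HasDerivAt (freeEnergyDeriv M) (-1 + M.β⁻¹ / (1 - m ^ 2)) m := by
  have h1 : 0 < (1 - m) / 2 := by linarith [hm.2]
  have h2 : 0 < (1 + m) / 2 := by linarith [hm.1]
  have d1 : HasDerivAt (fun m : ℝ => (1 - m) / 2) (-1 / 2) m :=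
    ((hasDerivAt_id m).const_sub 1).div_const 2
  have d2 : HasDerivAt (fun m : ℝ => (1 + m) / 2) (1 / 2) m :=
    ((hasDerivAt_id m).const_add 1).div_const 2
  have e3 : HasDerivAt (fun m : ℝ => -m - M.h) (-1) m :=
    ((hasDerivAt_id m).neg).sub_const M.h
  have e4 := e3.add ((((d2.log h2.ne').sub (d1.log h1.ne')).const_mul (1 / 2)).const_mul M.β⁻¹)
  convert! e4 using 1
  have h3 : 1 - m ≠ 0 := by linarith
  have h4 : 1 + m ≠ 0 := by linarith
  have h5 : 1 - m ^ 2 ≠ 0 := by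
    have : 1 - m ^ 2 = (1 - m) * (1 + m) := by ring
    rw [this]
    exact mul_ne_zero h3 h4
  have := M.β_pos.ne'
  field_simp
  ring

lemma freeEnergyDeriv_eq_zero_iff {m : ℝ} (hm : m ∈ Set.Ioo (-1 : ℝ) 1) :
    freeEnergyDeriv M m = 0 ↔ m = Real.tanh (M.β * (m + M.h)) := by
  have h1 : 0 < 1 - m := by linarith [hm.2]
  have h2 : 0 < 1 + m := by linarith [hm.1]
  have hb := M.β_pos
  have e : freeEnergyDeriv M m = M.β⁻¹ * (Real.artanh m - M.β * (m + M.h)) := by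
    rw [Real.artanh_eq_half_log ⟨hm.1.le, hm.2.le⟩, freeEnergyDeriv,
      Real.log_div h2.ne' two_ne_zero, Real.log_div h1.ne' two_ne_zero,
      Real.log_div h2.ne' h1.ne']
    field_simp
    ring
  rw [e, mul_eq_zero, or_iff_right (inv_ne_zero hb.ne'), sub_eq_zero]
  constructor
  · intro h
    rw [← h, Real.tanh_artanh hm]
  · intro h
    conv_lhs => rw [h]
    rw [Real.artanh_tanh]

/-- Without critical points in between, the free energy is strictly monotone. -/
lemma strictMonoOn_or_strictAntiOn_freeEnergy {a b : ℝ} (ha : -1 ≤ a) (hb : b ≤ 1)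
    (h : ∀ m ∈ Set.Ioo a b, freeEnergyDeriv M m ≠ 0) :
    StrictMonoOn (freeEnergy M) (Set.Icc a b) ∨ StrictAntiOn (freeEnergy M) (Set.Icc a b) := by
  have hd : ∀ m ∈ Set.Ioo a b, HasDerivAt (freeEnergy M) (freeEnergyDeriv M m) m := fun m hm =>
    hasDerivAt_freeEnergy ⟨ha.trans_lt hm.1, hm.2.trans_le hb⟩
  rcases hasDerivWithinAt_forall_lt_or_forall_gt_of_forall_ne (convex_Ioo a b)
    (fun m hm => (hd m hm).hasDerivWithinAt) h with h1 | h1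
  · right
    refine strictAntiOn_of_deriv_neg (convex_Icc a b) continuous_freeEnergy.continuousOn ?_
    intro m hm
    rw [interior_Icc] at hm
    rw [(hd m hm).deriv]
    exact h1 m hm
  · left
    refine strictMonoOn_of_deriv_pos (convex_Icc a b) continuous_freeEnergy.continuousOn ?_
    intro m hm
    rw [interior_Icc] at hm
    rw [(hd m hm).deriv]
    exact h1 m hm

namespace IsDoubleWell

variable {mMinus mStar mPlus : ℝ} (W : IsDoubleWell M mMinus mStar mPlus)
include W

lemma mem_Ioo_of_critical {m : ℝ} (h : m = mMinus ∨ m = mStar ∨ m = mPlus) :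
    m ∈ Set.Ioo (-1 : ℝ) 1 := by
  rw [(W.critical m).2 h]
  exact ⟨Real.neg_one_lt_tanh _, Real.tanh_lt_one _⟩

lemma mMinus_mem : mMinus ∈ Set.Ioo (-1 : ℝ) 1 := W.mem_Ioo_of_critical (Or.inl rfl)

lemma mStar_mem : mStar ∈ Set.Ioo (-1 : ℝ) 1 := W.mem_Ioo_of_critical (Or.inr (Or.inl rfl))

lemma mPlus_mem : mPlus ∈ Set.Ioo (-1 : ℝ) 1 := W.mem_Ioo_of_critical (Or.inr (Or.inr rfl))

lemma freeEnergyDeriv_ne_zero {m : ℝ} (hm : m ∈ Set.Ioo (-1 : ℝ) 1) (h1 : m ≠ mMinus)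
    (h2 : m ≠ mStar) (h3 : m ≠ mPlus) : freeEnergyDeriv M m ≠ 0 := by
  intro h
  rcases (W.critical m).1 ((freeEnergyDeriv_eq_zero_iff hm).1 h) with h | h | h
  exacts [h1 h, h2 h, h3 h]

lemma strictAntiOn_left : StrictAntiOn (freeEnergy M) (Set.Icc (-1) mMinus) := by
  have h0 := W.mMinus_mem
  rcases strictMonoOn_or_strictAntiOn_freeEnergy (M := M) le_rfl h0.2.le (fun m hm =>
    W.freeEnergyDeriv_ne_zero ⟨hm.1, hm.2.trans h0.2⟩ hm.2.ne
      (hm.2.trans W.lt_star).ne (hm.2.trans (W.lt_star.trans W.star_lt)).ne) with h | h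
  · exfalso
    obtain ⟨m, h1, h2⟩ := ((W.isLocalMin_minus.filter_mono nhdsWithin_le_nhds).and
      (Ioo_mem_nhdsLT h0.1)).exists
    exact absurd (h ⟨h2.1.le, h2.2.le⟩ ⟨h0.1.le, le_rfl⟩ h2.2) (not_lt.2 h1)
  · exact h

lemma strictMonoOn_middle : StrictMonoOn (freeEnergy M) (Set.Icc mMinus mStar) := by
  have h0 := W.mMinus_mem
  have h1 := W.mStar_mem
  rcases strictMonoOn_or_strictAntiOn_freeEnergy (M := M) h0.1.le h1.2.le (fun m hm =>
    W.freeEnergyDeriv_ne_zero ⟨h0.1.trans hm.1, hm.2.trans h1.2⟩ hm.1.ne' hm.2.ne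
      (hm.2.trans W.star_lt).ne) with h | h
  · exact h
  · exfalso
    obtain ⟨m, h1, h2⟩ := ((W.isLocalMin_minus.filter_mono nhdsWithin_le_nhds).and
      (Ioo_mem_nhdsGT W.lt_star)).exists
    exact absurd (h ⟨le_rfl, W.lt_star.le⟩ ⟨h2.1.le, h2.2.le⟩ h2.1) (not_lt.2 h1)

lemma strictAntiOn_right : StrictAntiOn (freeEnergy M) (Set.Icc mStar mPlus) := by
  have h0 := W.mStar_mem
  have h1 := W.mPlus_mem
  rcases strictMonoOn_or_strictAntiOn_freeEnergy (M := M) h0.1.le h1.2.le (fun m hm =>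
    W.freeEnergyDeriv_ne_zero ⟨h0.1.trans hm.1, hm.2.trans h1.2⟩ (W.lt_star.trans hm.1).ne'
      hm.1.ne' hm.2.ne) with h | h
  · exfalso
    obtain ⟨m, h1, h2⟩ := ((W.isLocalMax_star.filter_mono nhdsWithin_le_nhds).and
      (Ioo_mem_nhdsGT W.star_lt)).exists
    exact absurd (h ⟨le_rfl, W.star_lt.le⟩ ⟨h2.1.le, h2.2.le⟩ h2.1) (not_lt.2 h1)
  · exact h

lemma freeEnergy_lt {m : ℝ} (hm : m ∈ Set.Icc (-1) mStar) (hne : m ≠ mMinus) :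
    freeEnergy M mMinus < freeEnergy M m := by
  rcases lt_or_gt_of_ne hne with h | h
  · exact W.strictAntiOn_left ⟨hm.1, h.le⟩ ⟨W.mMinus_mem.1.le, le_rfl⟩ h
  · exact W.strictMonoOn_middle ⟨le_rfl, W.lt_star.le⟩ ⟨h.le, hm.2⟩ h

/-- Non-degeneracy of the left well: by Rolle's theorem the two zeros of `f''` lie between the three
critical points. -/
lemma inv_lt_mMinus : M.β * (1 - mMinus ^ 2) < 1 := by
  have hb := M.β_pos
  have h1 := W.mMinus_mem
  have h2 := W.mStar_mem
  have h3 := W.mPlus_mem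
  have rolle : ∀ {a b : ℝ}, a ∈ Set.Ioo (-1 : ℝ) 1 → b ∈ Set.Ioo (-1 : ℝ) 1 → a < b →
      freeEnergyDeriv M a = 0 → freeEnergyDeriv M b = 0 →
      ∃ z ∈ Set.Ioo a b, M.β * (1 - z ^ 2) = 1 := by
    intro a b ha hb' hab h0 h0'
    have hsub : ∀ z ∈ Set.Icc a b, z ∈ Set.Ioo (-1 : ℝ) 1 := fun z hz =>
      ⟨ha.1.trans_le hz.1, hz.2.trans_lt hb'.2⟩
    obtain ⟨z, hz, hz0⟩ := exists_hasDerivAt_eq_zero hab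
      (fun z hz => (hasDerivAt_freeEnergyDeriv (M := M) (hsub z hz)).continuousAt.continuousWithinAt)
      (h0.trans h0'.symm)
      (fun z hz => hasDerivAt_freeEnergyDeriv (hsub z ⟨hz.1.le, hz.2.le⟩))
    refine ⟨z, hz, ?_⟩
    have hzm := hsub z ⟨hz.1.le, hz.2.le⟩
    have h5 : 0 < 1 - z ^ 2 := by nlinarith [hzm.1, hzm.2]
    field_simp at hz0
    linarith
  have hz : ∀ {m : ℝ}, m = mMinus ∨ m = mStar ∨ m = mPlus → freeEnergyDeriv M m = 0 := fun h =>
    (freeEnergyDeriv_eq_zero_iff (W.mem_Ioo_of_critical h)).2 ((W.critical _).2 h)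
  obtain ⟨x, hx, hx1⟩ := rolle h1 h2 W.lt_star (hz (by simp)) (hz (by simp))
  obtain ⟨y, hy, hy1⟩ := rolle h2 h3 W.star_lt (hz (by simp)) (hz (by simp))
  have hxy : x < y := hx.2.trans hy.1
  have hsq : x ^ 2 = y ^ 2 := by
    have : M.β * (1 - x ^ 2) = M.β * (1 - y ^ 2) := hx1.trans hy1.symm
    have := mul_left_cancel₀ hb.ne' this
    linarith
  have hx0 : x < 0 := by
    rcases sq_eq_sq_iff_eq_or_eq_neg.1 hsq with h | h <;> linarith
  have : x ^ 2 < mMinus ^ 2 := by nlinarith [hx.1]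
  nlinarith

lemma curvature_pos : 0 < -1 + M.β⁻¹ / (1 - mMinus ^ 2) := by
  have h1 := W.mMinus_mem
  have h2 : 0 < 1 - mMinus ^ 2 := by nlinarith [h1.1, h1.2]
  have h3 := W.inv_lt_mMinus
  have h4 : 1 < M.β⁻¹ / (1 - mMinus ^ 2) := by
    rw [lt_div_iff₀ h2, one_mul, ← one_div, lt_div_iff₀ M.β_pos]
    linarith
  linarith

lemma iteratedDeriv_two : iteratedDeriv 2 (freeEnergy M) mMinus
    = -1 + M.β⁻¹ / (1 - mMinus ^ 2) := by
  rw [iteratedDeriv_succ, iteratedDeriv_one]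
  have : deriv (freeEnergy M) =ᶠ[𝓝 mMinus] freeEnergyDeriv M :=
    (isOpen_Ioo.eventually_mem W.mMinus_mem).mono fun m hm => (hasDerivAt_freeEnergy hm).deriv
  rw [this.deriv_eq, (hasDerivAt_freeEnergyDeriv W.mMinus_mem).deriv]

lemma quadratic_bounds : ∃ δ > 0, ∀ m, |m - mMinus| ≤ δ → m ∈ Set.Ioo (-1 : ℝ) 1 ∧
    (1 - mMinus ^ 2) / 2 ≤ 1 - m ^ 2 ∧ 1 - m ^ 2 ≤ 2 * (1 - mMinus ^ 2) ∧
    1 / 4 * (-1 + M.β⁻¹ / (1 - mMinus ^ 2)) * (m - mMinus) ^ 2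
      ≤ freeEnergy M m - freeEnergy M mMinus ∧
    freeEnergy M m - freeEnergy M mMinus
      ≤ (-1 + M.β⁻¹ / (1 - mMinus ^ 2)) * (m - mMinus) ^ 2 := by
  have hc := W.curvature_pos
  set c := -1 + M.β⁻¹ / (1 - mMinus ^ 2) with hcdef
  have h1 := W.mMinus_mem
  have h2 : 0 < 1 - mMinus ^ 2 := by nlinarith [h1.1, h1.2]
  have h0 : freeEnergyDeriv M mMinus = 0 :=
    (freeEnergyDeriv_eq_zero_iff h1).2 ((W.critical _).2 (Or.inl rfl))
  have hlo := (hasDerivAt_freeEnergyDeriv (M := M) h1).isLittleO.def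
    (c := 1 / 4 * c) (by positivity)
  have hcont : ContinuousAt (fun m : ℝ => 1 - m ^ 2) mMinus := by fun_prop
  have hev : ∀ᶠ m in 𝓝 mMinus, m ∈ Set.Ioo (-1 : ℝ) 1 ∧ (1 - mMinus ^ 2) / 2 < 1 - m ^ 2 ∧
      1 - m ^ 2 < 2 * (1 - mMinus ^ 2) ∧
      ‖freeEnergyDeriv M m - freeEnergyDeriv M mMinus - (m - mMinus) • c‖
        ≤ 1 / 4 * c * ‖m - mMinus‖ :=
    (isOpen_Ioo.eventually_mem h1).and ((hcont.eventually_const_lt (by linarith)).and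
      ((hcont.eventually_lt_const (by linarith)).and hlo))
  obtain ⟨δ, hδ, hball⟩ := Metric.nhds_basis_closedBall.eventually_iff.1 hev
  refine ⟨δ, hδ, fun m hm => ?_⟩
  have hmem : ∀ z, |z - mMinus| ≤ |m - mMinus| → z ∈ Metric.closedBall mMinus δ := by
    intro z hz
    rw [Metric.mem_closedBall, Real.dist_eq]
    exact hz.trans hm
  obtain ⟨b1, b2, b3, -⟩ := hball (hmem m le_rfl)
  refine ⟨b1, b2.le, b3.le, ?_⟩
  have hR : ∀ z ∈ Metric.closedBall mMinus |m - mMinus|, HasDerivWithinAt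
      (fun z => freeEnergy M z - c / 2 * (z - mMinus) ^ 2)
      (freeEnergyDeriv M z - c * (z - mMinus)) (Metric.closedBall mMinus |m - mMinus|) z := by
    intro z hz
    have hz' := hball (hmem z (by simpa [Real.dist_eq] using hz))
    have e1 : HasDerivAt (fun z => c / 2 * (z - mMinus) ^ 2) (c * (z - mMinus)) z := by
      have := (((hasDerivAt_id z).sub_const mMinus).pow 2).const_mul (c / 2)
      convert! this using 1
      simp
      ring
    exact ((hasDerivAt_freeEnergy hz'.1).sub e1).hasDerivWithinAt
  have hbound : ∀ z ∈ Metric.closedBall mMinus |m - mMinus|,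
      ‖freeEnergyDeriv M z - c * (z - mMinus)‖ ≤ 1 / 4 * c * |m - mMinus| := by
    intro z hz
    have hz0 : |z - mMinus| ≤ |m - mMinus| := by simpa [Real.dist_eq] using hz
    have hz' := (hball (hmem z hz0)).2.2.2
    rw [h0, sub_zero, smul_eq_mul, mul_comm (z - mMinus)] at hz'
    refine hz'.trans ?_
    rw [Real.norm_eq_abs]
    gcongr
  have key := (convex_closedBall mMinus |m - mMinus|).norm_image_sub_le_of_norm_hasDerivWithin_le
    hR hbound (x := mMinus) (y := m) (by simp) (by simp [Real.dist_eq])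
  simp only [sub_self] at key
  rw [Real.norm_eq_abs, Real.norm_eq_abs, mul_assoc, abs_mul_abs_self, abs_le] at key
  constructor <;> nlinarith [key.1, key.2, sq_nonneg (m - mMinus)]

/-- Away from the left well, and to the left of the saddle, the free energy is bounded below by more
than its value in the well. -/
lemma exists_gap {δ : ℝ} (hδ : 0 < δ) : ∃ γ > 0, ∀ m ∈ Set.Icc (-1) mStar, δ ≤ |m - mMinus| →
    freeEnergy M mMinus + γ ≤ freeEnergy M m := by
  set S : Set ℝ := Set.Icc (-1) mStar ∩ {m | δ ≤ |m - mMinus|} with hS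
  have hcS : IsCompact S := isCompact_Icc.inter_right
    (isClosed_le continuous_const (by fun_prop))
  rcases S.eq_empty_or_nonempty with h | h
  · refine ⟨1, one_pos, fun m hm hm' => ?_⟩
    have : m ∈ S := ⟨hm, hm'⟩
    rw [h] at this
    exact this.elim
  · obtain ⟨z, hz, hmin⟩ := hcS.exists_isMinOn h continuous_freeEnergy.continuousOn
    have hzne : z ≠ mMinus := by
      intro hzm
      have h1 : δ ≤ |z - mMinus| := hz.2
      rw [hzm, sub_self, abs_zero] at h1
      linarith
    refine ⟨freeEnergy M z - freeEnergy M mMinus, sub_pos.2 (W.freeEnergy_lt hz.1 hzne), ?_⟩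
    intro m hm hm'
    have : freeEnergy M z ≤ freeEnergy M m := hmin ⟨hm, hm'⟩
    linarith

end IsDoubleWell

end FreeEnergy

/-! ### Binomial coefficients and the Curie-Weiss weights of the levels -/

lemma factorial_le_stirling {n : ℕ} (hn : 0 < n) :
    (n.factorial : ℝ) ≤ Real.exp 1 * √n * (n / Real.exp 1) ^ n := by
  obtain ⟨n, rfl⟩ := Nat.exists_eq_succ_of_ne_zero hn.ne'
  have h1 : Stirling.stirlingSeq (n + 1) ≤ Stirling.stirlingSeq 1 :=
    Stirling.stirlingSeq'_antitone (Nat.zero_le n)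
  rw [Stirling.stirlingSeq_one, Stirling.stirlingSeq, div_le_iff₀ (by positivity)] at h1
  refine h1.trans (le_of_eq ?_)
  rw [Real.sqrt_mul (by norm_num)]
  field_simp

/-- The magnetisation of the configurations with `k` up-spins. -/
noncomputable def mag (N k : ℕ) : ℝ := -1 + 2 * k / N

section Level

variable {N k : ℕ}

lemma one_add_mag : (1 + mag N k) / 2 = k / N := by
  unfold mag
  ring

lemma one_sub_mag (hN : 0 < N) : (1 - mag N k) / 2 = (N - k) / N := by
  have : (N : ℝ) ≠ 0 := by exact_mod_cast hN.ne'
  unfold mag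
  field_simp
  ring

lemma mag_mem_Icc (hk : k ≤ N) : mag N k ∈ Set.Icc (-1 : ℝ) 1 := by
  unfold mag
  have h1 : (k : ℝ) / N ≤ 1 := div_le_one_of_le₀ (by exact_mod_cast hk) (by positivity)
  have h2 : (0 : ℝ) ≤ (k : ℝ) / N := by positivity
  rw [mul_div_assoc]
  constructor <;> linarith

lemma pow_eq_exp_mul_log {x : ℝ} {n : ℕ} (h : 0 < x ∨ n = 0) :
    x ^ n = Real.exp (n * Real.log x) := by
  rcases h with h | h
  · rw [Real.exp_nat_mul, Real.exp_log h]
  · simp [h]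

lemma exp_entropy_mul (hN : 0 < N) (hk : k ≤ N) :
    Real.exp (-(N * entropy (mag N k))) * ((k / N : ℝ) ^ k * ((N - k) / N : ℝ) ^ (N - k)) = 1 := by
  have hN' : (0 : ℝ) < N := by exact_mod_cast hN
  have h1 : (k / N : ℝ) ^ k = Real.exp (k * Real.log (k / N)) := by
    refine pow_eq_exp_mul_log ?_
    rcases Nat.eq_zero_or_pos k with h | h
    · exact Or.inr h
    · exact Or.inl (by positivity)
  have h2 : ((N - k) / N : ℝ) ^ (N - k) = Real.exp ((N - k : ℕ) * Real.log ((N - k) / N)) := by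
    refine pow_eq_exp_mul_log ?_
    rcases hk.lt_or_eq with h | h
    · left
      have : (k : ℝ) < N := by exact_mod_cast h
      exact div_pos (by linarith) hN'
    · exact Or.inr (by omega)
  rw [h1, h2, ← Real.exp_add, ← Real.exp_add, Real.exp_eq_one_iff, entropy, one_add_mag,
    one_sub_mag hN, Nat.cast_sub hk]
  field_simp
  ring

lemma choose_le_exp_entropy (hN : 0 < N) (hk : k ≤ N) :
    (N.choose k : ℝ) ≤ Real.exp (-(N * entropy (mag N k))) := by
  have hN' : (0 : ℝ) < N := by exact_mod_cast hN
  have hk' : (0 : ℝ) ≤ (N : ℝ) - k := by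
    have : (k : ℝ) ≤ N := by exact_mod_cast hk
    linarith
  set x : ℝ := k / N with hx
  set y : ℝ := (N - k) / N with hy
  have hx0 : 0 ≤ x := by positivity
  have hy0 : 0 ≤ y := by positivity
  have hxy : x + y = 1 := by
    rw [hx, hy]
    field_simp
    ring
  have h1 : x ^ k * y ^ (N - k) * N.choose k ≤ 1 := by
    have h2 := add_pow x y N
    rw [hxy, one_pow] at h2
    rw [h2]
    exact Finset.single_le_sum (f := fun m => x ^ m * y ^ (N - m) * N.choose m)
      (fun i _ => by positivity) (Finset.mem_range.2 (Nat.lt_succ_of_le hk))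
  calc (N.choose k : ℝ) = Real.exp (-(N * entropy (mag N k))) * (x ^ k * y ^ (N - k)) *
        N.choose k := by rw [exp_entropy_mul hN hk, one_mul]
    _ = Real.exp (-(N * entropy (mag N k))) * (x ^ k * y ^ (N - k) * N.choose k) := by ring
    _ ≤ Real.exp (-(N * entropy (mag N k))) * 1 := by gcongr
    _ = _ := mul_one _

lemma sqrt_mul_sub (hN : 0 < N) (hk : k ≤ N) :
    2 * (√k * √((N - k : ℕ) : ℝ)) * √N = N * √(N * (1 - mag N k ^ 2)) := by
  have hN' : (0 : ℝ) < N := by exact_mod_cast hN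
  have e : 1 - mag N k ^ 2 = 4 * (k * ((N : ℝ) - k)) / N ^ 2 := by
    unfold mag
    field_simp
    ring
  rw [← Real.sqrt_mul (Nat.cast_nonneg k), e, Nat.cast_sub hk]
  have h0 : (0 : ℝ) ≤ (N : ℝ) - k := by
    have : (k : ℝ) ≤ N := by exact_mod_cast hk
    linarith
  have e2 : (N : ℝ) * (4 * (k * ((N : ℝ) - k)) / N ^ 2) = (2 ^ 2) * (k * ((N : ℝ) - k)) / N := by
    field_simp
    ring
  rw [e2, Real.sqrt_div' _ hN'.le, Real.sqrt_mul (x := 2 ^ 2) (by norm_num),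
    Real.sqrt_sq (by norm_num)]
  have h3 := Real.mul_self_sqrt hN'.le
  have h4 : √(N : ℝ) ≠ 0 := (Real.sqrt_pos.2 hN').ne'
  rw [mul_div_assoc', eq_div_iff h4]
  calc _ = 2 * √(k * ((N : ℝ) - k)) * (√N * √N) := by ring
    _ = _ := by rw [h3]; ring

lemma stirling_pow_eq (hN : 0 < N) (hk : k ≤ N) :
    ((N : ℝ) / Real.exp 1) ^ N = Real.exp (-(N * entropy (mag N k))) *
      ((k / Real.exp 1) ^ k * (((N - k : ℕ) : ℝ) / Real.exp 1) ^ (N - k)) := by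
  have hN' : (0 : ℝ) < N := by exact_mod_cast hN
  have h := exp_entropy_mul hN hk
  have e1 : (k : ℝ) / Real.exp 1 = k / N * (N / Real.exp 1) := by field_simp
  have e2 : ((N - k : ℕ) : ℝ) / Real.exp 1 = (N - k) / N * (N / Real.exp 1) := by
    rw [Nat.cast_sub hk]
    field_simp
  rw [e1, e2, mul_pow, mul_pow]
  have e3 : ((N : ℝ) / Real.exp 1) ^ k * ((N : ℝ) / Real.exp 1) ^ (N - k)
      = ((N : ℝ) / Real.exp 1) ^ N := by
    rw [← pow_add, Nat.add_sub_cancel' hk]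
  calc _ = 1 * ((N : ℝ) / Real.exp 1) ^ N := (one_mul _).symm
    _ = Real.exp (-(N * entropy (mag N k))) * ((k / N : ℝ) ^ k * ((N - k) / N : ℝ) ^ (N - k)) *
        (((N : ℝ) / Real.exp 1) ^ k * ((N : ℝ) / Real.exp 1) ^ (N - k)) := by rw [h, e3]
    _ = _ := by ring

lemma choose_mul_sqrt_le (hk0 : 0 < k) (hk : k < N) :
    (N.choose k : ℝ) * √(N * (1 - mag N k ^ 2)) ≤ Real.exp (-(N * entropy (mag N k))) := by
  have hN : 0 < N := hk0.trans hk
  have hN' : (0 : ℝ) < N := by exact_mod_cast hN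
  have hfac : (N.choose k : ℝ) * k.factorial * (N - k).factorial = N.factorial := by
    exact_mod_cast Nat.choose_mul_factorial_mul_factorial hk.le
  have h1 := Stirling.le_factorial_stirling k
  have h2 := Stirling.le_factorial_stirling (N - k)
  have h3 := factorial_le_stirling hN
  set P : ℝ := (k / Real.exp 1) ^ k * (((N - k : ℕ) : ℝ) / Real.exp 1) ^ (N - k) with hP
  have hk' : (0 : ℝ) < k := by exact_mod_cast hk0
  have hNk' : (0 : ℝ) < ((N - k : ℕ) : ℝ) := by exact_mod_cast Nat.sub_pos_of_lt hk
  have hP0 : 0 < P := by positivity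
  set E := Real.exp (-(N * entropy (mag N k))) with hE
  have hE0 : 0 < E := Real.exp_pos _
  have hsq := sqrt_mul_sub hN hk.le
  have h4 : (N.choose k : ℝ) * (2 * Real.pi * (√k * √((N - k : ℕ) : ℝ)) * P)
      ≤ Real.exp 1 * √N * (E * P) := by
    have e : √(2 * Real.pi * k) * √(2 * Real.pi * ((N - k : ℕ) : ℝ))
        = 2 * Real.pi * (√k * √((N - k : ℕ) : ℝ)) := by
      rw [Real.sqrt_mul (by positivity) (k : ℝ), Real.sqrt_mul (by positivity) ((N - k : ℕ) : ℝ)]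
      have := Real.mul_self_sqrt (by positivity : 0 ≤ 2 * Real.pi)
      calc _ = (√(2 * Real.pi) * √(2 * Real.pi)) * (√k * √((N - k : ℕ) : ℝ)) := by ring
        _ = _ := by rw [this]
    rw [hE, hP, ← stirling_pow_eq hN hk.le, ← e]
    calc _ = (N.choose k : ℝ) * (√(2 * Real.pi * k) * (k / Real.exp 1) ^ k) *
          (√(2 * Real.pi * ((N - k : ℕ) : ℝ)) * (((N - k : ℕ) : ℝ) / Real.exp 1) ^ (N - k)) := by
          ring
      _ ≤ N.choose k * k.factorial * (N - k).factorial := by gcongr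
      _ = N.factorial := hfac
      _ ≤ _ := h3
  have h5 : (N.choose k : ℝ) * (Real.pi * (2 * (√k * √((N - k : ℕ) : ℝ)))) ≤ Real.exp 1 * √N * E := by
    refine le_of_mul_le_mul_right ?_ hP0
    calc _ = (N.choose k : ℝ) * (2 * Real.pi * (√k * √((N - k : ℕ) : ℝ)) * P) := by ring
      _ ≤ _ := h4
      _ = _ := by ring
  have h6 : (N.choose k : ℝ) * (Real.pi * (N * √(N * (1 - mag N k ^ 2)))) ≤ Real.exp 1 * N * E := by
    rw [← hsq]
    calc _ = (N.choose k : ℝ) * (Real.pi * (2 * (√k * √((N - k : ℕ) : ℝ)))) * √N := by ring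
      _ ≤ Real.exp 1 * √N * E * √N := by gcongr
      _ = Real.exp 1 * (√N * √N) * E := by ring
      _ = _ := by rw [Real.mul_self_sqrt hN'.le]
  have hpe : Real.exp 1 ≤ Real.pi := by
    have := Real.exp_one_lt_d9
    have := Real.pi_gt_three
    linarith
  refine le_of_mul_le_mul_left ?_ (by positivity : 0 < Real.pi * N)
  calc _ = (N.choose k : ℝ) * (Real.pi * (N * √(N * (1 - mag N k ^ 2)))) := by ring
    _ ≤ _ := h6
    _ ≤ Real.pi * N * E := by gcongr

lemma exp_entropy_le_choose (hk0 : 0 < k) (hk : k < N) :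
    Real.exp (-(N * entropy (mag N k))) ≤ 2 * (N.choose k * √(N * (1 - mag N k ^ 2))) := by
  have hN : 0 < N := hk0.trans hk
  have hN' : (0 : ℝ) < N := by exact_mod_cast hN
  have hfac : (N.choose k : ℝ) * k.factorial * (N - k).factorial = N.factorial := by
    exact_mod_cast Nat.choose_mul_factorial_mul_factorial hk.le
  have h1 := factorial_le_stirling hk0
  have h2 := factorial_le_stirling (Nat.sub_pos_of_lt hk)
  have h3 := Stirling.le_factorial_stirling N
  set P : ℝ := (k / Real.exp 1) ^ k * (((N - k : ℕ) : ℝ) / Real.exp 1) ^ (N - k) with hP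
  have hk' : (0 : ℝ) < k := by exact_mod_cast hk0
  have hNk' : (0 : ℝ) < ((N - k : ℕ) : ℝ) := by exact_mod_cast Nat.sub_pos_of_lt hk
  have hP0 : 0 < P := by positivity
  set E := Real.exp (-(N * entropy (mag N k))) with hE
  have hE0 : 0 < E := Real.exp_pos _
  have hsq := sqrt_mul_sub hN hk.le
  have h4 : √(2 * Real.pi) * √N * (E * P)
      ≤ N.choose k * (Real.exp 1 ^ 2 * (√k * √((N - k : ℕ) : ℝ)) * P) := by
    rw [hE, hP, ← stirling_pow_eq hN hk.le, ← Real.sqrt_mul (by positivity)]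
    refine h3.trans ?_
    rw [← hfac]
    calc _ ≤ (N.choose k : ℝ) * (Real.exp 1 * √k * (k / Real.exp 1) ^ k) *
          (Real.exp 1 * √((N - k : ℕ) : ℝ) * (((N - k : ℕ) : ℝ) / Real.exp 1) ^ (N - k)) := by
          gcongr
      _ = _ := by ring
  have h5 : √(2 * Real.pi) * √N * E ≤ N.choose k * (Real.exp 1 ^ 2 * (√k * √((N - k : ℕ) : ℝ))) := by
    refine le_of_mul_le_mul_right ?_ hP0
    calc _ = √(2 * Real.pi) * √N * (E * P) := by ring
      _ ≤ _ := h4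
      _ = _ := by ring
  have h6 : 2 * √(2 * Real.pi) * N * E
      ≤ N.choose k * (Real.exp 1 ^ 2 * (N * √(N * (1 - mag N k ^ 2)))) := by
    rw [← hsq]
    calc _ = 2 * √N * (√(2 * Real.pi) * √N * E) := by
          have := Real.mul_self_sqrt hN'.le
          calc _ = 2 * √(2 * Real.pi) * (√N * √N) * E := by rw [this]
            _ = _ := by ring
      _ ≤ 2 * √N * (N.choose k * (Real.exp 1 ^ 2 * (√k * √((N - k : ℕ) : ℝ)))) := by gcongr
      _ = _ := by ring
  have hpe : Real.exp 1 ^ 2 ≤ 4 * √(2 * Real.pi) := by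
    have h7 := Real.exp_one_lt_d9
    have h8 := Real.pi_gt_three
    have h9 : 2 ≤ √(2 * Real.pi) := Real.le_sqrt_of_sq_le (by linarith)
    have h10 := Real.exp_pos 1
    nlinarith
  refine le_of_mul_le_mul_left ?_ (by positivity : 0 < 2 * √(2 * Real.pi) * N)
  calc _ ≤ _ := h6
    _ ≤ N.choose k * (4 * √(2 * Real.pi) * (N * √(N * (1 - mag N k ^ 2)))) := by gcongr
    _ = _ := by ring

/-- The Curie-Weiss energy, times `-β`, of the configurations with `k` up-spins. -/
noncomputable def cwExponent (M : Params) (N k : ℕ) : ℝ :=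
  M.β * N * (mag N k ^ 2 / 2 + M.h * mag N k)

/-- The total Curie-Weiss weight of the configurations with `k` up-spins. -/
noncomputable def levelWeight (M : Params) (N k : ℕ) : ℝ :=
  N.choose k * Real.exp (cwExponent M N k)

variable {M : Params}

lemma levelWeight_nonneg : 0 ≤ levelWeight M N k := by
  unfold levelWeight
  positivity

lemma exp_entropy_mul_exp_cwExponent :
    Real.exp (-(N * entropy (mag N k))) * Real.exp (cwExponent M N k)
      = Real.exp (-M.β * N * freeEnergy M (mag N k)) := by
  rw [← Real.exp_add, cwExponent, freeEnergy]
  congr 1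
  have := M.β_pos.ne'
  field_simp
  ring

lemma levelWeight_le (hN : 0 < N) (hk : k ≤ N) :
    levelWeight M N k ≤ Real.exp (-M.β * N * freeEnergy M (mag N k)) := by
  rw [← exp_entropy_mul_exp_cwExponent, levelWeight]
  have := choose_le_exp_entropy hN hk
  gcongr

lemma levelWeight_mul_sqrt_le (hk0 : 0 < k) (hk : k < N) :
    levelWeight M N k * √(N * (1 - mag N k ^ 2))
      ≤ Real.exp (-M.β * N * freeEnergy M (mag N k)) := by
  rw [← exp_entropy_mul_exp_cwExponent, levelWeight, mul_right_comm]
  have := choose_mul_sqrt_le hk0 hk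
  gcongr

lemma le_levelWeight_mul_sqrt (hk0 : 0 < k) (hk : k < N) :
    Real.exp (-M.β * N * freeEnergy M (mag N k))
      ≤ 2 * (levelWeight M N k * √(N * (1 - mag N k ^ 2))) := by
  rw [← exp_entropy_mul_exp_cwExponent, levelWeight, mul_right_comm, ← mul_assoc]
  have := exp_entropy_le_choose hk0 hk
  gcongr

end Level

/-- A discrete Gaussian sum, compared with a geometric series through `t y² ≥ √t |y| - 1/4`. -/
lemma sum_exp_neg_sq_le {t x : ℝ} (ht : 0 < t) (ht1 : t ≤ 1) (hx : 0 ≤ x) (n : ℕ) :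
    ∑ k ∈ Finset.range n, Real.exp (-(t * (k - x) ^ 2)) ≤ 6 / √t := by
  set s := √t with hs
  have hs0 : 0 < s := Real.sqrt_pos.2 ht
  have hs1 : s ≤ 1 := Real.sqrt_le_one.2 ht1
  have hst : t = s ^ 2 := (Real.sq_sqrt ht.le).symm
  set r := Real.exp (-s) with hr
  have hr0 : 0 < r := Real.exp_pos _
  have hr1 : r ≤ (1 + s)⁻¹ := by
    rw [hr, Real.exp_neg]
    exact inv_anti₀ (by linarith) (by linarith [Real.add_one_le_exp s])
  have hr2 : s / 2 ≤ 1 - r := by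
    have : (1 + s)⁻¹ ≤ 1 - s / 2 := by
      rw [inv_le_iff_one_le_mul₀ (by linarith)]
      nlinarith
    linarith
  have hgeom : ∀ m, ∑ j ∈ Finset.range m, r ^ j ≤ 2 / s := by
    intro m
    have h1 : r < 1 := by linarith
    rw [geom_sum_eq h1.ne, ← neg_div_neg_eq, neg_sub, neg_sub,
      div_le_div_iff₀ (by linarith) hs0]
    nlinarith [pow_pos hr0 m]
  have he : Real.exp (1 / 4) ≤ 4 / 3 := by
    have h1 := Real.add_one_le_exp (-(1 / 4 : ℝ))
    rw [Real.exp_neg] at h1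
    have h2 := Real.exp_pos (1 / 4 : ℝ)
    rw [le_inv_comm₀ (by norm_num) h2] at h1
    norm_num at h1 ⊢
    linarith
  set c := ⌈x⌉₊ with hc
  have hcx : x ≤ c := Nat.le_ceil x
  have hcx' : (c : ℝ) < x + 1 := Nat.ceil_lt_add_one hx
  have hexp : ∀ {j : ℕ} {y : ℝ}, (j : ℝ) ≤ |y| → Real.exp (-(t * y ^ 2)) ≤ 4 / 3 * r ^ j := by
    intro j y hy
    calc Real.exp (-(t * y ^ 2)) ≤ Real.exp (1 / 4 + j * (-s)) := by
          refine Real.exp_le_exp.2 ?_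
          rw [hst, ← sq_abs y]
          nlinarith [sq_nonneg (s * |y| - 1 / 2), mul_le_mul_of_nonneg_left hy hs0.le]
      _ = Real.exp (1 / 4) * r ^ j := by rw [Real.exp_add, Real.exp_nat_mul]
      _ ≤ 4 / 3 * r ^ j := by gcongr
  have hterm : ∀ k : ℕ, Real.exp (-(t * (k - x) ^ 2))
      ≤ 4 / 3 * (if c ≤ k then r ^ (k - c) else r ^ (c - 1 - k)) := by
    intro k
    split_ifs with h
    · refine hexp (le_trans ?_ (le_abs_self _))
      rw [Nat.cast_sub h]
      linarith
    · refine hexp (le_trans ?_ (neg_le_abs _))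
      rw [Nat.cast_sub (by omega), Nat.cast_sub (by omega)]
      push_cast
      linarith
  have hsplit : ∑ k ∈ Finset.range n, (if c ≤ k then r ^ (k - c) else r ^ (c - 1 - k))
      ≤ 2 / s + 2 / s := by
    rw [Finset.sum_ite]
    refine add_le_add ?_ ?_
    · have : (Finset.range n).filter (fun k => c ≤ k) = Finset.Ico c n := by
        ext k
        simp [Finset.mem_Ico, and_comm]
      rw [this, Finset.sum_Ico_eq_sum_range]
      simpa using hgeom (n - c)
    · calc _ ≤ ∑ k ∈ Finset.range c, r ^ (c - 1 - k) := by
            refine Finset.sum_le_sum_of_subset_of_nonneg ?_ fun _ _ _ => by positivity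
            intro k hk
            simp only [Finset.mem_filter, Finset.mem_range, not_le] at hk ⊢
            exact hk.2
        _ = ∑ j ∈ Finset.range c, r ^ j := Finset.sum_range_reflect (fun j => r ^ j) c
        _ ≤ _ := hgeom c
  calc ∑ k ∈ Finset.range n, Real.exp (-(t * (k - x) ^ 2))
      ≤ ∑ k ∈ Finset.range n, 4 / 3 * (if c ≤ k then r ^ (k - c) else r ^ (c - 1 - k)) :=
        Finset.sum_le_sum fun k _ => hterm k
    _ = 4 / 3 * ∑ k ∈ Finset.range n, (if c ≤ k then r ^ (k - c) else r ^ (c - 1 - k)) := by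
        rw [Finset.mul_sum]
    _ ≤ 4 / 3 * (2 / s + 2 / s) := by gcongr
    _ ≤ 6 / s := by
        rw [← add_div, mul_div_assoc', div_le_div_iff_of_pos_right hs0]
        norm_num

/-! ### Laplace's method for the left well -/

lemma eventually_succ_mul_exp_neg_le_one {c : ℝ} (hc : 0 < c) :
    ∀ᶠ N : ℕ in atTop, ((N : ℝ) + 1) * Real.exp (-c * N) ≤ 1 := by
  have h1 : Tendsto (fun x : ℝ => x * Real.exp (-c * x)) atTop (𝓝 0) := by
    simpa using tendsto_rpow_mul_exp_neg_mul_atTop_nhds_zero 1 c hc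
  have h2 : Tendsto (fun x : ℝ => Real.exp (-c * x)) atTop (𝓝 0) := by
    simpa using tendsto_rpow_mul_exp_neg_mul_atTop_nhds_zero 0 c hc
  have h3 := (h1.add h2).comp tendsto_natCast_atTop_atTop
  rw [add_zero] at h3
  filter_upwards [h3.eventually_le_const (zero_lt_one)] with N hN
  simp only [Function.comp] at hN
  linarith

namespace IsDoubleWell

variable {M : Params} {mMinus mStar mPlus : ℝ} (W : IsDoubleWell M mMinus mStar mPlus)
include W

lemma one_sub_sq_pos : 0 < 1 - mMinus ^ 2 := by
  have h1 := W.mMinus_mem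
  nlinarith [h1.1, h1.2]

lemma prefactor_eq : (1 - mMinus ^ 2) * (M.β * iteratedDeriv 2 (freeEnergy M) mMinus)
    = 1 - M.β * (1 - mMinus ^ 2) := by
  have h1 := W.one_sub_sq_pos.ne'
  have h2 := M.β_pos.ne'
  rw [W.iteratedDeriv_two]
  field_simp
  ring

lemma prefactor_pos :
    0 < (1 - mMinus ^ 2) * (M.β * iteratedDeriv 2 (freeEnergy M) mMinus) := by
  rw [W.prefactor_eq]
  linarith [W.inv_lt_mMinus]

lemma sqrt_prefactor_le_one :
    √((1 - mMinus ^ 2) * (M.β * iteratedDeriv 2 (freeEnergy M) mMinus)) ≤ 1 := by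
  rw [W.prefactor_eq]
  refine Real.sqrt_le_one.2 ?_
  have := mul_pos M.β_pos W.one_sub_sq_pos
  linarith

lemma sum_levelWeight_le : ∀ᶠ N : ℕ in atTop,
    ∑ k ∈ (Finset.range (N + 1)).filter (fun k => mag N k ≤ mStar), levelWeight M N k
      ≤ 10 * (Real.exp (-M.β * N * freeEnergy M mMinus) /
        √((1 - mMinus ^ 2) * (M.β * iteratedDeriv 2 (freeEnergy M) mMinus))) := by
  obtain ⟨δ, hδ, hquad⟩ := W.quadratic_bounds
  obtain ⟨γ, hγ, hgap⟩ := W.exists_gap hδ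
  have hc := W.curvature_pos
  have hv := W.one_sub_sq_pos
  have hβ := M.β_pos
  have hD0 := W.prefactor_pos
  have hD1 := W.sqrt_prefactor_le_one
  have hm := W.mMinus_mem
  rw [W.iteratedDeriv_two] at hD0 hD1 ⊢
  set c := -1 + M.β⁻¹ / (1 - mMinus ^ 2) with hcdef
  set v := 1 - mMinus ^ 2 with hvdef
  set D := v * (M.β * c) with hD
  have hsD : 0 < √D := Real.sqrt_pos.2 hD0
  have hev1 : ∀ᶠ N : ℕ in atTop, M.β * c ≤ N := tendsto_natCast_atTop_atTop.eventually_ge_atTop _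
  have hev2 : ∀ᶠ N : ℕ in atTop, ((N : ℝ) + 1) * Real.exp (-(M.β * γ) * N) ≤ 1 :=
    eventually_succ_mul_exp_neg_le_one (by positivity)
  filter_upwards [hev1, hev2, eventually_gt_atTop 0] with N h1 h2 hN
  have hN' : (0 : ℝ) < N := by exact_mod_cast hN
  set t := M.β * c / N with ht
  have ht0 : 0 < t := by positivity
  have ht1 : t ≤ 1 := (div_le_one hN').2 h1
  set x := N * (1 + mMinus) / 2 with hx
  have hx0 : 0 ≤ x := by
    have : 0 < 1 + mMinus := by linarith [hm.1]
    positivity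
  set e0 := Real.exp (-M.β * N * freeEnergy M mMinus) with he0
  have he0p : 0 < e0 := Real.exp_pos _
  have hsNv : 0 < √(N * v) := Real.sqrt_pos.2 (by positivity)
  have hpt : ∀ k ∈ (Finset.range (N + 1)).filter (fun k => mag N k ≤ mStar), levelWeight M N k
      ≤ e0 * (√2 / √(N * v)) * Real.exp (-(t * (k - x) ^ 2))
        + e0 * Real.exp (-(M.β * γ) * N) := by
    intro k hk
    rw [Finset.mem_filter, Finset.mem_range, Nat.lt_succ_iff] at hk
    by_cases hd : |mag N k - mMinus| ≤ δ
    · obtain ⟨b1, b2, -, b3, -⟩ := hquad _ hd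
      have hk0 : 0 < k := by
        rcases Nat.eq_zero_or_pos k with h | h
        · exfalso
          have := b1.1
          simp [mag, h] at this
        · exact h
      have hkN : k < N := by
        rcases hk.1.lt_or_eq with h | h
        · exact h
        · exfalso
          have h5 := b1.2
          rw [h, mag, mul_div_assoc, div_self hN'.ne'] at h5
          norm_num at h5
      have h3 := levelWeight_mul_sqrt_le (M := M) hk0 hkN
      have h4 : √(N * v) / √2 ≤ √(N * (1 - mag N k ^ 2)) := by
        rw [← Real.sqrt_div (by positivity)]
        refine Real.sqrt_le_sqrt ?_
        rw [mul_div_assoc]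
        gcongr
      have h5 : Real.exp (-M.β * N * freeEnergy M (mag N k))
          ≤ e0 * Real.exp (-(t * (k - x) ^ 2)) := by
        rw [he0, ← Real.exp_add]
        refine Real.exp_le_exp.2 ?_
        have e : t * (k - x) ^ 2 = M.β * N * (1 / 4 * c * (mag N k - mMinus) ^ 2) := by
          rw [ht, hx, mag]
          field_simp
          ring
        rw [e]
        have := mul_le_mul_of_nonneg_left b3 (by positivity : 0 ≤ M.β * (N : ℝ))
        linarith
      have h6 : levelWeight M N k * (√(N * v) / √2) ≤ e0 * Real.exp (-(t * (k - x) ^ 2)) :=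
        (mul_le_mul_of_nonneg_left h4 levelWeight_nonneg).trans (h3.trans h5)
      have h7 : levelWeight M N k ≤ e0 * (√2 / √(N * v)) * Real.exp (-(t * (k - x) ^ 2)) := by
        rw [← le_div_iff₀ (by positivity)] at h6
        refine h6.trans (le_of_eq ?_)
        field_simp
      have : 0 ≤ e0 * Real.exp (-(M.β * γ) * N) := by positivity
      linarith
    · have h3 := hgap _ ⟨(mag_mem_Icc hk.1).1, hk.2⟩ (not_le.1 hd).le
      have h4 := levelWeight_le (M := M) hN hk.1
      have h5 : Real.exp (-M.β * N * freeEnergy M (mag N k)) ≤ e0 * Real.exp (-(M.β * γ) * N) := by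
        rw [he0, ← Real.exp_add]
        refine Real.exp_le_exp.2 ?_
        have := mul_le_mul_of_nonneg_left h3 (by positivity : 0 ≤ M.β * (N : ℝ))
        linarith
      have : 0 ≤ e0 * (√2 / √(N * v)) * Real.exp (-(t * (k - x) ^ 2)) := by positivity
      linarith
  have hst : √(N * v) * √t = √D := by
    rw [← Real.sqrt_mul (by positivity)]
    congr 1
    rw [ht, hD]
    field_simp
  have hs2 : √2 ≤ 3 / 2 := Real.sqrt_le_iff.2 ⟨by norm_num, by norm_num⟩
  calc ∑ k ∈ (Finset.range (N + 1)).filter (fun k => mag N k ≤ mStar), levelWeight M N k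
      ≤ ∑ k ∈ (Finset.range (N + 1)).filter (fun k => mag N k ≤ mStar),
          (e0 * (√2 / √(N * v)) * Real.exp (-(t * (k - x) ^ 2))
            + e0 * Real.exp (-(M.β * γ) * N)) := Finset.sum_le_sum hpt
    _ ≤ ∑ k ∈ Finset.range (N + 1),
          (e0 * (√2 / √(N * v)) * Real.exp (-(t * (k - x) ^ 2))
            + e0 * Real.exp (-(M.β * γ) * N)) :=
        Finset.sum_le_sum_of_subset_of_nonneg (Finset.filter_subset _ _)
          fun _ _ _ => by positivity
    _ = e0 * (√2 / √(N * v)) * ∑ k ∈ Finset.range (N + 1), Real.exp (-(t * (k - x) ^ 2))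
          + e0 * ((N + 1) * Real.exp (-(M.β * γ) * N)) := by
        rw [Finset.sum_add_distrib, ← Finset.mul_sum, Finset.sum_const, Finset.card_range,
          nsmul_eq_mul]
        push_cast
        ring
    _ ≤ e0 * (√2 / √(N * v)) * (6 / √t) + e0 * 1 := by
        gcongr
        exact sum_exp_neg_sq_le ht0 ht1 hx0 _
    _ = 6 * √2 * (e0 / √D) + e0 * 1 := by
        rw [← hst]
        have : √t ≠ 0 := (Real.sqrt_pos.2 ht0).ne'
        field_simp
    _ ≤ 6 * (3 / 2) * (e0 / √D) + e0 / √D := by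
        gcongr
        rw [mul_one]
        exact le_div_self he0p.le hsD hD1
    _ = 10 * (e0 / √D) := by ring

set_option maxHeartbeats 1000000 in
lemma le_sum_levelWeight : ∀ᶠ N : ℕ in atTop, ∀ a ≤ N, |mag N a - mMinus| ≤ 1 / N →
    Real.exp (-M.β * N * freeEnergy M mMinus) /
        √((1 - mMinus ^ 2) * (M.β * iteratedDeriv 2 (freeEnergy M) mMinus))
      ≤ 40 * ∑ k ∈ Finset.range (a + 1), levelWeight M N k := by
  obtain ⟨δ, hδ, hquad⟩ := W.quadratic_bounds
  have hc := W.curvature_pos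
  have hv := W.one_sub_sq_pos
  have hβ := M.β_pos
  have hD0 := W.prefactor_pos
  have hm := W.mMinus_mem
  have hm1 : 0 < 1 + mMinus := by linarith [hm.1]
  rw [W.iteratedDeriv_two] at hD0 ⊢
  set c := -1 + M.β⁻¹ / (1 - mMinus ^ 2) with hcdef
  set v := 1 - mMinus ^ 2 with hvdef
  set D := v * (M.β * c) with hD
  have hsD : 0 < √D := Real.sqrt_pos.2 hD0
  have hbc : 0 < M.β * c := by positivity
  have hsbc : 0 < √(M.β * c) := Real.sqrt_pos.2 hbc
  set q := (√(M.β * c))⁻¹ with hq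
  have hq0 : 0 < q := by positivity
  have hlim : Tendsto (fun N : ℕ => √(N : ℝ)) atTop atTop :=
    Real.tendsto_sqrt_atTop.comp tendsto_natCast_atTop_atTop
  filter_upwards [hlim.eventually_ge_atTop (q / δ), hlim.eventually_ge_atTop (4 / q),
    hlim.eventually_ge_atTop ((q + 1) / (1 + mMinus)), hlim.eventually_ge_atTop 1,
    eventually_gt_atTop 0] with N h1 h2 h3 h4 hN a ha hclose
  have hN' : (0 : ℝ) < N := by exact_mod_cast hN
  have hNs : (N : ℝ) = √N * √N := (Real.mul_self_sqrt hN'.le).symm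
  set y := √(N : ℝ) with hy
  have hy0 : 0 < y := by linarith
  -- Levels at distance at most `T / N` from the bottom of the well carry comparable weights.
  set T := q * y with hT
  have hT0 : 0 < T := by positivity
  have hTδ : T ≤ δ * N := by
    rw [div_le_iff₀ hδ] at h1
    rw [hNs, hT]
    nlinarith
  have hT4 : 4 ≤ T := by
    rw [div_le_iff₀ hq0] at h2
    linarith
  have hTN : T + 1 ≤ N * (1 + mMinus) := by
    rw [div_le_iff₀ hm1] at h3
    rw [hNs, hT]
    nlinarith
  set n := ⌊T / 2⌋₊ with hn
  have hnT : (n : ℝ) ≤ T / 2 := Nat.floor_le (by positivity)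
  have hnT' : T / 4 ≤ n := by
    have := Nat.lt_floor_add_one (T / 2)
    rw [← hn] at this
    linarith
  have hmaga : (N : ℝ) * mag N a = 2 * a - N := by
    rw [mag]
    field_simp
    ring
  have hclose' : |N * mag N a - N * mMinus| ≤ 1 := by
    rw [← mul_sub, abs_mul, abs_of_pos hN']
    calc _ ≤ (N : ℝ) * (1 / N) := by gcongr
      _ = 1 := by field_simp
  have hna : n ≤ a := by
    have h5 := (abs_le.1 hclose').1
    rw [hmaga] at h5
    have h6 : (n : ℝ) ≤ a := by linarith
    exact_mod_cast h6
  set e0 := Real.exp (-M.β * N * freeEnergy M mMinus) with he0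
  have he0p : 0 < e0 := Real.exp_pos _
  have hsNv : 0 < √(N * v) := Real.sqrt_pos.2 (by positivity)
  have hqD : T / √(N * v) = 1 / √D := by
    rw [hT, hq, hy, hD, Real.sqrt_mul hN'.le, Real.sqrt_mul hv.le]
    have := Real.sqrt_pos.2 hN'
    have := Real.sqrt_pos.2 hv
    field_simp
  have hpt : ∀ j ∈ Finset.range n, e0 / (10 * √(N * v)) ≤ levelWeight M N (a - j) := by
    intro j hj
    rw [Finset.mem_range] at hj
    have hja : j ≤ a := hj.le.trans hna
    have hj' : (j : ℝ) + 1 ≤ n := by exact_mod_cast hj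
    have hmagj : (N : ℝ) * (mag N (a - j) - mMinus) = N * mag N a - N * mMinus - 2 * j := by
      rw [mag, mag, Nat.cast_sub hja]
      field_simp
      ring
    have hdist : |mag N (a - j) - mMinus| ≤ T / N := by
      have e : |mag N (a - j) - mMinus| * N = |N * (mag N (a - j) - mMinus)| := by
        rw [abs_mul, abs_of_pos hN', mul_comm]
      rw [le_div_iff₀ hN', e, hmagj, abs_le]
      rw [abs_le] at hclose'
      constructor
      · linarith
      · have : (0 : ℝ) ≤ j := Nat.cast_nonneg j
        linarith
    obtain ⟨b1, -, b2, -, b3⟩ := hquad _ (hdist.trans ((div_le_iff₀ hN').2 hTδ))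
    have hk0 : 0 < a - j := by
      rcases Nat.eq_zero_or_pos (a - j) with h | h
      · exfalso
        have := b1.1
        simp [mag, h] at this
      · exact h
    have hkN : a - j < N := by
      rcases (show a - j ≤ N by omega).lt_or_eq with h | h
      · exact h
      · exfalso
        have h5 := b1.2
        rw [h, mag, mul_div_assoc, div_self hN'.ne'] at h5
        norm_num at h5
    have h5 := le_levelWeight_mul_sqrt (M := M) hk0 hkN
    have h6 : √(N * (1 - mag N (a - j) ^ 2)) ≤ 3 / 2 * √(N * v) := by
      rw [Real.sqrt_le_left (by positivity), mul_pow, Real.sq_sqrt (by positivity)]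
      nlinarith [mul_pos hN' hv, mul_le_mul_of_nonneg_left b2 hN'.le]
    have h7 : e0 * Real.exp (-1) ≤ Real.exp (-M.β * N * freeEnergy M (mag N (a - j))) := by
      rw [he0, ← Real.exp_add]
      refine Real.exp_le_exp.2 ?_
      have h8 : (mag N (a - j) - mMinus) ^ 2 ≤ (T / N) ^ 2 := by
        rw [← sq_abs]
        gcongr
      have h9 : M.β * N * (c * (T / N) ^ 2) = 1 := by
        rw [hT, hq, hy, div_pow, mul_pow, inv_pow, Real.sq_sqrt hbc.le, Real.sq_sqrt hN'.le]
        field_simp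
      have h10 : M.β * N * (freeEnergy M (mag N (a - j)) - freeEnergy M mMinus) ≤ 1 := by
        rw [← h9]
        exact mul_le_mul_of_nonneg_left (b3.trans (by gcongr)) (by positivity)
      linarith
    have h8 : (3 / 10 : ℝ) ≤ Real.exp (-1) := by
      rw [Real.exp_neg, le_inv_comm₀ (by norm_num) (Real.exp_pos _)]
      have := Real.exp_one_lt_d9
      norm_num
      linarith
    have h9 : e0 * (3 / 10) ≤ 2 * (levelWeight M N (a - j) * (3 / 2 * √(N * v))) := by
      calc e0 * (3 / 10) ≤ e0 * Real.exp (-1) := by gcongr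
        _ ≤ _ := h7.trans h5
        _ ≤ _ := by
          have := levelWeight_nonneg (M := M) (N := N) (k := a - j)
          gcongr
    rw [div_le_iff₀ (by positivity)]
    linarith
  have hsum : (n : ℝ) * (e0 / (10 * √(N * v))) ≤ ∑ k ∈ Finset.range (a + 1), levelWeight M N k := by
    calc (n : ℝ) * (e0 / (10 * √(N * v))) = ∑ j ∈ Finset.range n, e0 / (10 * √(N * v)) := by
          rw [Finset.sum_const, Finset.card_range, nsmul_eq_mul]
      _ ≤ ∑ j ∈ Finset.range n, levelWeight M N (a - j) := Finset.sum_le_sum hpt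
      _ ≤ ∑ j ∈ Finset.range (a + 1), levelWeight M N (a - j) :=
          Finset.sum_le_sum_of_subset_of_nonneg
            (Finset.range_subset_range.2 (by omega)) fun _ _ _ => levelWeight_nonneg
      _ = _ := by
          rw [← Finset.sum_range_reflect (fun k => levelWeight M N k) (a + 1)]
          exact Finset.sum_congr rfl fun j _ => by rw [Nat.add_sub_cancel]
  calc e0 / √D = e0 * (T / √(N * v)) := by
        rw [hqD]
        ring
    _ = 40 * (T / 4 * (e0 / (10 * √(N * v)))) := by
        field_simp
        norm_num
    _ ≤ 40 * (n * (e0 / (10 * √(N * v)))) := by gcongr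
    _ ≤ _ := by gcongr

end IsDoubleWell

/-! ### Exponential moments of the random Hamiltonian -/

section Moments

variable {M : Params} {N : ℕ}

instance : IsProbabilityMeasure (couplingLaw M N) := by
  unfold couplingLaw
  infer_instance

/-- The product of the two spins at the ends of a pair. -/
noncomputable def pairSign (σ : Config N) (e : Pair N) : ℝ := spin (σ e.1.1) * spin (σ e.1.2)

lemma spin_eq (b : Bool) : spin b = 1 ∨ spin b = -1 := by cases b <;> simp [spin]

lemma spin_mul_self (b : Bool) : spin b * spin b = 1 := by cases b <;> simp [spin]

lemma pairSign_eq (σ : Config N) (e : Pair N) : pairSign σ e = 1 ∨ pairSign σ e = -1 := by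
  unfold pairSign
  rcases spin_eq (σ e.1.1) with h | h <;> rcases spin_eq (σ e.1.2) with h' | h' <;> simp [h, h']

lemma sum_spin (hN : 0 < N) (σ : Config N) : ∑ i, spin (σ i) = N * mag N (up σ) := by
  have hN' : (N : ℝ) ≠ 0 := by exact_mod_cast hN.ne'
  have h1 : ∀ i, spin (σ i) = 2 * (if σ i = true then 1 else 0) - 1 := by
    intro i
    cases σ i
    · simp [spin]
    · norm_num [spin]
  simp_rw [h1]
  rw [Finset.sum_sub_distrib, ← Finset.mul_sum, Finset.sum_boole]
  simp only [Finset.sum_const, Finset.card_univ, Fintype.card_fin, nsmul_eq_mul, mul_one]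
  rw [mag, up]
  field_simp
  ring

lemma sum_pair (F : Fin N → Fin N → ℝ) (hF : ∀ i j, F i j = F j i) :
    ∑ i, ∑ j, F i j = ∑ i, F i i + 2 * ∑ e : Pair N, F e.1.1 e.1.2 := by
  have h0 : ∑ e : Pair N, F e.1.1 e.1.2 = ∑ i, ∑ j, if i < j then F i j else 0 := by
    rw [← Finset.sum_product', Finset.univ_product_univ, ← Finset.sum_filter]
    rw [Finset.sum_subtype (p := fun e : Fin N × Fin N => e.1 < e.2)
      (Finset.univ.filter fun e : Fin N × Fin N => e.1 < e.2) (by simp)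
      (fun e => F e.1 e.2)]
  have h1 : ∑ i, ∑ j, (if j < i then F i j else 0) = ∑ i, ∑ j, if i < j then F i j else 0 := by
    rw [Finset.sum_comm]
    refine Finset.sum_congr rfl fun i _ => Finset.sum_congr rfl fun j _ => ?_
    rw [hF]
  have h2 : ∑ i, F i i = ∑ i, ∑ j, if j = i then F i j else 0 := by simp
  rw [two_mul, h0]
  conv_rhs => rw [h2]
  conv_rhs => enter [2, 2]; rw [← h1]
  rw [← Finset.sum_add_distrib, ← Finset.sum_add_distrib]
  refine Finset.sum_congr rfl fun i _ => ?_
  rw [← Finset.sum_add_distrib, ← Finset.sum_add_distrib]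
  refine Finset.sum_congr rfl fun j _ => ?_
  rcases lt_trichotomy i j with h | h | h
  · simp [h, h.ne', h.not_gt]
  · simp [h]
  · simp [h, h.ne, h.not_gt]

lemma sum_pairSign (hN : 0 < N) (σ : Config N) :
    ∑ e, pairSign σ e = ((N * mag N (up σ)) ^ 2 - N) / 2 := by
  have h := sum_pair (fun i j => spin (σ i) * spin (σ j)) (fun i j => mul_comm _ _)
  rw [← Finset.sum_mul_sum, sum_spin hN] at h
  simp only [spin_mul_self, Finset.sum_const, Finset.card_univ, Fintype.card_fin, nsmul_eq_mul,
    mul_one] at h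
  unfold pairSign
  linarith

lemma card_pair : (Fintype.card (Pair N) : ℝ) = (N ^ 2 - N) / 2 := by
  have h := sum_pair (N := N) (fun _ _ => 1) (fun _ _ => rfl)
  simp only [Finset.sum_const, Finset.card_univ, Fintype.card_fin, nsmul_eq_mul, mul_one] at h
  linarith

/-- The exponent of the Boltzmann weight is the Curie-Weiss exponent, up to the diagonal term
`-β / 2`, plus a centred linear function of the couplings. -/
lemma neg_mul_hamiltonian_eq (hN : 0 < N) (J : Couplings N) (σ : Config N) :
    -M.β * hamiltonian M J σ = cwExponent M N (up σ) - M.β / 2 +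
      ∑ e, M.β / (N * M.p) * pairSign σ e * (coupling (J e) - M.p) := by
  have hN' : (N : ℝ) ≠ 0 := by exact_mod_cast hN.ne'
  have hp := M.p_pos.ne'
  have h1 : ∑ e : Pair N, M.β / (N * M.p) * pairSign σ e * (coupling (J e) - M.p)
      = M.β / (N * M.p) * ∑ e : Pair N, coupling (J e) * spin (σ e.1.1) * spin (σ e.1.2)
        - M.β / N * ∑ e, pairSign σ e := by
    rw [Finset.mul_sum, Finset.mul_sum, ← Finset.sum_sub_distrib]
    refine Finset.sum_congr rfl fun e _ => ?_
    unfold pairSign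
    field_simp
  rw [h1, sum_pairSign hN, hamiltonian, sum_spin hN, cwExponent]
  field_simp
  ring

/-- The exponential moment of a centred Bernoulli variable. -/
noncomputable def centredMgf (p y : ℝ) : ℝ :=
  p * Real.exp ((1 - p) * y) + (1 - p) * Real.exp (-p * y)

lemma abs_centredMgf_sub_le {p y : ℝ} (hp : 0 < p) (hp1 : p < 1) (hy : |y| ≤ 1) :
    |centredMgf p y - (1 + p * (1 - p) * y ^ 2 / 2)| ≤ 2 / 9 * |y| ^ 3 := by
  have bound : ∀ {z : ℝ}, |z| ≤ |y| → |Real.exp z - (1 + z + z ^ 2 / 2)| ≤ 2 / 9 * |y| ^ 3 := by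
    intro z hz
    have h := Real.exp_bound (hz.trans hy) (n := 3) (by norm_num)
    norm_num [Finset.sum_range_succ, Nat.factorial] at h
    calc _ ≤ |z| ^ 3 * (2 / 9) := h
      _ ≤ |y| ^ 3 * (2 / 9) := by gcongr
      _ = _ := by ring
  have h1 := bound (z := (1 - p) * y) (by
    rw [abs_mul, abs_of_pos (by linarith : 0 < 1 - p)]
    nlinarith [abs_nonneg y])
  have h2 := bound (z := -p * y) (by
    rw [abs_mul, abs_neg, abs_of_pos hp]
    nlinarith [abs_nonneg y])
  rw [abs_le] at h1 h2 ⊢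
  have e : centredMgf p y - (1 + p * (1 - p) * y ^ 2 / 2)
      = p * (Real.exp ((1 - p) * y) - (1 + (1 - p) * y + ((1 - p) * y) ^ 2 / 2))
        + (1 - p) * (Real.exp (-p * y) - (1 + -p * y + (-p * y) ^ 2 / 2)) := by
    unfold centredMgf
    ring
  rw [e]
  constructor <;> nlinarith [h1.1, h1.2, h2.1, h2.2]

lemma centredMgf_pos {p y : ℝ} (hp : 0 < p) (hp1 : p < 1) : 0 < centredMgf p y := by
  have : 0 < 1 - p := by linarith
  unfold centredMgf
  positivity

lemma centredMgf_le {p y : ℝ} (hp : 0 < p) (hp1 : p < 1) (hy : |y| ≤ 1) :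
    centredMgf p y ≤ Real.exp (p * (1 - p) * y ^ 2 / 2 + |y| ^ 3) := by
  have h := (abs_le.1 (abs_centredMgf_sub_le hp hp1 hy)).2
  have h2 := Real.add_one_le_exp (p * (1 - p) * y ^ 2 / 2 + |y| ^ 3)
  have : 0 ≤ |y| ^ 3 := by positivity
  linarith

lemma le_centredMgf {p y : ℝ} (hp : 0 < p) (hp1 : p < 1) (hy : |y| ≤ 1) :
    Real.exp (p * (1 - p) * y ^ 2 / 2 - |y| ^ 3) ≤ centredMgf p y := by
  have h := (abs_le.1 (abs_centredMgf_sub_le hp hp1 hy)).1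
  have hy0 := abs_nonneg y
  have hpq : p * (1 - p) ≤ 1 / 4 := by nlinarith [sq_nonneg (p - 1 / 2)]
  have hpq0 : 0 < p * (1 - p) := mul_pos hp (by linarith)
  set v := p * (1 - p) * y ^ 2 / 2 with hv
  set r := |y| ^ 3 with hr
  have hr0 : 0 ≤ r := by positivity
  have hr1 : r ≤ 1 := pow_le_one₀ hy0 hy
  have hv0 : 0 ≤ v := by positivity
  have hv1 : v ≤ |y| ^ 2 / 8 := by
    rw [hv, ← sq_abs y]
    nlinarith [sq_nonneg |y|]
  have hvr : v ^ 2 ≤ r / 64 := by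
    have h4 : |y| ^ 4 ≤ |y| ^ 3 := pow_le_pow_of_le_one hy0 hy (by norm_num)
    calc v ^ 2 ≤ (|y| ^ 2 / 8) ^ 2 := by gcongr
      _ = |y| ^ 4 / 64 := by ring
      _ ≤ _ := by gcongr
  have hw1 : v - r < 1 := by nlinarith [pow_le_one₀ hy0 hy (n := 2)]
  have hexp : Real.exp (v - r) ≤ (1 - (v - r))⁻¹ := by
    rw [← neg_neg (v - r), Real.exp_neg]
    refine inv_anti₀ (by linarith) ?_
    have := Real.add_one_le_exp (-(v - r))
    linarith
  refine hexp.trans ?_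
  have h5 : (1 - (v - r))⁻¹ ≤ 1 + v - 2 / 9 * r := by
    rw [inv_le_iff_one_le_mul₀ (by linarith)]
    nlinarith [mul_nonneg hv0 hr0, mul_nonneg hr0 (sub_nonneg.2 hr1)]
  linarith

lemma integral_exp_linear (y : Pair N → ℝ) :
    ∫ J, Real.exp (∑ e, y e * (coupling (J e) - M.p)) ∂couplingLaw M N
      = ∏ e, centredMgf M.p (y e) := by
  simp_rw [Real.exp_sum]
  rw [couplingLaw, integral_fintype_prod_eq_prod
    (f := fun e b => Real.exp (y e * (coupling b - M.p)))]
  refine Finset.prod_congr rfl fun e _ => ?_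
  rw [integral_bernoulliMeasure]
  simp only [coupling, if_true, Bool.false_eq_true, if_false, smul_eq_mul, centredMgf, zero_sub]
  congr 3
  · ring
  · ring

lemma couplings_integrable (F : Couplings N → ℝ) : Integrable F (couplingLaw M N) :=
  Integrable.of_finite

lemma integral_exp_linear_le {y : Pair N → ℝ} {r : ℝ} (hr0 : 0 ≤ r) (hr : r ≤ 1)
    (hy : ∀ e, |y e| ≤ r) :
    ∫ J, Real.exp (∑ e, y e * (coupling (J e) - M.p)) ∂couplingLaw M N
      ≤ Real.exp (N ^ 2 / 2 * (M.p * (1 - M.p) * r ^ 2 / 2 + r ^ 3)) := by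
  have hp := M.p_pos
  have hp1 := M.p_lt_one
  have hpq0 : 0 < M.p * (1 - M.p) := mul_pos hp (by linarith)
  rw [integral_exp_linear]
  calc ∏ e, centredMgf M.p (y e)
      ≤ ∏ _e : Pair N, Real.exp (M.p * (1 - M.p) * r ^ 2 / 2 + r ^ 3) := by
        refine Finset.prod_le_prod (fun e _ => (centredMgf_pos hp hp1).le) fun e _ => ?_
        refine (centredMgf_le hp hp1 ((hy e).trans hr)).trans (Real.exp_le_exp.2 ?_)
        rw [← sq_abs (y e)]
        have := hy e
        gcongr
    _ = Real.exp (Fintype.card (Pair N) * (M.p * (1 - M.p) * r ^ 2 / 2 + r ^ 3)) := by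
        rw [Finset.prod_const, Finset.card_univ, ← Real.exp_nat_mul]
    _ ≤ _ := by
        refine Real.exp_le_exp.2 ?_
        rw [card_pair]
        have : 0 ≤ M.p * (1 - M.p) * r ^ 2 / 2 + r ^ 3 := by positivity
        refine mul_le_mul_of_nonneg_right ?_ this
        have : (0 : ℝ) ≤ N := Nat.cast_nonneg N
        linarith

/-- The part of the partition function carried by the configurations in `S`. -/
noncomputable def partialZ (M : Params) (S : Finset (Config N)) (J : Couplings N) : ℝ :=
  ∑ σ ∈ S, Real.exp (-M.β * hamiltonian M J σ)

/-- The Curie-Weiss analogue of `partialZ`. -/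
noncomputable def partialCW (M : Params) (S : Finset (Config N)) : ℝ :=
  ∑ σ ∈ S, Real.exp (cwExponent M N (up σ))

lemma partialZ_pos {S : Finset (Config N)} (hS : S.Nonempty) (J : Couplings N) :
    0 < partialZ M S J := Finset.sum_pos (fun _ _ => Real.exp_pos _) hS

lemma partialCW_pos {S : Finset (Config N)} (hS : S.Nonempty) : 0 < partialCW M S :=
  Finset.sum_pos (fun _ _ => Real.exp_pos _) hS

lemma alpha_nonneg : 0 ≤ alpha M := by
  have := M.p_pos
  have : 0 ≤ 1 - M.p := by linarith [M.p_lt_one]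
  unfold alpha
  positivity

/-- For large `N`, the error terms in the exponential moments are negligible. -/
lemma eventually_moment_errors (M : Params) : ∀ᶠ N : ℕ in atTop, 0 < N ∧
    2 * (M.β / (N * M.p)) ≤ 1 ∧ 4 * (N : ℝ) ^ 2 * (M.β / (N * M.p)) ^ 3 ≤ 1 ∧
    alpha M / N ≤ 1 / 2 := by
  have hβ := M.β_pos
  have hp := M.p_pos
  have hlim := tendsto_natCast_atTop_atTop (R := ℝ)
  filter_upwards [eventually_gt_atTop 0, hlim.eventually_ge_atTop (2 * M.β / M.p),
    hlim.eventually_ge_atTop (4 * M.β ^ 3 / M.p ^ 3), hlim.eventually_ge_atTop (2 * alpha M)]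
    with N h0 h1 h2 h3
  have hN : (0 : ℝ) < N := by exact_mod_cast h0
  refine ⟨h0, ?_, ?_, ?_⟩
  · rw [mul_div_assoc', div_le_one (by positivity)]
    rwa [div_le_iff₀ hp] at h1
  · have e : 4 * (N : ℝ) ^ 2 * (M.β / (N * M.p)) ^ 3 = 4 * M.β ^ 3 / M.p ^ 3 / N := by
      field_simp
    rw [e]
    exact (div_le_one hN).2 h2
  · rw [div_le_iff₀ hN]
    linarith

lemma sq_mul_eq_alpha (hN : 0 < N) :
    (N : ℝ) ^ 2 * (M.p * (1 - M.p) * (M.β / (N * M.p)) ^ 2) = 4 * alpha M := by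
  have hN' : (N : ℝ) ≠ 0 := by exact_mod_cast hN.ne'
  have hp := M.p_pos.ne'
  unfold alpha
  field_simp

lemma abs_mul_pairSign (x : ℝ) (σ : Config N) (e : Pair N) : |x * pairSign σ e| = |x| := by
  rcases pairSign_eq σ e with h | h <;> simp [h]

lemma integral_boltzmann (hN : 0 < N) (σ : Config N) :
    ∫ J, Real.exp (-M.β * hamiltonian M J σ) ∂couplingLaw M N
      = Real.exp (cwExponent M N (up σ) - M.β / 2) *
        ∏ e, centredMgf M.p (M.β / (N * M.p) * pairSign σ e) := by
  simp_rw [neg_mul_hamiltonian_eq hN, Real.exp_add]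
  rw [integral_const_mul, integral_exp_linear]

lemma eventually_first_moment (M : Params) : ∀ᶠ N : ℕ in atTop, ∀ σ : Config N,
    Real.exp (alpha M - M.β / 2 - 1) * Real.exp (cwExponent M N (up σ))
      ≤ ∫ J, Real.exp (-M.β * hamiltonian M J σ) ∂couplingLaw M N ∧
    ∫ J, Real.exp (-M.β * hamiltonian M J σ) ∂couplingLaw M N
      ≤ Real.exp (alpha M + 1) * Real.exp (cwExponent M N (up σ)) := by
  filter_upwards [eventually_moment_errors M] with N ⟨hN, h1, h2, h3⟩ σ
  have hN' : (0 : ℝ) < N := by exact_mod_cast hN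
  have hβ := M.β_pos
  have hp := M.p_pos
  have hα := sq_mul_eq_alpha (M := M) hN
  have hα0 := alpha_nonneg (M := M)
  set x := M.β / (N * M.p) with hx
  have hx0 : 0 < x := by positivity
  have habs : ∀ e, |x * pairSign σ e| = x := fun e => by
    rw [abs_mul_pairSign, abs_of_pos hx0]
  constructor
  · rw [integral_boltzmann hN, ← hx]
    have hprod : Real.exp (Fintype.card (Pair N) * (M.p * (1 - M.p) * x ^ 2 / 2 - x ^ 3))
        ≤ ∏ e, centredMgf M.p (x * pairSign σ e) := by
      calc _ = ∏ _e : Pair N, Real.exp (M.p * (1 - M.p) * x ^ 2 / 2 - x ^ 3) := by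
            rw [Finset.prod_const, Finset.card_univ, ← Real.exp_nat_mul]
        _ ≤ _ := by
            refine Finset.prod_le_prod (fun _ _ => (Real.exp_pos _).le) fun e _ => ?_
            have := le_centredMgf hp M.p_lt_one (y := x * pairSign σ e) (by rw [habs]; linarith)
            rwa [← sq_abs, habs] at this
    have hexp : alpha M - 1 ≤ Fintype.card (Pair N) * (M.p * (1 - M.p) * x ^ 2 / 2 - x ^ 3) := by
      rw [card_pair]
      have e : ((N : ℝ) ^ 2 - N) / 2 * (M.p * (1 - M.p) * x ^ 2 / 2)
          = alpha M - alpha M / N := by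
        have : (N : ℝ) ^ 2 * (M.p * (1 - M.p) * x ^ 2) / (4 * N) = alpha M / N := by
          rw [hα]
          field_simp
        have e2 : (N : ℝ) * (M.p * (1 - M.p) * x ^ 2) / 4 = alpha M / N := by
          rw [← this]
          field_simp
        linarith
      have : 0 < x ^ 3 := by positivity
      have : 0 < N * x ^ 3 := by positivity
      nlinarith
    calc _ = Real.exp (cwExponent M N (up σ) - M.β / 2) * Real.exp (alpha M - 1) := by
          rw [← Real.exp_add, ← Real.exp_add]
          congr 1
          ring
      _ ≤ _ := by
          refine mul_le_mul_of_nonneg_left ?_ (Real.exp_pos _).le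
          exact (Real.exp_le_exp.2 hexp).trans hprod
  · simp_rw [neg_mul_hamiltonian_eq hN, Real.exp_add]
    rw [integral_const_mul, mul_comm]
    have h4 := integral_exp_linear_le (M := M) (y := fun e => x * pairSign σ e) hx0.le (by linarith)
      fun e => (habs e).le
    refine mul_le_mul (h4.trans ?_) (Real.exp_le_exp.2 (by linarith)) (Real.exp_pos _).le
      (by positivity)
    rw [← Real.exp_add]
    refine Real.exp_le_exp.2 ?_
    linarith

lemma eventually_second_moment (M : Params) : ∀ᶠ N : ℕ in atTop, ∀ σ τ : Config N,
    ∫ J, Real.exp (-M.β * hamiltonian M J σ) * Real.exp (-M.β * hamiltonian M J τ)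
        ∂couplingLaw M N
      ≤ Real.exp (4 * alpha M - M.β + 1) *
        (Real.exp (cwExponent M N (up σ)) * Real.exp (cwExponent M N (up τ))) := by
  filter_upwards [eventually_moment_errors M] with N ⟨hN, h1, h2, h3⟩ σ τ
  have hN' : (0 : ℝ) < N := by exact_mod_cast hN
  have hβ := M.β_pos
  have hp := M.p_pos
  have hα := sq_mul_eq_alpha (M := M) hN
  set x := M.β / (N * M.p) with hx
  have hx0 : 0 < x := by positivity
  have h4 := integral_exp_linear_le (M := M)
    (y := fun e => x * pairSign σ e + x * pairSign τ e) (r := 2 * x) (by positivity) h1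
    fun e => (abs_add_le _ _).trans (by
      rw [abs_mul_pairSign, abs_mul_pairSign, abs_of_pos hx0]
      linarith)
  have e1 : ∀ J, Real.exp (-M.β * hamiltonian M J σ) * Real.exp (-M.β * hamiltonian M J τ)
      = Real.exp (cwExponent M N (up σ) + cwExponent M N (up τ) - M.β) *
        Real.exp (∑ e, (x * pairSign σ e + x * pairSign τ e) * (coupling (J e) - M.p)) := by
    intro J
    rw [neg_mul_hamiltonian_eq hN, neg_mul_hamiltonian_eq hN, ← hx, ← Real.exp_add,
      ← Real.exp_add]
    congr 1
    simp_rw [add_mul]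
    rw [Finset.sum_add_distrib]
    ring
  simp_rw [e1]
  rw [integral_const_mul]
  calc _ ≤ Real.exp (cwExponent M N (up σ) + cwExponent M N (up τ) - M.β) *
        Real.exp (4 * alpha M + 1) := by
        refine mul_le_mul_of_nonneg_left (h4.trans (Real.exp_le_exp.2 ?_)) (Real.exp_pos _).le
        have : (N : ℝ) ^ 2 / 2 * (M.p * (1 - M.p) * (2 * x) ^ 2 / 2 + (2 * x) ^ 3)
            = (N : ℝ) ^ 2 * (M.p * (1 - M.p) * x ^ 2) + 4 * (N : ℝ) ^ 2 * x ^ 3 := by ring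
        rw [this, hα]
        linarith
    _ = _ := by
        rw [← Real.exp_add, ← Real.exp_add, ← Real.exp_add]
        congr 1
        ring

lemma eventually_partialZ_moments (M : Params) : ∀ᶠ N : ℕ in atTop, ∀ S : Finset (Config N),
    Real.exp (alpha M - M.β / 2 - 1) * partialCW M S
      ≤ ∫ J, partialZ M S J ∂couplingLaw M N ∧
    ∫ J, partialZ M S J ∂couplingLaw M N ≤ Real.exp (alpha M + 1) * partialCW M S ∧
    ∫ J, partialZ M S J ^ 2 ∂couplingLaw M N
      ≤ Real.exp (4 * alpha M - M.β + 1) * partialCW M S ^ 2 := by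
  filter_upwards [eventually_first_moment M, eventually_second_moment M] with N h1 h2 S
  have e1 : ∫ J, partialZ M S J ∂couplingLaw M N
      = ∑ σ ∈ S, ∫ J, Real.exp (-M.β * hamiltonian M J σ) ∂couplingLaw M N :=
    integral_finsetSum _ fun σ _ => couplings_integrable _
  refine ⟨?_, ?_, ?_⟩
  · rw [e1, partialCW, Finset.mul_sum]
    exact Finset.sum_le_sum fun σ _ => (h1 σ).1
  · rw [e1, partialCW, Finset.mul_sum]
    exact Finset.sum_le_sum fun σ _ => (h1 σ).2
  · have e2 : ∀ J, partialZ M S J ^ 2 = ∑ σ ∈ S, ∑ τ ∈ S,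
        Real.exp (-M.β * hamiltonian M J σ) * Real.exp (-M.β * hamiltonian M J τ) := by
      intro J
      rw [partialZ, sq, Finset.sum_mul_sum]
    simp_rw [e2]
    rw [integral_finsetSum _ fun σ _ => couplings_integrable _, partialCW, sq,
      Finset.sum_mul_sum, Finset.mul_sum]
    refine Finset.sum_le_sum fun σ _ => ?_
    rw [integral_finsetSum _ fun σ _ => couplings_integrable _, Finset.mul_sum]
    exact Finset.sum_le_sum fun τ _ => h2 σ τ

/-- The couplings for which the energies of all configurations are within `ε N / β` of their
Curie-Weiss values. -/
def typicalCouplings (M : Params) (N : ℕ) (ε : ℝ) : Set (Couplings N) :=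
  {J | ∀ σ : Config N, |-M.β * hamiltonian M J σ - cwExponent M N (up σ)| ≤ ε * N}

/-- A Chernoff bound with a fixed parameter of order `1 / ε` beats the union over the `2 ^ N`
configurations. -/
lemma eventually_typicalCouplings (M : Params) {ε ρ : ℝ} (hε : 0 < ε) (hρ : 0 < ρ) :
    ∀ᶠ N : ℕ in atTop, (couplingLaw M N).real (typicalCouplings M N ε)ᶜ ≤ ρ := by
  have hβ := M.β_pos
  have hp := M.p_pos
  have hp1 := M.p_lt_one
  set t := 4 / ε with ht
  have ht0 : 0 < t := by positivity
  set C := t ^ 2 * M.β ^ 2 / M.p ^ 2 with hC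
  have hlim := tendsto_natCast_atTop_atTop (R := ℝ)
  have hexp : Tendsto (fun N : ℕ => 2 * Real.exp C * Real.exp (-(N : ℝ))) atTop (𝓝 0) := by
    have := (Real.tendsto_exp_neg_atTop_nhds_zero.comp hlim).const_mul (2 * Real.exp C)
    simpa using this
  filter_upwards [eventually_gt_atTop 0, hlim.eventually_ge_atTop (t * M.β / M.p),
    hlim.eventually_ge_atTop (M.β / ε), hexp.eventually_le_const hρ] with N hN h1 h2 h3
  have hN' : (0 : ℝ) < N := by exact_mod_cast hN
  set x := M.β / (N * M.p) with hx
  have hx0 : 0 < x := by positivity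
  have htx : t * x ≤ 1 := by
    rw [hx, mul_div_assoc', div_le_one (by positivity)]
    rwa [div_le_iff₀ hp] at h1
  have htail : ∀ (σ : Config N) (b : ℝ), |b| = 1 → (couplingLaw M N).real
      {J | ε * N / 2 ≤ ∑ e, b * (x * pairSign σ e) * (coupling (J e) - M.p)}
      ≤ Real.exp (-(2 * N) + C) := by
    intro σ b hb
    refine (measure_ge_le_exp_mul_mgf (ε * N / 2) ht0.le (couplings_integrable _)).trans ?_
    rw [Real.exp_add]
    have e1 : -t * (ε * N / 2) = -(2 * N) := by
      rw [ht]
      field_simp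
      norm_num
    rw [e1, mgf]
    refine mul_le_mul_of_nonneg_left ?_ (Real.exp_pos _).le
    have e2 : ∀ J : Couplings N, t * ∑ e, b * (x * pairSign σ e) * (coupling (J e) - M.p)
        = ∑ e, t * (b * (x * pairSign σ e)) * (coupling (J e) - M.p) := by
      intro J
      rw [Finset.mul_sum]
      exact Finset.sum_congr rfl fun e _ => by ring
    simp_rw [e2]
    refine (integral_exp_linear_le (r := t * x) (by positivity) htx fun e => ?_).trans ?_
    · rw [abs_mul, abs_mul, hb, abs_mul_pairSign, abs_of_pos ht0, abs_of_pos hx0, one_mul]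
    · refine Real.exp_le_exp.2 ?_
      have e3 : (N : ℝ) ^ 2 * (t * x) ^ 2 = C := by
        rw [hx, hC]
        field_simp
      have h4 : (t * x) ^ 3 ≤ (t * x) ^ 2 := pow_le_pow_of_le_one (by positivity) htx (by norm_num)
      have h5 : M.p * (1 - M.p) ≤ 1 := by nlinarith
      have h6 : M.p * (1 - M.p) * (t * x) ^ 2 / 2 ≤ (t * x) ^ 2 := by
        nlinarith [sq_nonneg (t * x)]
      calc _ ≤ (N : ℝ) ^ 2 / 2 * ((t * x) ^ 2 + (t * x) ^ 2) := by gcongr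
        _ = C := by
          rw [← e3]
          ring
  have hsub : (typicalCouplings M N ε)ᶜ ⊆ ⋃ σ ∈ (Finset.univ : Finset (Config N)),
      ({J | ε * N / 2 ≤ ∑ e, 1 * (x * pairSign σ e) * (coupling (J e) - M.p)} ∪
        {J | ε * N / 2 ≤ ∑ e, (-1) * (x * pairSign σ e) * (coupling (J e) - M.p)}) := by
    intro J hJ
    simp only [typicalCouplings, Set.mem_compl_iff, Set.mem_ofPred_eq, not_forall, not_le] at hJ
    obtain ⟨σ, hσ⟩ := hJ
    simp only [Set.mem_iUnion, Set.mem_union, Set.mem_ofPred_eq, Finset.mem_univ, exists_prop,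
      true_and]
    refine ⟨σ, ?_⟩
    rw [neg_mul_hamiltonian_eq hN, ← hx] at hσ
    simp only [one_mul, neg_mul, Finset.sum_neg_distrib]
    rw [div_le_iff₀ hε] at h2
    rcases lt_abs.1 hσ with h | h
    · left
      nlinarith
    · right
      nlinarith
  calc (couplingLaw M N).real (typicalCouplings M N ε)ᶜ
      ≤ _ := measureReal_mono hsub (measure_ne_top _ _)
    _ ≤ ∑ σ : Config N, _ := measureReal_biUnion_finset_le _ _
    _ ≤ ∑ _σ : Config N, 2 * Real.exp (-(2 * N) + C) := by
        refine Finset.sum_le_sum fun σ _ => (measureReal_union_le _ _).trans ?_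
        have := htail σ 1 (by simp)
        have := htail σ (-1) (by simp)
        linarith
    _ = 2 ^ N * (2 * Real.exp (-(2 * N) + C)) := by
        simp [Finset.sum_const, nsmul_eq_mul]
    _ ≤ Real.exp N * (2 * Real.exp (-(2 * N) + C)) := by
        have h7 : (2 : ℝ) ^ N ≤ Real.exp N := by
          calc (2 : ℝ) ^ N ≤ Real.exp 1 ^ N := by
                gcongr
                linarith [Real.add_one_le_exp 1]
            _ = Real.exp N := by rw [← Real.exp_nat_mul, mul_one]
        gcongr
    _ = 2 * Real.exp C * Real.exp (-(N : ℝ)) := by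
        have : Real.exp (-(2 * N) + C) = Real.exp (-(N : ℝ)) * Real.exp (-(N : ℝ)) * Real.exp C := by
          rw [← Real.exp_add, ← Real.exp_add]
          congr 1
          ring
        rw [this]
        have h8 : Real.exp (N : ℝ) * Real.exp (-(N : ℝ)) = 1 := by rw [← Real.exp_add]; simp
        calc _ = 2 * Real.exp C * Real.exp (-(N : ℝ)) * (Real.exp (N : ℝ) * Real.exp (-(N : ℝ))) := by
              ring
          _ = _ := by rw [h8, mul_one]
    _ ≤ ρ := h3

end Moments

/-! ### Concentration of restricted partition functions -/

section Concentration

variable {M : Params} {N : ℕ}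

lemma integrable_count_of_finite {α : Type*} [MeasurableSpace α] [MeasurableSingletonClass α]
    [Finite α] (f : α → ℝ) : Integrable f Measure.count := Integrable.of_finite

/-- The logarithm of a restricted partition function is a convex function of the couplings with
Lipschitz constant `β / (p √2)`. -/
lemma measure_abs_log_partialZ_le {c₁ c₂ : ℝ} (hT : IsTalagrandPair c₁ c₂) (hN : 0 < N)
    {S : Finset (Config N)} (hS : S.Nonempty) {t : ℝ} (ht : 0 ≤ t) :
    (couplingLaw M N).real {J | t * (M.β / (M.p * √2)) ≤ |Real.log (partialZ M S J) -
        ∫ J', Real.log (partialZ M S J') ∂couplingLaw M N|} ≤ c₁ * Real.exp (-c₂ * t ^ 2) := by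
  classical
  have hβ := M.β_pos
  have hp := M.p_pos
  have hN' : (0 : ℝ) < N := by exact_mod_cast hN
  set x := M.β / (N * M.p) with hx
  have hx0 : 0 < x := by positivity
  set L := M.β / (M.p * √2) with hL
  have hL0 : 0 < L := by positivity
  set n := Fintype.card (Pair N) with hn
  let idx : Fin n ≃ Pair N := (Fintype.equivFin (Pair N)).symm
  set ℓ : EuclideanSpace ℝ (Fin n) → S → ℝ := fun y σ =>
    x * ∑ i, y i * pairSign σ.1 (idx i) + M.β * (M.h * ∑ i, spin (σ.1 i)) with hℓ
  have hSne : Nonempty S := hS.to_subtype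
  have hnz : NeZero (Measure.count : Measure S) := ⟨by
    intro h0
    obtain ⟨σ⟩ := hSne
    have h1 : (Measure.count : Measure S) {σ} = 1 := Measure.count_singleton σ
    rw [h0] at h1
    simp at h1⟩
  set G : EuclideanSpace ℝ (Fin n) → ℝ := fun y =>
    L⁻¹ * Real.log (∫ σ, Real.exp (ℓ y σ) ∂(Measure.count : Measure S)) with hG
  have hlip : ∀ y z σ, ℓ y σ ≤ ℓ z σ + L * dist y z := by
    intro y z σ
    have h1 : ∑ i, y i * pairSign σ.1 (idx i) - ∑ i, z i * pairSign σ.1 (idx i)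
        ≤ N / √2 * dist y z := by
      rw [← Finset.sum_sub_distrib]
      calc ∑ i, (y i * pairSign σ.1 (idx i) - z i * pairSign σ.1 (idx i))
          ≤ ∑ i, |y i - z i| := by
            refine Finset.sum_le_sum fun i _ => ?_
            rw [← sub_mul]
            refine (le_abs_self _).trans (le_of_eq ?_)
            rw [abs_mul_pairSign]
        _ ≤ √(n * ∑ i, (y i - z i) ^ 2) := by
            refine Real.le_sqrt_of_sq_le ?_
            have h2 := sq_sum_le_card_mul_sum_sq (s := (Finset.univ : Finset (Fin n)))
              (f := fun i => |y i - z i|)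
            simpa using h2
        _ ≤ √((N ^ 2 / 2) * ∑ i, (y i - z i) ^ 2) := by
            refine Real.sqrt_le_sqrt (mul_le_mul_of_nonneg_right ?_
              (Finset.sum_nonneg fun i _ => sq_nonneg _))
            rw [hn, card_pair]
            linarith
        _ = N / √2 * dist y z := by
            rw [Real.sqrt_mul (by positivity), Real.sqrt_div (by positivity),
              Real.sqrt_sq hN'.le, EuclideanSpace.dist_eq]
            congr 2
            exact Finset.sum_congr rfl fun i _ => by rw [Real.dist_eq, sq_abs]
    have h2 : x * (N / √2 * dist y z) = L * dist y z := by
      rw [hx, hL]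
      field_simp
    have h3 := mul_le_mul_of_nonneg_left h1 hx0.le
    simp only [hℓ]
    linarith
  have hGlip : LipschitzWith 1 G := by
    have hone : ∀ y z, G y - G z ≤ dist y z := by
      intro y z
      have h1 := log_integral_exp_le_add (ν := (Measure.count : Measure S))
        (integrable_count_of_finite _) (integrable_count_of_finite _) (hlip y z)
      simp only [hG]
      rw [← mul_sub, inv_mul_le_iff₀ hL0]
      linarith
    refine LipschitzWith.of_dist_le_mul fun y z => ?_
    rw [NNReal.coe_one, one_mul, Real.dist_eq, abs_le]
    have h1 := hone y z
    have h2 := hone z y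
    rw [dist_comm z y] at h2
    constructor <;> linarith
  have hGconv : ConvexOn ℝ Set.univ G := by
    have h1 := convexOn_log_integral_exp (ν := (Measure.count : Measure S)) (q := ℓ)
      (fun y => integrable_count_of_finite _) fun σ => ?_
    · exact h1.smul (inv_pos.2 hL0).le
    · refine ⟨convex_univ, fun y _ z _ a b _ _ hab => le_of_eq ?_⟩
      have hb : b = 1 - a := by linarith
      simp only [hℓ, PiLp.add_apply, PiLp.smul_apply, smul_eq_mul]
      have e : ∑ i, (a * y i + b * z i) * pairSign σ.1 (idx i)
          = a * ∑ i, y i * pairSign σ.1 (idx i) + b * ∑ i, z i * pairSign σ.1 (idx i) := by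
        rw [Finset.mul_sum, Finset.mul_sum, ← Finset.sum_add_distrib]
        exact Finset.sum_congr rfl fun i _ => by ring
      rw [e, hb]
      ring
  have hGX : ∀ J : Couplings N, G (WithLp.toLp 2 fun i => coupling (J (idx i)))
      = L⁻¹ * Real.log (partialZ M S J) := by
    intro J
    simp only [hG]
    congr 2
    rw [integral_count, partialZ, ← Finset.sum_coe_sort S]
    refine Finset.sum_congr rfl fun σ _ => ?_
    congr 1
    simp only [hℓ]
    rw [Equiv.sum_comp idx (fun e => coupling (J e) * pairSign σ.1 e), hamiltonian, hx]
    unfold pairSign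
    simp_rw [← mul_assoc]
    ring
  have hind : iIndepFun (fun (i : Fin n) (J : Couplings N) => coupling (J (idx i)))
      (couplingLaw M N) := by
    have h1 : iIndepFun (fun (e : Pair N) (J : Couplings N) => coupling (J e))
        (couplingLaw M N) :=
      iIndepFun_pi fun e => (measurable_of_finite coupling).aemeasurable
    exact h1.precomp idx.injective
  have key := hT.2.2 n (Couplings N) inferInstance (couplingLaw M N) inferInstance
    (fun i J => coupling (J (idx i))) 1 G t (fun i => measurable_of_finite _) hind one_pos
    (fun i J => by cases J (idx i) <;> simp [coupling]) hGlip hGconv ht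
  refine le_trans (measureReal_mono ?_) key
  intro J hJ
  simp only [Set.mem_ofPred_eq, hGX, mul_one, integral_const_mul] at hJ ⊢
  rw [← mul_sub, abs_mul, abs_of_pos (inv_pos.2 hL0), le_inv_mul_iff₀ hL0, mul_comm]
  exact hJ

lemma one_le_of_isTalagrandPair {c₁ c₂ : ℝ} (hT : IsTalagrandPair c₁ c₂) : 1 ≤ c₁ := by
  have h := hT.2.2 0 Unit inferInstance (Measure.dirac ()) inferInstance (fun _ _ => 0) 1
    (fun _ => 0) 0 (fun i => measurable_const) iIndepFun.of_subsingleton one_pos (by simp)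
    (LipschitzWith.const' 0 |>.weaken zero_le_one) (convexOn_const 0 convex_univ) le_rfl
  simpa using h

/-- The Paley-Zygmund inequality. -/
lemma paley_zygmund {Ω : Type*} [MeasurableSpace Ω] {P : Measure Ω} [IsProbabilityMeasure P]
    {X : Ω → ℝ} (hX0 : ∀ ω, 0 ≤ X ω) (hXm : Measurable X) (hX : Integrable X P)
    (hX2 : Integrable (fun ω => X ω ^ 2) P) {η : ℝ} (hη0 : 0 ≤ η) (hη1 : η ≤ 1) :
    ((1 - η) * ∫ ω, X ω ∂P) ^ 2
      ≤ (∫ ω, X ω ^ 2 ∂P) * P.real {ω | η * ∫ ω', X ω' ∂P ≤ X ω} := by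
  set m := ∫ ω, X ω ∂P with hm
  set A := {ω | η * m ≤ X ω} with hA
  have hAm : MeasurableSet A := measurableSet_le measurable_const hXm
  have hm0 : 0 ≤ m := integral_nonneg hX0
  set Q := P.real A with hQ
  set V := ∫ ω, X ω ^ 2 ∂P with hV
  have hV0 : 0 ≤ V := integral_nonneg fun _ => sq_nonneg _
  have hQ0 : 0 ≤ Q := measureReal_nonneg
  have hAX : Integrable (A.indicator X) P := hX.indicator hAm
  have hA1 : Integrable (A.indicator fun _ => (1 : ℝ)) P := (integrable_const _).indicator hAm
  have h1 : (1 - η) * m ≤ ∫ ω, A.indicator X ω ∂P := by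
    have h2 : m ≤ ∫ ω, (η * m + A.indicator X ω) ∂P := by
      refine integral_mono hX ((integrable_const _).add hAX) fun ω => ?_
      by_cases hω : ω ∈ A
      · simp only [Set.indicator_of_mem hω]
        linarith [mul_nonneg hη0 hm0]
      · simp only [Set.indicator_of_notMem hω, add_zero]
        exact (not_le.1 hω).le
    rw [integral_add (integrable_const _) hAX] at h2
    simp only [integral_const, probReal_univ, one_smul] at h2
    linarith
  have h3 : ∀ s : ℝ, 0 ≤ s → 2 * s * ((1 - η) * m) ≤ s ^ 2 * V + Q := by
    intro s hs
    have h4 : ∫ ω, 2 * s * A.indicator X ω ∂P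
        ≤ ∫ ω, (s ^ 2 * X ω ^ 2 + A.indicator (fun _ => (1 : ℝ)) ω) ∂P := by
      refine integral_mono (hAX.const_mul _) ((hX2.const_mul _).add hA1) fun ω => ?_
      by_cases hω : ω ∈ A
      · simp only [Set.indicator_of_mem hω]
        nlinarith [sq_nonneg (s * X ω - 1)]
      · simp only [Set.indicator_of_notMem hω, mul_zero, add_zero]
        positivity
    rw [integral_add (hX2.const_mul _) hA1, integral_const_mul, integral_const_mul,
      integral_indicator hAm] at h4
    have h5 : ∫ ω in A, (1 : ℝ) ∂P = Q := by simp [hQ]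
    have h6 := mul_le_mul_of_nonneg_left h1 (by positivity : 0 ≤ 2 * s)
    have h7 : ∫ ω, A.indicator (fun _ => (1 : ℝ)) ω ∂P = Q := by
      rw [integral_indicator hAm, h5]
    rw [integral_indicator hAm] at h6
    simp only [h7] at h4
    linarith
  set a := (1 - η) * m with ha
  have ha0 : 0 ≤ a := mul_nonneg (by linarith) hm0
  rcases hV0.eq_or_lt with h0 | h0
  · have : a ≤ 0 := by
      by_contra hc
      have hc' : 0 < a := not_le.1 hc
      have h8 := h3 ((Q + 1) / a) (by positivity)
      rw [← h0, mul_zero, zero_add, mul_assoc, div_mul_cancel₀ _ hc'.ne'] at h8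
      linarith
    rw [le_antisymm this ha0, ← h0]
    simp
  · have h8 := h3 (a / V) (by positivity)
    have h9 : 2 * (a / V) * a = 2 * (a ^ 2 / V) := by ring
    have h10 : (a / V) ^ 2 * V = a ^ 2 / V := by field_simp
    rw [h9, h10] at h8
    have h11 : a ^ 2 / V ≤ Q := by linarith
    rw [div_le_iff₀ h0] at h11
    linarith

/-- The tail bound for `log (partialZ M S)`, in terms of the deviation itself. -/
lemma measure_le_abs_log_partialZ_le {c₁ c₂ : ℝ} (hT : IsTalagrandPair c₁ c₂) (hN : 0 < N)
    {S : Finset (Config N)} (hS : S.Nonempty) {r : ℝ} (hr : 0 ≤ r) :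
    (couplingLaw M N).real {J | r ≤ |Real.log (partialZ M S J) -
        ∫ J', Real.log (partialZ M S J') ∂couplingLaw M N|}
      ≤ c₁ * Real.exp (-(2 * c₂ * M.p ^ 2 / M.β ^ 2) * r ^ 2) := by
  have hβ := M.β_pos
  have hp := M.p_pos
  have h2 : √2 ^ 2 = (2 : ℝ) := Real.sq_sqrt (by norm_num)
  have h := measure_abs_log_partialZ_le (M := M) hT hN hS
    (t := r * (M.p * √2) / M.β) (by positivity)
  have e1 : r * (M.p * √2) / M.β * (M.β / (M.p * √2)) = r := by field_simp
  have e2 : -c₂ * (r * (M.p * √2) / M.β) ^ 2 = -(2 * c₂ * M.p ^ 2 / M.β ^ 2) * r ^ 2 := by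
    rw [div_pow, mul_pow, mul_pow, h2]
    ring
  rwa [e1, e2] at h

lemma integral_log_partialZ_le {S : Finset (Config N)} (hS : S.Nonempty) :
    ∫ J, Real.log (partialZ M S J) ∂couplingLaw M N
      ≤ Real.log (∫ J, partialZ M S J ∂couplingLaw M N) := by
  have h := convexOn_exp.map_integral_le (μ := couplingLaw M N)
    (f := fun J => Real.log (partialZ M S J)) Real.continuous_exp.continuousOn isClosed_univ
    (by simp) (couplings_integrable _) (couplings_integrable _)
  simp only [Real.exp_log (partialZ_pos hS _)] at h
  rw [← Real.log_exp (∫ J, Real.log (partialZ M S J) ∂couplingLaw M N)]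
  exact Real.log_le_log (Real.exp_pos _) h

/-- The Paley-Zygmund inequality provides couplings for which the restricted partition function is
at least `η` times its mean, with a probability that exceeds that of a large deviation of its
logarithm; so the mean of the logarithm is not much smaller than the logarithm of the mean. -/
lemma eventually_le_integral_log_partialZ (M : Params) {c₁ c₂ : ℝ} (hT : IsTalagrandPair c₁ c₂) :
    ∀ᶠ N : ℕ in atTop, ∀ S : Finset (Config N), S.Nonempty →
      kappa M c₁ c₂ - (M.β / 2 + 1 + 2 * (M.β / (M.p * √(2 * c₂)))) + Real.log (partialCW M S)
        ≤ ∫ J, Real.log (partialZ M S J) ∂couplingLaw M N := by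
  filter_upwards [eventually_partialZ_moments M, eventually_gt_atTop 0] with N hmom hN S hS
  obtain ⟨hm1, -, hm2⟩ := hmom S
  have hβ := M.β_pos
  have hp := M.p_pos
  have hα := alpha_nonneg (M := M)
  have hc1 := one_le_of_isTalagrandPair hT
  have hc2 := hT.2.1
  have hCW := partialCW_pos (M := M) hS
  set b := ∫ J, Real.log (partialZ M S J) ∂couplingLaw M N with hb
  set m := ∫ J, partialZ M S J ∂couplingLaw M N with hm
  set C := partialCW M S with hC
  have hmpos : 0 < m := lt_of_lt_of_le (by positivity) hm1
  have key : ∀ η ∈ Set.Ioo (0 : ℝ) 1,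
      Real.log η - M.β * √(2 * alpha M + Real.log (c₁ / (1 - η) ^ 2)) / (M.p * √(2 * c₂))
        ≤ b - Real.log C - alpha M + (M.β / 2 + 1 + 2 * (M.β / (M.p * √(2 * c₂)))) := by
    rintro η ⟨hη0, hη1⟩
    have hη : 0 < 1 - η := by linarith
    set A := Real.log (c₁ / (1 - η) ^ 2) with hA
    have hA0 : 0 ≤ A := Real.log_nonneg ((one_le_div (by positivity)).2
      ((pow_le_one₀ hη.le (by linarith)).trans hc1))
    -- The deviation `r` has probability at most `(1 - η)² exp (-(2 α + 4))`, just below the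
    -- Paley-Zygmund bound `(1 - η)² exp (-(2 α + 3))`.
    set r := M.β / (M.p * √2) * √((2 * alpha M + A + 4) / c₂) with hr
    have hr0 : 0 ≤ r := by positivity
    have hr2 : -(2 * c₂ * M.p ^ 2 / M.β ^ 2) * r ^ 2 = -(2 * alpha M + A + 4) := by
      rw [hr, mul_pow, Real.sq_sqrt (by positivity), div_pow, mul_pow,
        Real.sq_sqrt (by norm_num)]
      field_simp
    have htail := measure_le_abs_log_partialZ_le (M := M) hT hN hS hr0
    have e1 : c₁ * Real.exp (-(2 * alpha M + A + 4))
        = (1 - η) ^ 2 * Real.exp (-(2 * alpha M + 4)) := by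
      have : Real.exp (-A) = (1 - η) ^ 2 / c₁ := by
        rw [hA, Real.exp_neg, Real.exp_log (by positivity), inv_div]
      rw [show -(2 * alpha M + A + 4) = -A + -(2 * alpha M + 4) by ring, Real.exp_add, this]
      field_simp
    rw [hr2, e1, ← hb] at htail
    have hpz := paley_zygmund (P := couplingLaw M N) (X := partialZ M S)
      (fun J => (partialZ_pos hS J).le) (measurable_of_finite _) (couplings_integrable _)
      (couplings_integrable _) hη0.le hη1.le
    rw [← hm] at hpz
    set Q := (couplingLaw M N).real {J | η * m ≤ partialZ M S J} with hQ
    have hQ0 : 0 ≤ Q := measureReal_nonneg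
    have hQlow : (1 - η) ^ 2 * Real.exp (-(2 * alpha M + 3)) ≤ Q := by
      have h1 : (1 - η) ^ 2 * (Real.exp (alpha M - M.β / 2 - 1) * C) ^ 2
          ≤ Real.exp (4 * alpha M - M.β + 1) * C ^ 2 * Q := by
        rw [← mul_pow]
        refine le_trans ?_ (hpz.trans (mul_le_mul_of_nonneg_right hm2 hQ0))
        gcongr
      have e2 : (Real.exp (alpha M - M.β / 2 - 1) * C) ^ 2
          = Real.exp (4 * alpha M - M.β + 1) * C ^ 2 * Real.exp (-(2 * alpha M + 3)) := by
        rw [mul_pow, mul_right_comm, ← Real.exp_add, ← Real.exp_nat_mul]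
        congr 2
        push_cast
        ring
      rw [e2, mul_left_comm] at h1
      exact le_of_mul_le_mul_left h1 (by positivity)
    have hlt : Real.exp (-(2 * alpha M + 4)) < Real.exp (-(2 * alpha M + 3)) :=
      Real.exp_lt_exp.2 (by linarith)
    obtain ⟨J, hJ1, hJ2⟩ : ∃ J, η * m ≤ partialZ M S J ∧
        |Real.log (partialZ M S J) - b| < r := by
      by_contra! hno
      have hsub : Q ≤ (couplingLaw M N).real {J | r ≤ |Real.log (partialZ M S J) - b|} :=
        measureReal_mono (fun J hJ => hno J hJ) (measure_ne_top _ _)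
      have : (1 - η) ^ 2 * Real.exp (-(2 * alpha M + 4))
          < (1 - η) ^ 2 * Real.exp (-(2 * alpha M + 3)) := by gcongr
      linarith
    have h3 : Real.log η + (alpha M - M.β / 2 - 1 + Real.log C) ≤ Real.log (partialZ M S J) := by
      have h4 : η * (Real.exp (alpha M - M.β / 2 - 1) * C) ≤ partialZ M S J :=
        le_trans (by gcongr) hJ1
      have h5 := Real.log_le_log (by positivity) h4
      rwa [Real.log_mul hη0.ne' (by positivity), Real.log_mul (Real.exp_pos _).ne' hCW.ne',
        Real.log_exp] at h5
    have h6 : r ≤ M.β * √(2 * alpha M + A) / (M.p * √(2 * c₂)) + 2 * (M.β / (M.p * √(2 * c₂))) := by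
      have h7 : √(2 * alpha M + A + 4) ≤ √(2 * alpha M + A) + 2 := by
        refine Real.sqrt_le_iff.2 ⟨by positivity, ?_⟩
        have := Real.sq_sqrt (show 0 ≤ 2 * alpha M + A by positivity)
        nlinarith [Real.sqrt_nonneg (2 * alpha M + A)]
      have e3 : r = M.β / (M.p * √(2 * c₂)) * √(2 * alpha M + A + 4) := by
        rw [hr, Real.sqrt_div (by positivity), Real.sqrt_mul (by norm_num)]
        field_simp
      rw [e3]
      calc _ ≤ M.β / (M.p * √(2 * c₂)) * (√(2 * alpha M + A) + 2) := by gcongr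
        _ = _ := by ring
    have h8 := (abs_lt.1 hJ2).2
    linarith
  have hsup : kappa M c₁ c₂ - alpha M
      ≤ b - Real.log C - alpha M + (M.β / 2 + 1 + 2 * (M.β / (M.p * √(2 * c₂)))) := by
    rw [kappa, add_sub_cancel_left]
    refine csSup_le ((Set.nonempty_Ioo.2 one_pos).image _) ?_
    rintro _ ⟨η, hη, rfl⟩
    exact key η hη
  linarith

lemma eventually_measure_partialZ_gt_le (M : Params) {c₁ c₂ : ℝ} (hT : IsTalagrandPair c₁ c₂) :
    ∀ᶠ N : ℕ in atTop, ∀ S : Finset (Config N), S.Nonempty → ∀ r : ℝ, 0 ≤ r →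
      (couplingLaw M N).real {J | Real.exp (alpha M + 1 + r) * partialCW M S < partialZ M S J}
        ≤ c₁ * Real.exp (-(2 * c₂ * M.p ^ 2 / M.β ^ 2) * r ^ 2) := by
  filter_upwards [eventually_partialZ_moments M, eventually_gt_atTop 0] with N hmom hN S hS r hr
  refine (measureReal_mono (fun J hJ => ?_) (measure_ne_top _ _)).trans
    (measure_le_abs_log_partialZ_le hT hN hS hr)
  have hCW := partialCW_pos (M := M) hS
  have hm := (hmom S).1
  have hmpos : 0 < ∫ J, partialZ M S J ∂couplingLaw M N := lt_of_lt_of_le (by positivity) hm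
  have h1 := (integral_log_partialZ_le (M := M) hS).trans (Real.log_le_log hmpos (hmom S).2.1)
  rw [Real.log_mul (Real.exp_pos _).ne' hCW.ne', Real.log_exp] at h1
  rw [Set.mem_ofPred_eq] at hJ ⊢
  have h2 := Real.log_le_log (by positivity) hJ.le
  rw [Real.log_mul (Real.exp_pos _).ne' hCW.ne', Real.log_exp] at h2
  exact le_abs.2 (Or.inl (by linarith))

lemma eventually_measure_partialZ_lt_le (M : Params) {c₁ c₂ : ℝ} (hT : IsTalagrandPair c₁ c₂) :
    ∀ᶠ N : ℕ in atTop, ∀ S : Finset (Config N), S.Nonempty → ∀ r : ℝ, 0 ≤ r →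
      (couplingLaw M N).real {J | partialZ M S J < Real.exp (kappa M c₁ c₂ -
          (M.β / 2 + 1 + 2 * (M.β / (M.p * √(2 * c₂)))) - r) * partialCW M S}
        ≤ c₁ * Real.exp (-(2 * c₂ * M.p ^ 2 / M.β ^ 2) * r ^ 2) := by
  filter_upwards [eventually_le_integral_log_partialZ M hT, eventually_gt_atTop 0]
    with N hlow hN S hS r hr
  refine (measureReal_mono (fun J hJ => ?_) (measure_ne_top _ _)).trans
    (measure_le_abs_log_partialZ_le hT hN hS hr)
  have hCW := partialCW_pos (M := M) hS
  have h1 := hlow S hS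
  rw [Set.mem_ofPred_eq] at hJ ⊢
  have h2 := Real.log_le_log (partialZ_pos hS J) hJ.le
  rw [Real.log_mul (Real.exp_pos _).ne' hCW.ne', Real.log_exp] at h2
  exact le_abs.2 (Or.inr (by linarith))

end Concentration

/-! ### The hitting probability of a magnetisation level -/

section Hitting

variable {M : Params} {N : ℕ} {J : Couplings N}

/-- The conductance of the edge between `σ` and `flip σ i` in the electric network of the Metropolis
chain, normalised to be `N Z_{β,N}` times the stationary flow through the edge. -/
noncomputable def conductance (M : Params) (J : Couplings N) (σ : Config N) (i : Fin N) : ℝ :=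
  Real.exp (-M.β * max (hamiltonian M J σ) (hamiltonian M J (flip σ i)))

lemma conductance_pos (σ : Config N) (i : Fin N) : 0 < conductance M J σ i := Real.exp_pos _

lemma conductance_flip (σ : Config N) (i : Fin N) :
    conductance M J (flip σ i) i = conductance M J σ i := by
  unfold conductance
  rw [flip_flip, max_comm]

lemma conductance_le (σ : Config N) (i : Fin N) :
    conductance M J σ i ≤ Real.exp (-M.β * hamiltonian M J σ) :=
  Real.exp_le_exp.2 (mul_le_mul_of_nonpos_left (le_max_left _ _) (neg_nonpos.2 M.β_pos.le))

lemma le_conductance {x : ℝ} {σ : Config N} {i : Fin N} (h1 : x ≤ -M.β * hamiltonian M J σ)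
    (h2 : x ≤ -M.β * hamiltonian M J (flip σ i)) : Real.exp x ≤ conductance M J σ i := by
  refine Real.exp_le_exp.2 ?_
  rcases max_choice (hamiltonian M J σ) (hamiltonian M J (flip σ i)) with h | h <;> rwa [h]

lemma exp_mul_jumpProb_flip (hN : 0 < N) (σ : Config N) (i : Fin N) :
    N * Real.exp (-M.β * hamiltonian M J σ) * jumpProb M J σ (flip σ i) = conductance M J σ i := by
  have hN' : (N : ℝ) ≠ 0 := by exact_mod_cast hN.ne'
  rw [jumpProb, if_pos ⟨i, rfl⟩, conductance]
  have : max (hamiltonian M J σ) (hamiltonian M J (flip σ i))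
      = hamiltonian M J σ + max (hamiltonian M J (flip σ i) - hamiltonian M J σ) 0 := by
    rw [max_comm, ← max_add_add_left]
    simp
  rw [this, mul_add, Real.exp_add]
  field_simp

lemma sum_jumpProb_mul (σ : Config N) (F : Config N → ℝ) :
    ∑ η, jumpProb M J σ η * F η = ∑ i, jumpProb M J σ (flip σ i) * F (flip σ i) := by
  classical
  rw [← Finset.sum_image (s := Finset.univ) (g := flip σ)
    (f := fun η => jumpProb M J σ η * F η) fun i _ j _ h => flip_injective σ h]
  refine (Finset.sum_subset (Finset.subset_univ _) fun η _ hη => ?_).symm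
  rw [jumpProb, if_neg, zero_mul]
  rintro ⟨i, rfl⟩
  exact hη (Finset.mem_image_of_mem _ (Finset.mem_univ i))

lemma laplacian_harmonic (hN : 0 < N) {A B : Set (Config N)} (hAB : Disjoint A B) {σ : Config N}
    (hA : σ ∉ A) (hB : σ ∉ B) : laplacian (conductance M J) (harmonic M J A B) σ = 0 := by
  set u := harmonic M J A B with hu
  have h1 : ∑ η, transProb M J σ η * (u σ - u η) = 0 := by
    simp_rw [mul_sub]
    rw [Finset.sum_sub_distrib, ← Finset.sum_mul, sum_transProb, one_mul, hu,
      ← harmonic_eq_sum hAB hA hB, sub_self]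
  have h2 : ∑ η, jumpProb M J σ η * (u σ - u η) = 0 := by
    rw [← h1]
    refine Finset.sum_congr rfl fun η _ => ?_
    by_cases h : η = σ
    · rw [h, sub_self, mul_zero, mul_zero]
    · rw [transProb, if_neg h]
  rw [sum_jumpProb_mul] at h2
  rw [laplacian]
  simp_rw [← exp_mul_jumpProb_flip hN, mul_assoc]
  rw [← Finset.mul_sum, ← Finset.mul_sum, h2, mul_zero, mul_zero]

lemma magnetisation_eq (hN : 0 < N) (σ : Config N) : magnetisation σ = mag N (up σ) := by
  have hN' : (N : ℝ) ≠ 0 := by exact_mod_cast hN.ne'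
  rw [magnetisation, sum_spin hN]
  field_simp

lemma mag_injective (hN : 0 < N) : Function.Injective (mag N) := by
  intro k l h
  have hN' : (N : ℝ) ≠ 0 := by exact_mod_cast hN.ne'
  unfold mag at h
  field_simp at h
  have : (k : ℝ) = l := by linarith
  exact_mod_cast this

lemma mem_level_mag (hN : 0 < N) {k : ℕ} {σ : Config N} : σ ∈ level N (mag N k) ↔ up σ = k := by
  rw [level, Set.mem_ofPred_eq, magnetisation_eq hN, (mag_injective hN).eq_iff]

lemma disjoint_level_mag (hN : 0 < N) {k l : ℕ} (hkl : k < l) :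
    Disjoint (level N (mag N k)) (level N (mag N l)) := by
  refine Set.disjoint_left.2 fun σ h1 h2 => ?_
  rw [mem_level_mag hN] at h1 h2
  omega

lemma up_flip_le (σ : Config N) (i : Fin N) : up (flip σ i) ≤ up σ + 1 := by
  cases h : σ i
  · exact (up_flip_of_false h).le
  · have := up_flip_of_true h
    omega

lemma le_up_flip (σ : Config N) (i : Fin N) : up σ ≤ up (flip σ i) + 1 := by
  have := up_flip_le (flip σ i) i
  rwa [flip_flip] at this

/-- Starting with at most `ka` up-spins, the chain hits level `ka` before level `kb > ka`: the
magnetisation changes by a single step at a time. -/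
lemma harmonic_eq_one (hN : 0 < N) {ka kb : ℕ} (hkk : ka < kb) (hka : ka ≤ N) {σ : Config N}
    (hσ : up σ ≤ ka) : harmonic M J (level N (mag N ka)) (level N (mag N kb)) σ = 1 := by
  have hAB := disjoint_level_mag hN hkk
  set u := harmonic M J (level N (mag N ka)) (level N (mag N kb)) with hu
  have h1 : ∀ τ : Config N, up τ = ka → u τ = 1 := fun τ hτ => by
    rw [hu, harmonic, if_pos ((mem_level_mag hN).2 hτ)]
  rcases hσ.lt_or_eq with h | h
  swap
  · exact h1 σ h
  have h2 := eq_zero_of_laplacian (c := conductance M J)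
    (v := fun τ => if up τ < ka then 1 - u τ else 0) conductance_pos conductance_flip
    (τ := fun _ => true) (fun τ => ?_) (by
      refine if_neg (not_lt.2 ?_)
      simpa [up] using hka) σ
  · rw [if_pos h] at h2
    linarith
  · by_cases hτ : up τ < ka
    · right
      have h3 := laplacian_harmonic (M := M) (J := J) hN hAB (σ := τ)
        (fun hc => by rw [mem_level_mag hN] at hc; omega)
        (fun hc => by rw [mem_level_mag hN] at hc; omega)
      refine Eq.trans ?_ (neg_eq_zero.2 h3)
      rw [← hu]
      simp only [laplacian]
      rw [← Finset.sum_neg_distrib]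
      refine Finset.sum_congr rfl fun i _ => ?_
      have h4 : (if up (flip τ i) < ka then 1 - u (flip τ i) else 0) = 1 - u (flip τ i) := by
        split_ifs with h5
        · rfl
        · rw [h1 _ (by have := up_flip_le τ i; omega), sub_self]
      rw [h4, if_pos hτ]
      ring
    · exact Or.inl (if_neg hτ)

lemma harmonic_eq_zero (hN : 0 < N) {ka kb : ℕ} (hkk : ka < kb) {σ : Config N}
    (hσ : kb ≤ up σ) : harmonic M J (level N (mag N ka)) (level N (mag N kb)) σ = 0 := by
  have hAB := disjoint_level_mag hN hkk
  set u := harmonic M J (level N (mag N ka)) (level N (mag N kb)) with hu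
  have h1 : ∀ τ : Config N, up τ = kb → u τ = 0 := fun τ hτ => by
    rw [hu, harmonic, if_neg (fun hc => by rw [mem_level_mag hN] at hc; omega),
      if_pos ((mem_level_mag hN).2 hτ)]
  rcases hσ.lt_or_eq with h | h
  swap
  · exact h1 σ h.symm
  have h2 := eq_zero_of_laplacian (c := conductance M J)
    (v := fun τ => if kb < up τ then u τ else 0) conductance_pos conductance_flip
    (τ := fun _ => false) (fun τ => ?_) (by simp [up]) σ
  · rwa [if_pos h] at h2
  · by_cases hτ : kb < up τ
    · right
      have h3 := laplacian_harmonic (M := M) (J := J) hN hAB (σ := τ)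
        (fun hc => by rw [mem_level_mag hN] at hc; omega)
        (fun hc => by rw [mem_level_mag hN] at hc; omega)
      refine Eq.trans ?_ h3
      rw [← hu]
      simp only [laplacian]
      refine Finset.sum_congr rfl fun i _ => ?_
      have h4 : (if kb < up (flip τ i) then u (flip τ i) else 0) = u (flip τ i) := by
        split_ifs with h5
        · rfl
        · rw [h1 _ (by have := le_up_flip τ i; omega)]
      rw [h4, if_pos hτ]
    · exact Or.inl (if_neg hτ)

/-- The Dirichlet principle with the indicator of the configurations with at most `k` up-spins as a
trial function. -/
lemma energy_harmonic_le (hN : 0 < N) {ka k kb : ℕ} (hk : ka ≤ k) (hkb : k < kb) :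
    energy (conductance M J) (harmonic M J (level N (mag N ka)) (level N (mag N kb)))
        (harmonic M J (level N (mag N ka)) (level N (mag N kb)))
      ≤ N * ∑ σ ∈ upLevel N k, Real.exp (-M.β * hamiltonian M J σ) := by
  have hAB := disjoint_level_mag hN (hk.trans_lt hkb)
  set g : Config N → ℝ := fun σ => if up σ ≤ k then 1 else 0 with hg
  have h1 := energy_le_energy (c := conductance M J) (A := level N (mag N ka))
    (B := level N (mag N kb)) (u := harmonic M J (level N (mag N ka)) (level N (mag N kb)))
    (g := g) (fun σ i => (conductance_pos σ i).le) conductance_flip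
    (fun σ hσ => by rw [harmonic, if_pos hσ])
    (fun σ hσ => by rw [harmonic, if_neg (Set.disjoint_right.1 hAB hσ), if_pos hσ])
    (fun σ hA hB => laplacian_harmonic hN hAB hA hB)
    (fun σ hσ => if_pos (by rw [mem_level_mag hN] at hσ; omega))
    (fun σ hσ => if_neg (by rw [mem_level_mag hN] at hσ; omega))
  refine h1.trans ?_
  rw [energy_eq_sum_laplacian conductance_flip, upLevel, Finset.sum_filter, Finset.mul_sum]
  refine Finset.sum_le_sum fun σ _ => ?_
  by_cases h2 : up σ < k
  · have h3 : laplacian (conductance M J) g σ = 0 := by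
      refine Finset.sum_eq_zero fun i _ => ?_
      have := up_flip_le σ i
      simp only [hg]
      rw [if_pos h2.le, if_pos (by omega), sub_self, mul_zero]
    rw [h3, mul_zero, if_neg h2.ne, mul_zero]
  by_cases h3 : up σ = k
  · rw [if_pos h3]
    simp only [hg]
    rw [if_pos h3.le, one_mul]
    calc _ ≤ ∑ _i : Fin N, Real.exp (-M.β * hamiltonian M J σ) := by
          refine Finset.sum_le_sum fun i _ => ?_
          refine (mul_le_of_le_one_right (conductance_pos σ i).le ?_).trans (conductance_le σ i)
          beta_reduce
          rw [if_pos h3.le]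
          split_ifs <;> norm_num
      _ = _ := by simp
  · simp only [hg]
    rw [if_neg (by omega), if_neg h3, zero_mul, mul_zero]

end Hitting

/-! ### Beyond the saddle, the harmonic sum is negligible -/

section Saddle

variable {M : Params} {N : ℕ} {J : Couplings N}

lemma exists_mag_of_isClosestInGrid (hN : 0 < N) {m x : ℝ} (hm : m ∈ Set.Icc (-1 : ℝ) 1)
    (hx : IsClosestInGrid N m x) : ∃ k ≤ N, x = mag N k ∧ |mag N k - m| ≤ 1 / N := by
  obtain ⟨⟨k, hk, rfl⟩, hmin⟩ := hx
  have hN' : (0 : ℝ) < N := by exact_mod_cast hN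
  refine ⟨k, hk, rfl, ?_⟩
  set t := N * (1 + m) / 2 with ht
  have ht0 : 0 ≤ t := by
    have : 0 ≤ 1 + m := by linarith [hm.1]
    positivity
  have htN : t ≤ N := by
    have : N * (1 + m) ≤ N * 2 := by
      gcongr
      linarith [hm.2]
    linarith
  set l := ⌊t + 1 / 2⌋₊ with hl
  have h1 : (l : ℝ) ≤ t + 1 / 2 := Nat.floor_le (by linarith)
  have h2 : t + 1 / 2 < l + 1 := Nat.lt_floor_add_one _
  have hlN : l ≤ N := by
    have : (l : ℝ) < N + 1 := by linarith
    exact Nat.lt_succ_iff.1 (by exact_mod_cast this)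
  refine (hmin _ ⟨l, hlN, rfl⟩).trans ?_
  have e : -1 + 2 * (l : ℝ) / N - m = 2 * (l - t) / N := by
    rw [ht]
    field_simp
    ring
  rw [e, abs_div, abs_of_pos hN', div_le_div_iff_of_pos_right hN', abs_le]
  constructor <;> linarith

/-- The number of up-spins of the last level whose magnetisation is at most `m`. -/
noncomputable def levelBelow (N : ℕ) (m : ℝ) : ℕ := ⌊N * (1 + m) / 2⌋₊

lemma mag_le_iff (hN : 0 < N) {m : ℝ} (hm : -1 ≤ m) {k : ℕ} :
    mag N k ≤ m ↔ k ≤ levelBelow N m := by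
  have hN' : (0 : ℝ) < N := by exact_mod_cast hN
  have : 0 ≤ N * (1 + m) / 2 := by
    have : 0 ≤ 1 + m := by linarith
    positivity
  rw [levelBelow, Nat.le_floor_iff this, mag, ← le_sub_iff_add_le', div_le_iff₀ hN']
  constructor <;> intro h <;> linarith

lemma mag_succ (k : ℕ) : mag N (k + 1) = mag N k + 2 / N := by
  unfold mag
  push_cast
  ring

lemma mag_mono {k l : ℕ} (h : k ≤ l) : mag N k ≤ mag N l := by
  unfold mag
  gcongr

lemma cwExponent_succ_ge {k : ℕ} (hk : k < N) :
    cwExponent M N k - (2 * M.β + 2 * M.β * |M.h|) ≤ cwExponent M N (k + 1) := by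
  have hN' : (0 : ℝ) < N := by exact_mod_cast (Nat.zero_le k).trans_lt hk
  have hβ := M.β_pos
  have h1 := (mag_mem_Icc (N := N) hk.le).1
  have h2 := (mag_mem_Icc (N := N) (k := k + 1) hk).1
  have e : cwExponent M N (k + 1)
      = cwExponent M N k + M.β * (mag N k + mag N (k + 1)) + 2 * M.β * M.h := by
    rw [cwExponent, cwExponent, mag_succ]
    field_simp
    ring
  rw [e]
  have h3 := neg_abs_le M.h
  nlinarith

lemma sum_eq_sum_upLevel (G : Config N → ℝ) :
    ∑ σ, G σ = ∑ k ∈ Finset.range (N + 1), ∑ σ ∈ upLevel N k, G σ :=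
  (Finset.sum_fiberwise_of_maps_to (g := up)
    (fun σ _ => Finset.mem_range.2 (Nat.lt_succ_of_le (up_le σ))) G).symm

lemma partialCW_eq_sum_levelWeight {k : ℕ} (hk : k ≤ N) :
    partialCW M (Finset.univ.filter fun σ : Config N => up σ ≤ k)
      = ∑ j ∈ Finset.range (k + 1), levelWeight M N j := by
  have h0 : Finset.range (k + 1) ⊆ Finset.range (N + 1) :=
    Finset.range_subset_range.2 (by omega)
  rw [partialCW, Finset.sum_filter, sum_eq_sum_upLevel, ← Finset.sum_subset h0 fun j _ hj => ?_]
  · refine Finset.sum_congr rfl fun j hj => ?_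
    rw [levelWeight, ← card_upLevel, ← nsmul_eq_mul, ← Finset.sum_const]
    refine Finset.sum_congr rfl fun σ hσ => ?_
    rw [mem_upLevel] at hσ
    rw [Finset.mem_range] at hj
    rw [if_pos (by omega), hσ]
  · refine Finset.sum_eq_zero fun σ hσ => ?_
    rw [mem_upLevel] at hσ
    rw [Finset.mem_range] at hj
    exact if_neg (by omega)

/-- On typical couplings, the Boltzmann weights of a level are comparable to the Curie-Weiss
weight. -/
lemma sum_upLevel_boltzmann_le {ε : ℝ} (hJ : J ∈ typicalCouplings M N ε) (k : ℕ)
    {w : Config N → ℝ} (hw : ∀ σ, 0 ≤ w σ) :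
    ∑ σ ∈ upLevel N k, Real.exp (-M.β * hamiltonian M J σ) * w σ
      ≤ Real.exp (ε * N) * Real.exp (cwExponent M N k) * ∑ σ ∈ upLevel N k, w σ := by
  rw [Finset.mul_sum]
  refine Finset.sum_le_sum fun σ hσ => mul_le_mul_of_nonneg_right ?_ (hw σ)
  rw [← Real.exp_add]
  have := (abs_le.1 (hJ σ)).2
  rw [mem_upLevel.1 hσ] at this
  exact Real.exp_le_exp.2 (by linarith)

set_option maxHeartbeats 400000 in
/-- The capacity is controlled by the level `ks`, at the saddle, while the effective resistance
between level `k` and level `kb`, where the free energy decreases, is controlled by the inverse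
weight of level `k`, which cancels the Boltzmann weights of that level. -/
lemma sum_upLevel_harmonic_le {ε : ℝ} (hJ : J ∈ typicalCouplings M N ε) {ka ks k kb : ℕ}
    (hka : ka ≤ ks) (hks : ks < k) (hkb : k < kb) (hkN : kb ≤ N)
    (hf : ∀ j, k ≤ j → j < kb → freeEnergy M (mag N j) ≤ freeEnergy M (mag N k))
    {δ : ℝ} (hδ : 0 < δ) :
    ∑ σ ∈ upLevel N k, Real.exp (-M.β * hamiltonian M J σ) *
        harmonic M J (level N (mag N ka)) (level N (mag N kb)) σ
      ≤ Real.exp (ε * N) * (2 * Real.exp 1 * (N * (N + 1)) * Real.log (1 + 1 / δ) *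
          (2 * N * √N * Real.exp (2 * ε * N + (2 * M.β + 2 * M.β * |M.h|)) *
            Real.exp (-M.β * N * freeEnergy M (mag N ks)))
          + 2 * δ * Real.exp (-M.β * N * freeEnergy M (mag N k))) := by
  have hN : 0 < N := by omega
  have hN' : (0 : ℝ) < N := by exact_mod_cast hN
  have hβ := M.β_pos
  set C₀ := 2 * M.β + 2 * M.β * |M.h| with hC₀
  have hC₀0 : 0 ≤ C₀ := by positivity
  have hAB : Disjoint (level N (mag N ka)) (level N (mag N kb)) :=
    disjoint_level_mag hN (by omega)
  set u := harmonic M J (level N (mag N ka)) (level N (mag N kb)) with hu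
  have hu0 : ∀ σ, 0 ≤ u σ := fun σ => harmonic_nonneg σ
  set fk := Real.exp (-M.β * N * freeEnergy M (mag N k)) with hfk
  set r := fk * Real.exp (-(C₀ + ε * N)) / (2 * √N) with hr
  have hfk0 : 0 < fk := Real.exp_pos _
  have hr0 : 0 < r := by positivity
  have hE : energy (conductance M J) u u
      ≤ N * (Real.exp (ε * N) * Real.exp (-M.β * N * freeEnergy M (mag N ks))) := by
    refine (energy_harmonic_le hN hka (hks.trans hkb)).trans ?_
    gcongr
    have h1 := sum_upLevel_boltzmann_le hJ ks (w := fun _ => 1) (fun _ => zero_le_one)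
    simp only [mul_one, Finset.sum_const, card_upLevel, nsmul_eq_mul] at h1
    refine h1.trans ?_
    have h2 := levelWeight_le (M := M) hN (k := ks) (by omega)
    rw [levelWeight] at h2
    rw [mul_assoc, mul_comm (Real.exp (cwExponent M N ks))]
    gcongr
  have hcr : ∀ j, k ≤ j → j < kb → ∀ σ ∈ upLevel N j, ∀ i, σ i = false →
      r ≤ N.choose j * conductance M J σ i := by
    intro j hj hj' σ hσ i hi
    rw [mem_upLevel] at hσ
    have h1 := (abs_le.1 (hJ σ)).1
    have h2 := (abs_le.1 (hJ (flip σ i))).1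
    rw [up_flip_of_false hi] at h2
    rw [hσ] at h1 h2
    have h3 := cwExponent_succ_ge (M := M) (N := N) (k := j) (by omega)
    have h4 : Real.exp (cwExponent M N j - (C₀ + ε * N)) ≤ conductance M J σ i :=
      le_conductance (by linarith) (by linarith)
    have h5 := le_levelWeight_mul_sqrt (M := M) (N := N) (k := j) (by omega) (by omega)
    have h6 : fk ≤ Real.exp (-M.β * N * freeEnergy M (mag N j)) := by
      refine Real.exp_le_exp.2 ?_
      have := mul_le_mul_of_nonneg_left (hf j hj hj') (by positivity : 0 ≤ M.β * N)
      linarith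
    have h7 : √(N * (1 - mag N j ^ 2)) ≤ √N :=
      Real.sqrt_le_sqrt (mul_le_of_le_one_right hN'.le (by linarith [sq_nonneg (mag N j)]))
    have h8 : fk ≤ levelWeight M N j * (2 * √N) := by
      have := mul_le_mul_of_nonneg_left h7 (levelWeight_nonneg (M := M) (N := N) (k := j))
      linarith
    calc r = fk / (2 * √N) * Real.exp (-(C₀ + ε * N)) := by rw [hr]; ring
      _ ≤ levelWeight M N j * Real.exp (-(C₀ + ε * N)) := by
          gcongr
          rwa [div_le_iff₀ (by positivity)]
      _ = N.choose j * Real.exp (cwExponent M N j - (C₀ + ε * N)) := by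
          rw [levelWeight, mul_assoc, ← Real.exp_add]
          rfl
      _ ≤ _ := by gcongr
  have h1 := sum_level_harmonic_le (c := conductance M J) (u := u) (k := k) (k' := kb)
    (fun σ i => (conductance_pos σ i).le) conductance_flip
    (fun σ hσ => by rw [hu, harmonic, if_pos hσ])
    (fun σ hσ => by rw [hu, harmonic, if_neg (Set.disjoint_right.1 hAB hσ), if_pos hσ])
    (fun σ hA hB => laplacian_harmonic hN hAB hA hB) hu0 hδ hkb.le hkN
    (fun σ hσ => harmonic_eq_zero hN (by omega) (mem_upLevel.1 hσ).ge) hr0 hcr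
  have hlog : 0 ≤ Real.log (1 + 1 / δ) := Real.log_nonneg (by
    have : 0 < 1 / δ := by positivity
    linarith)
  have hlw : levelWeight M N k ≤ fk := levelWeight_le hN (by omega)
  refine (sum_upLevel_boltzmann_le hJ k hu0).trans ?_
  rw [mul_assoc]
  refine mul_le_mul_of_nonneg_left ?_ (Real.exp_pos _).le
  have hE0 := energy_self_nonneg (fun σ i => (conductance_pos (M := M) (J := J) σ i).le) u
  calc Real.exp (cwExponent M N k) * ∑ σ ∈ upLevel N k, u σ
      ≤ Real.exp (cwExponent M N k) * (N.choose k * (2 * Real.exp 1 * (N * (N + 1)) *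
          Real.log (1 + 1 / δ) * energy (conductance M J) u u / r + 2 * δ)) := by gcongr
    _ = levelWeight M N k * (2 * Real.exp 1 * (N * (N + 1)) *
          Real.log (1 + 1 / δ) * energy (conductance M J) u u / r + 2 * δ) := by
        rw [levelWeight]
        ring
    _ ≤ fk * (2 * Real.exp 1 * (N * (N + 1)) * Real.log (1 + 1 / δ) *
          (N * (Real.exp (ε * N) * Real.exp (-M.β * N * freeEnergy M (mag N ks)))) / r
            + 2 * δ) := by gcongr
    _ = _ := by
        have e1 : Real.exp (2 * ε * N + C₀) = Real.exp (ε * N) / Real.exp (-(C₀ + ε * N)) := by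
          rw [← Real.exp_sub]
          congr 1
          ring
        rw [e1, hr]
        field_simp

end Saddle

section DoubleWell

variable {M : Params} {mMinus mStar mPlus : ℝ} (W : IsDoubleWell M mMinus mStar mPlus)

namespace IsDoubleWell

include W

/-- The levels of `A`, of the saddle and of `B` are eventually ordered. -/
lemma eventually_levels : ∀ᶠ N : ℕ in atTop, ∀ ka kb : ℕ, |mag N ka - mMinus| ≤ 1 / N →
    |mag N kb - mPlus| ≤ 1 / N → ka ≤ levelBelow N mStar ∧ levelBelow N mStar < kb := by
  have hlim : Tendsto (fun N : ℕ => 1 / (N : ℝ)) atTop (𝓝 0) := tendsto_one_div_atTop_nhds_zero_nat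
  filter_upwards [eventually_gt_atTop 0, hlim.eventually_lt_const (sub_pos.2 W.lt_star),
    hlim.eventually_lt_const (sub_pos.2 W.star_lt)] with N hN h1 h2 ka kb ha hb
  have hm := W.mStar_mem.1.le
  have ha' := (abs_le.1 ha).2
  have hb' := (abs_le.1 hb).1
  rw [← mag_le_iff hN hm, ← not_le, ← mag_le_iff hN hm, not_le]
  constructor <;> linarith

lemma eventually_freeEnergy_levelBelow {γ : ℝ} (hγ : 0 < γ) : ∀ᶠ N : ℕ in atTop,
    freeEnergy M mStar - γ ≤ freeEnergy M (mag N (levelBelow N mStar)) := by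
  obtain ⟨d, hd, hcont⟩ := Metric.continuous_iff.1 (continuous_freeEnergy (M := M)) mStar γ hγ
  have hlim : Tendsto (fun N : ℕ => 2 * (1 / (N : ℝ))) atTop (𝓝 0) := by
    simpa using (tendsto_one_div_atTop_nhds_zero_nat (𝕜 := ℝ)).const_mul 2
  filter_upwards [eventually_gt_atTop 0, hlim.eventually_lt_const hd] with N hN h1
  have hm := W.mStar_mem.1.le
  have h2 := (mag_le_iff hN hm).2 le_rfl
  have h3 : ¬ mag N (levelBelow N mStar + 1) ≤ mStar := by
    rw [mag_le_iff hN hm]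
    omega
  rw [mag_succ] at h3
  have e : (2 : ℝ) / N = 2 * (1 / N) := by ring
  have h4 := hcont (mag N (levelBelow N mStar)) (by
    rw [Real.dist_eq, abs_lt]
    constructor <;> linarith)
  rw [Real.dist_eq] at h4
  linarith [(abs_lt.1 h4).1]

set_option maxHeartbeats 1000000 in
/-- On typical couplings, the configurations beyond the saddle contribute an exponentially small
fraction of `exp (-β N f(m₋))` to the harmonic sum. -/
lemma exists_sum_beyond_saddle_le : ∃ ε > 0, ∀ᶠ N : ℕ in atTop, ∀ ka kb : ℕ,
    |mag N ka - mMinus| ≤ 1 / N → |mag N kb - mPlus| ≤ 1 / N → kb ≤ N →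
    ∀ J ∈ typicalCouplings M N ε,
      ∑ σ ∈ Finset.univ.filter (fun σ : Config N => ¬ up σ ≤ levelBelow N mStar),
        Real.exp (-M.β * hamiltonian M J σ) *
          harmonic M J (level N (mag N ka)) (level N (mag N kb)) σ
      ≤ Real.exp (-M.β * N * freeEnergy M mMinus) := by
  have hβ := M.β_pos
  set g := freeEnergy M mStar - freeEnergy M mMinus with hg
  have hg0 : 0 < g :=
    sub_pos.2 (W.freeEnergy_lt ⟨W.mStar_mem.1.le, le_rfl⟩ W.lt_star.ne')
  set R := M.β * (freeEnergy M mStar - freeEnergy M mPlus) with hR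
  have hR0 : 0 ≤ R := mul_nonneg hβ.le (sub_nonneg.2
    (W.strictAntiOn_right ⟨le_rfl, W.star_lt.le⟩ ⟨W.star_lt.le, le_rfl⟩ W.star_lt).le)
  set C₀ := 2 * M.β + 2 * M.β * |M.h| with hC₀
  have hC₀0 : 0 ≤ C₀ := by positivity
  set K := 4 * Real.exp 1 * (1 + R) * Real.exp C₀ + 2 with hK
  have hK0 : 0 ≤ K := by positivity
  -- The exponential rate is `β g` from the height of the saddle, less `3 ε` from the fluctuations of
  -- the energies and `β g / 4` from the rounding of the saddle to the grid; the remaining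
  -- `3 β g / 8 = 7 c` beats the polynomial factor `(N + 1) ^ 7`.
  set ε := M.β * g / 8 with hε
  set c := 3 * (M.β * g) / 56 with hc
  refine ⟨ε, by positivity, ?_⟩
  filter_upwards [eventually_gt_atTop 0, W.eventually_levels,
    W.eventually_freeEnergy_levelBelow (γ := g / 4) (by positivity),
    eventually_succ_mul_exp_neg_le_one (c := c) (by positivity),
    (tendsto_natCast_atTop_atTop (R := ℝ)).eventually_ge_atTop K]
    with N hN hlev hsad hexp hNK ka kb ha hb hkb J hJ
  have hN' : (0 : ℝ) < N := by exact_mod_cast hN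
  obtain ⟨hka, hks⟩ := hlev ka kb ha hb
  set ks := levelBelow N mStar with hks_def
  set u := harmonic M J (level N (mag N ka)) (level N (mag N kb)) with hu
  set n : ℝ := N + 1 with hn
  have hn1 : 1 ≤ n := by linarith
  set e0 := Real.exp (-M.β * N * freeEnergy M mMinus) with he0
  set T := K * n ^ 5 * (Real.exp (-(7 * c) * N) * e0) with hT
  have hT0 : 0 ≤ T := by positivity
  have hmem : ∀ j, ks < j → j < kb → mag N j ∈ Set.Icc mStar mPlus := by
    intro j h1 h2
    have h3 : ¬ mag N j ≤ mStar := by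
      rw [mag_le_iff hN W.mStar_mem.1.le]
      omega
    have h4 : mag N (j + 1) ≤ mag N kb := mag_mono h2
    rw [mag_succ] at h4
    have h5 := (abs_le.1 hb).2
    have h6 : (1 : ℝ) / N ≤ 2 / N := by gcongr; norm_num
    exact ⟨(not_le.1 h3).le, by linarith⟩
  have hlevel : ∀ k ∈ Finset.range (N + 1), ∑ σ ∈ upLevel N k,
      (if ¬ up σ ≤ ks then Real.exp (-M.β * hamiltonian M J σ) * u σ else 0) ≤ T := by
    intro k _
    by_cases h1 : k ≤ ks
    · refine le_trans (le_of_eq (Finset.sum_eq_zero fun σ hσ => if_neg ?_)) hT0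
      rw [mem_upLevel.1 hσ]
      exact not_not.2 h1
    by_cases h2 : kb ≤ k
    · refine le_trans (le_of_eq (Finset.sum_eq_zero fun σ hσ => ?_)) hT0
      rw [hu, harmonic_eq_zero hN (hka.trans_lt hks) (by rwa [mem_upLevel.1 hσ]), mul_zero,
        ite_self]
    rw [not_le] at h1 h2
    have h3 : ∑ σ ∈ upLevel N k,
        (if ¬ up σ ≤ ks then Real.exp (-M.β * hamiltonian M J σ) * u σ else 0)
        = ∑ σ ∈ upLevel N k, Real.exp (-M.β * hamiltonian M J σ) * u σ :=
      Finset.sum_congr rfl fun σ hσ => if_pos (by rw [mem_upLevel.1 hσ]; omega)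
    rw [h3]
    have hk := hmem k h1 h2
    -- This `δ` makes the weight of the bottom of the right well comparable to that of the saddle.
    refine (sum_upLevel_harmonic_le hJ hka h1 h2 hkb (fun j hj hj' => ?_)
      (Real.exp_pos (-(R * N)))).trans ?_
    · exact W.strictAntiOn_right.antitoneOn hk (hmem j (by omega) hj') (mag_mono hj)
    have h4 : Real.log (1 + 1 / Real.exp (-(R * N))) ≤ (1 + R) * n := by
      have h5 : (1 : ℝ) ≤ Real.exp (R * N) := Real.one_le_exp (by positivity)
      have h6 : 1 + 1 / Real.exp (-(R * N)) ≤ Real.exp (1 + R * N) := by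
        rw [Real.exp_neg, one_div, inv_inv, Real.exp_add]
        have h7 := Real.add_one_le_exp (1 : ℝ)
        nlinarith
      have h7 := Real.log_le_log (by positivity) h6
      rw [Real.log_exp] at h7
      rw [hn]
      nlinarith
    have h5 : √(N : ℝ) ≤ n := by
      refine Real.sqrt_le_iff.2 ⟨by linarith, ?_⟩
      rw [hn]
      nlinarith
    have h6 : Real.exp (-M.β * N * freeEnergy M (mag N ks))
        ≤ Real.exp (-(3 / 4 * M.β * g) * N) * e0 := by
      rw [he0, ← Real.exp_add]
      refine Real.exp_le_exp.2 ?_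
      have := mul_le_mul_of_nonneg_left hsad (by positivity : 0 ≤ M.β * N)
      have e : freeEnergy M mStar = g + freeEnergy M mMinus := by rw [hg]; ring
      rw [e] at this
      linarith
    have h7 : Real.exp (-(R * N)) * Real.exp (-M.β * N * freeEnergy M (mag N k))
        ≤ Real.exp (2 * ε * N) * (Real.exp (-(3 / 4 * M.β * g) * N) * e0) := by
      rw [he0, ← Real.exp_add, ← Real.exp_add, ← Real.exp_add]
      refine Real.exp_le_exp.2 ?_
      have h8 : freeEnergy M mPlus ≤ freeEnergy M (mag N k) :=
        W.strictAntiOn_right.antitoneOn hk ⟨W.star_lt.le, le_rfl⟩ hk.2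
      have h9 := mul_le_mul_of_nonneg_left h8 (by positivity : 0 ≤ M.β * N)
      have h10 : 0 ≤ M.β * g * N := by positivity
      have e : freeEnergy M mMinus = freeEnergy M mStar - g := by rw [hg]; ring
      rw [hR, hε, e]
      linarith
    have h8 : Real.exp (ε * N) * (Real.exp (2 * ε * N) * (Real.exp (-(3 / 4 * M.β * g) * N) * e0))
        = Real.exp (-(7 * c) * N) * e0 := by
      rw [he0, ← Real.exp_add, ← Real.exp_add, ← Real.exp_add, ← Real.exp_add]
      congr 1
      rw [hε, hc]
      ring
    have hNn : (N : ℝ) ≤ n := by linarith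
    calc _ ≤ Real.exp (ε * N) * (2 * Real.exp 1 * (n * n) * ((1 + R) * n) *
          (2 * n * n * (Real.exp (2 * ε * N) * Real.exp C₀) *
            (Real.exp (-(3 / 4 * M.β * g) * N) * e0))
          + 2 * (n ^ 5 * (Real.exp (2 * ε * N) * (Real.exp (-(3 / 4 * M.β * g) * N) * e0)))) := by
          rw [Real.exp_add (2 * ε * N)]
          gcongr ?_ * (?_ + ?_)
          · have : 0 ≤ Real.log (1 + 1 / Real.exp (-(R * N))) := Real.log_nonneg (by
              have : 0 < 1 / Real.exp (-(R * N)) := by positivity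
              linarith)
            gcongr
          · rw [mul_assoc]
            gcongr 2 * ?_
            exact h7.trans (le_mul_of_one_le_left (by positivity) (one_le_pow₀ hn1))
      _ = K * n ^ 5 * (Real.exp (ε * N) *
            (Real.exp (2 * ε * N) * (Real.exp (-(3 / 4 * M.β * g) * N) * e0))) := by
          rw [hK]
          ring
      _ = T := by rw [h8]
  rw [Finset.sum_filter, sum_eq_sum_upLevel]
  calc _ ≤ ∑ _k ∈ Finset.range (N + 1), T := Finset.sum_le_sum hlevel
    _ = n * T := by simp [hn]
    _ = K * n ^ 6 * Real.exp (-(7 * c) * N) * e0 := by rw [hT]; ring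
    _ ≤ n * n ^ 6 * Real.exp (-(7 * c) * N) * e0 := by
        gcongr
        linarith
    _ = (n * Real.exp (-c * N)) ^ 7 * e0 := by
        rw [mul_pow, ← Real.exp_nat_mul]
        have : -(7 * c) * N = (7 : ℕ) * (-c * N) := by push_cast; ring
        rw [this]
        ring
    _ ≤ 1 * e0 := by
        gcongr
        exact pow_le_one₀ (by positivity) hexp
    _ = e0 := one_mul _

end IsDoubleWell

end DoubleWell

/-! ### Bounds on the harmonic sum with high probability -/

section HarmonicSum

variable {M : Params} {N : ℕ}

lemma partitionFn_pos (J : Couplings N) : 0 < partitionFn M J :=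
  Finset.sum_pos (fun _ _ => Real.exp_pos _) Finset.univ_nonempty

lemma harmonicSum_eq (J : Couplings N) (a b : ℝ) : harmonicSum M J a b
    = (∑ σ, Real.exp (-M.β * hamiltonian M J σ) * harmonic M J (level N a) (level N b) σ) /
      partitionFn M J := by
  rw [harmonicSum, Finset.sum_div]
  exact Finset.sum_congr rfl fun σ _ => by rw [gibbs]; ring

lemma wellWeight_eq (J : Couplings N) (m : ℝ) : wellWeight M J m
    = Real.exp (-M.β * N * freeEnergy M m) /
      √((1 - m ^ 2) * (M.β * iteratedDeriv 2 (freeEnergy M) m)) / partitionFn M J := by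
  rw [wellWeight, div_div, mul_comm (partitionFn M J)]

lemma nonempty_filter_up_le (k : ℕ) :
    (Finset.univ.filter fun σ : Config N => up σ ≤ k).Nonempty :=
  ⟨fun _ => false, Finset.mem_filter.2 ⟨Finset.mem_univ _, by simp [up]⟩⟩

lemma one_sub_measureReal_le {Ω : Type*} [MeasurableSpace Ω] (P : Measure Ω)
    [IsProbabilityMeasure P] {S T : Set Ω} (h : Sᶜ ⊆ T) : 1 - P.real T ≤ P.real S := by
  have h1 := measureReal_union_le (μ := P) S Sᶜ
  rw [Set.union_compl_self, probReal_univ] at h1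
  have h2 : P.real Sᶜ ≤ P.real T := measureReal_mono h (measure_ne_top _ _)
  linarith

variable {mMinus mStar mPlus : ℝ} (W : IsDoubleWell M mMinus mStar mPlus)

namespace IsDoubleWell

include W

/-- Bounding the hitting probability by `1` up to the saddle. -/
lemma eventually_harmonicSum_le {c₁ c₂ : ℝ} (hT : IsTalagrandPair c₁ c₂) {s ρ : ℝ} (hs : 8 ≤ s)
    (hρ : 0 < ρ) : ∀ᶠ N : ℕ in atTop, ∀ ka kb : ℕ, |mag N ka - mMinus| ≤ 1 / N →
      |mag N kb - mPlus| ≤ 1 / N → kb ≤ N →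
      1 - (c₁ * Real.exp (-(2 * c₂ * M.p ^ 2 / M.β ^ 2) * (s / 4) ^ 2) + ρ)
        ≤ (couplingLaw M N).real {J | harmonicSum M J (mag N ka) (mag N kb)
            ≤ Real.exp (alpha M + s) * wellWeight M J mMinus} := by
  obtain ⟨ε, hε, hbeyond⟩ := W.exists_sum_beyond_saddle_le
  filter_upwards [eventually_gt_atTop 0, hbeyond, W.eventually_levels,
    eventually_typicalCouplings M hε hρ, eventually_measure_partialZ_gt_le M hT,
    W.sum_levelWeight_le] with N hN hbey hlev htyp htail hsum ka kb ha hb hkb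
  obtain ⟨-, hks⟩ := hlev ka kb ha hb
  set ks := levelBelow N mStar with hks_def
  set S : Finset (Config N) := Finset.univ.filter fun σ => up σ ≤ ks with hS
  set e0 := Real.exp (-M.β * N * freeEnergy M mMinus) with he0
  set D := (1 - mMinus ^ 2) * (M.β * iteratedDeriv 2 (freeEnergy M) mMinus) with hD
  have hD0 : 0 < √D := Real.sqrt_pos.2 W.prefactor_pos
  have hCW : partialCW M S ≤ 10 * (e0 / √D) := by
    rw [hS, partialCW_eq_sum_levelWeight (by omega)]
    refine le_trans (le_of_eq (Finset.sum_congr ?_ fun _ _ => rfl)) hsum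
    ext k
    simp only [Finset.mem_range, Finset.mem_filter, mag_le_iff hN W.mStar_mem.1.le, ← hks_def]
    omega
  have hr := htail S (nonempty_filter_up_le ks) (s / 4) (by linarith)
  refine le_trans ?_ (one_sub_measureReal_le (couplingLaw M N)
    (T := (typicalCouplings M N ε)ᶜ ∪
      {J | Real.exp (alpha M + 1 + s / 4) * partialCW M S < partialZ M S J}) ?_)
  · have := measureReal_union_le (μ := couplingLaw M N) (typicalCouplings M N ε)ᶜ
      {J | Real.exp (alpha M + 1 + s / 4) * partialCW M S < partialZ M S J}
    linarith
  rw [Set.compl_subset_comm, Set.compl_union, compl_compl]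
  rintro J ⟨hJ1, hJ2⟩
  rw [Set.mem_compl_iff, Set.mem_ofPred_eq, not_lt] at hJ2
  rw [Set.mem_ofPred_eq, harmonicSum_eq, wellWeight_eq, ← mul_div_assoc]
  refine div_le_div_of_nonneg_right ?_ (partitionFn_pos J).le
  rw [← Finset.sum_filter_add_sum_filter_not Finset.univ (fun σ : Config N => up σ ≤ ks)]
  have h1 : ∑ σ ∈ S, Real.exp (-M.β * hamiltonian M J σ) *
      harmonic M J (level N (mag N ka)) (level N (mag N kb)) σ ≤ partialZ M S J :=
    Finset.sum_le_sum fun σ _ => mul_le_of_le_one_right (Real.exp_pos _).le (harmonic_le_one σ)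
  have h2 := hbey ka kb ha hb hkb J hJ1
  have h3 : e0 ≤ e0 / √D :=
    le_div_self (Real.exp_pos _).le hD0 W.sqrt_prefactor_le_one
  have hα := alpha_nonneg (M := M)
  have h4 : 11 * Real.exp (alpha M + 1 + s / 4) ≤ Real.exp (alpha M + s) := by
    have h5 : (11 : ℝ) ≤ Real.exp 5 := by
      have h6 : Real.exp 5 = Real.exp 1 ^ 5 := by
        rw [← Real.exp_nat_mul]
        norm_num
      have h7 : (2 : ℝ) ^ 5 ≤ Real.exp 1 ^ 5 := by
        gcongr
        linarith [Real.add_one_le_exp (1 : ℝ)]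
      rw [h6]
      linarith
    calc _ ≤ Real.exp 5 * Real.exp (alpha M + 1 + s / 4) := by gcongr
      _ = Real.exp (5 + (alpha M + 1 + s / 4)) := (Real.exp_add _ _).symm
      _ ≤ _ := Real.exp_le_exp.2 (by linarith)
  have h5 : 1 ≤ Real.exp (alpha M + 1 + s / 4) := Real.one_le_exp (by linarith)
  have h6 : 0 < e0 / √D := div_pos (Real.exp_pos _) hD0
  calc _ ≤ partialZ M S J + e0 := add_le_add h1 h2
    _ ≤ Real.exp (alpha M + 1 + s / 4) * (10 * (e0 / √D))
        + Real.exp (alpha M + 1 + s / 4) * (e0 / √D) :=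
        add_le_add (hJ2.trans (by gcongr)) (h3.trans (le_mul_of_one_le_left h6.le h5))
    _ = 11 * Real.exp (alpha M + 1 + s / 4) * (e0 / √D) := by ring
    _ ≤ _ := by gcongr

/-- The hitting probability equals `1` up to the level of `A`. -/
lemma eventually_le_harmonicSum {c₁ c₂ : ℝ} (hT : IsTalagrandPair c₁ c₂) {s : ℝ}
    (hs : M.β / 2 + 5 + 2 * (M.β / (M.p * √(2 * c₂))) ≤ 3 / 4 * s) (hs0 : 0 ≤ s) :
    ∀ᶠ N : ℕ in atTop, ∀ ka kb : ℕ, |mag N ka - mMinus| ≤ 1 / N →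
      |mag N kb - mPlus| ≤ 1 / N → ka ≤ N →
      1 - c₁ * Real.exp (-(2 * c₂ * M.p ^ 2 / M.β ^ 2) * (s / 4) ^ 2)
        ≤ (couplingLaw M N).real {J | Real.exp (kappa M c₁ c₂ - s) * wellWeight M J mMinus
            ≤ harmonicSum M J (mag N ka) (mag N kb)} := by
  filter_upwards [eventually_gt_atTop 0, W.eventually_levels,
    eventually_measure_partialZ_lt_le M hT, W.le_sum_levelWeight]
    with N hN hlev htail hsum ka kb ha hb hka
  obtain ⟨hks, hks'⟩ := hlev ka kb ha hb
  set S : Finset (Config N) := Finset.univ.filter fun σ => up σ ≤ ka with hS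
  set e0 := Real.exp (-M.β * N * freeEnergy M mMinus) with he0
  set D := (1 - mMinus ^ 2) * (M.β * iteratedDeriv 2 (freeEnergy M) mMinus) with hD
  have hCW : e0 / √D ≤ 40 * partialCW M S := by
    rw [hS, partialCW_eq_sum_levelWeight hka]
    exact hsum ka hka ha
  have hr := htail S (nonempty_filter_up_le ka) (s / 4) (by linarith)
  refine (sub_le_sub_left hr 1).trans (one_sub_measureReal_le (couplingLaw M N) ?_)
  set C := M.β / 2 + 1 + 2 * (M.β / (M.p * √(2 * c₂))) with hC
  rw [Set.compl_subset_comm]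
  intro J hJ
  rw [Set.mem_compl_iff, Set.mem_ofPred_eq, not_lt] at hJ
  rw [Set.mem_ofPred_eq, harmonicSum_eq, wellWeight_eq, ← mul_div_assoc]
  refine div_le_div_of_nonneg_right ?_ (partitionFn_pos J).le
  have h1 : partialZ M S J ≤ ∑ σ, Real.exp (-M.β * hamiltonian M J σ) *
      harmonic M J (level N (mag N ka)) (level N (mag N kb)) σ := by
    calc partialZ M S J = ∑ σ ∈ S, Real.exp (-M.β * hamiltonian M J σ) *
          harmonic M J (level N (mag N ka)) (level N (mag N kb)) σ := by
          refine Finset.sum_congr rfl fun σ hσ => ?_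
          rw [harmonic_eq_one hN (hks.trans_lt hks') hka (Finset.mem_filter.1 hσ).2, mul_one]
      _ ≤ _ := Finset.sum_le_sum_of_subset_of_nonneg (Finset.subset_univ _) fun σ _ _ =>
          mul_nonneg (Real.exp_pos _).le (harmonic_nonneg σ)
  refine le_trans ?_ (hJ.trans h1)
  have hCW0 := partialCW_pos (M := M) (nonempty_filter_up_le (N := N) ka)
  have h2 : Real.exp (kappa M c₁ c₂ - s) * 40 ≤ Real.exp (kappa M c₁ c₂ - C - s / 4) := by
    have h5 : (40 : ℝ) ≤ Real.exp 4 := by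
      have h6 : Real.exp 4 = Real.exp 1 ^ 4 := by
        rw [← Real.exp_nat_mul]
        norm_num
      have h7 : (2.7 : ℝ) ^ 4 ≤ Real.exp 1 ^ 4 := by
        gcongr
        linarith [Real.exp_one_gt_d9]
      rw [h6]
      norm_num at h7
      linarith
    calc _ ≤ Real.exp (kappa M c₁ c₂ - s) * Real.exp 4 := by gcongr
      _ = Real.exp (kappa M c₁ c₂ - s + 4) := (Real.exp_add _ _).symm
      _ ≤ _ := Real.exp_le_exp.2 (by linarith)
  calc _ ≤ Real.exp (kappa M c₁ c₂ - s) * (40 * partialCW M S) := by gcongr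
    _ = Real.exp (kappa M c₁ c₂ - s) * 40 * partialCW M S := by ring
    _ ≤ _ := by gcongr

end IsDoubleWell

end HarmonicSum

end RDCW

open RDCW
theorem theorem1p5 :
    (∃ c₁ c₂ : ℝ, IsTalagrandPair c₁ c₂) ∧
    ∀ c₁ c₂ : ℝ, IsTalagrandPair c₁ c₂ →
      ∃ k₁ > (0 : ℝ), ∃ k > (0 : ℝ),
        ∀ (M : Params) (mMinus mStar mPlus : ℝ) (a b : ℕ → ℝ) (s : ℝ),
          1 < M.β → 0 < M.h → IsDoubleWell M mMinus mStar mPlus →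
          (∀ N, 1 ≤ N → IsClosestInGrid N mMinus (a N)) →
          (∀ N, 1 ≤ N → IsClosestInGrid N mPlus (b N)) →
          0 < s →
          (∃ ε : ℕ → ℝ, Tendsto ε atTop (𝓝 0) ∧ ∀ᶠ N : ℕ in atTop,
            1 - k₁ * Real.exp (-(k * M.p ^ 2 / M.β ^ 2) * s ^ 2) ≤
              (couplingLaw M N).real {J | harmonicSum M J (a N) (b N) ≤
                Real.exp (alpha M + s) * wellWeight M J mMinus * (1 + ε N)}) ∧
          (∃ ε : ℕ → ℝ, Tendsto ε atTop (𝓝 0) ∧ ∀ᶠ N : ℕ in atTop,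
            1 - k₁ * Real.exp (-(k * M.p ^ 2 / M.β ^ 2) * s ^ 2) ≤
              (couplingLaw M N).real {J | Real.exp (kappa M c₁ c₂ - s) *
                wellWeight M J mMinus * (1 + ε N) ≤ harmonicSum M J (a N) (b N)}) := by
  refine ⟨⟨2, 1 / 16, isTalagrandPair_two⟩, fun c₁ c₂ hT => ?_⟩
  have hc1 := one_le_of_isTalagrandPair hT
  have hc2 := hT.2.1
  -- Below the threshold `L * β / p` on `s`, the constant `k₁` makes the claim void.
  set L := 8 + 4 / √(2 * c₂) with hL
  have hL0 : 0 < L := by positivity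
  -- A deviation `s / 4` of `log (partialZ M S)` has probability at most `c₁ exp (-k p² s² / β²)`.
  set k := c₂ / 8 with hk
  have hk0 : 0 < k := by positivity
  refine ⟨(c₁ + 1) * Real.exp (k * L ^ 2), by positivity, k, hk0, ?_⟩
  intro M mMinus mStar mPlus a b s hβ1 _ W ha hb hs
  have hβ := M.β_pos
  have hp := M.p_pos
  have hp1 := M.p_lt_one
  set x := Real.exp (-(k * M.p ^ 2 / M.β ^ 2) * s ^ 2) with hx
  have hx0 : 0 < x := Real.exp_pos _
  rcases lt_or_ge s (L * (M.β / M.p)) with hsL | hsL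
  · have hvoid : 1 - (c₁ + 1) * Real.exp (k * L ^ 2) * x ≤ 0 := by
      have h1 : 1 ≤ Real.exp (k * L ^ 2) * x := by
        rw [hx, ← Real.exp_add]
        refine Real.one_le_exp ?_
        have h2 : s ^ 2 ≤ (L * (M.β / M.p)) ^ 2 := pow_le_pow_left₀ hs.le hsL.le 2
        have h3 : k * M.p ^ 2 / M.β ^ 2 * s ^ 2
            ≤ k * M.p ^ 2 / M.β ^ 2 * (L * (M.β / M.p)) ^ 2 := by gcongr
        have h4 : k * M.p ^ 2 / M.β ^ 2 * (L * (M.β / M.p)) ^ 2 = k * L ^ 2 := by field_simp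
        linarith
      nlinarith
    exact ⟨⟨0, tendsto_const_nhds, Eventually.of_forall fun N => hvoid.trans measureReal_nonneg⟩,
      ⟨0, tendsto_const_nhds, Eventually.of_forall fun N => hvoid.trans measureReal_nonneg⟩⟩
  have hβp : 1 ≤ M.β / M.p := (one_le_div hp).2 (by linarith)
  have hβp' : M.β ≤ M.β / M.p := le_div_self hβ.le hp hp1.le
  have htail : c₁ * Real.exp (-(2 * c₂ * M.p ^ 2 / M.β ^ 2) * (s / 4) ^ 2) = c₁ * x := by
    rw [hx, hk]
    congr 2
    ring
  have hk1 : (c₁ + 1) * x ≤ (c₁ + 1) * Real.exp (k * L ^ 2) * x := by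
    have : 1 ≤ Real.exp (k * L ^ 2) := Real.one_le_exp (by positivity)
    gcongr
    exact le_mul_of_one_le_right (by positivity) this
  have hs3 : M.β / 2 + 5 + 2 * (M.β / (M.p * √(2 * c₂))) ≤ 3 / 4 * s := by
    have h1 : M.β / (M.p * √(2 * c₂)) = 1 / √(2 * c₂) * (M.β / M.p) := by ring
    have h2 : L * (M.β / M.p) = 8 * (M.β / M.p) + 4 * (1 / √(2 * c₂) * (M.β / M.p)) := by
      rw [hL]
      ring
    have h3 : 0 ≤ 1 / √(2 * c₂) * (M.β / M.p) := by positivity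
    rw [h1]
    linarith
  have hs8 : 8 ≤ s := by
    have h1 : 0 ≤ 4 / √(2 * c₂) := by positivity
    have h2 : 8 ≤ L := by linarith
    nlinarith
  refine ⟨⟨0, tendsto_const_nhds, ?_⟩, ⟨0, tendsto_const_nhds, ?_⟩⟩
  · filter_upwards [eventually_gt_atTop 0, W.eventually_harmonicSum_le hT hs8 hx0] with N hN h
    obtain ⟨ka, -, ha', hka⟩ :=
      exists_mag_of_isClosestInGrid hN (Set.Ioo_subset_Icc_self W.mMinus_mem) (ha N hN)
    obtain ⟨kb, hkb', hb', hkb⟩ :=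
      exists_mag_of_isClosestInGrid hN (Set.Ioo_subset_Icc_self W.mPlus_mem) (hb N hN)
    have h1 := h ka kb hka hkb hkb'
    rw [htail] at h1
    simp only [ha', hb', Pi.zero_apply, add_zero, mul_one]
    linarith
  · filter_upwards [eventually_gt_atTop 0, W.eventually_le_harmonicSum hT hs3 hs.le] with N hN h
    obtain ⟨ka, hka', ha', hka⟩ :=
      exists_mag_of_isClosestInGrid hN (Set.Ioo_subset_Icc_self W.mMinus_mem) (ha N hN)
    obtain ⟨kb, -, hb', hkb⟩ :=
      exists_mag_of_isClosestInGrid hN (Set.Ioo_subset_Icc_self W.mPlus_mem) (hb N hN)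
    have h1 := h ka kb hka hkb hka'
    rw [htail] at h1
    simp only [ha', hb', Pi.zero_apply, add_zero, mul_one]
    linarith
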